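/- **Setting.** Let $X=L^2(\mathbb R^3;\mathbb C)$. The Rollnik class $R$ is the set of measurable $W:\mathbb R^3\to\mathbb C$ with $\iint |W(x)W(y)|\,|x-y|^{-2}\,dx\,dy<\infty$. **Theorem.** Let $V:\mathbb R\times\mathbb R^3\to\mathbb R$ be measurable and such that $t\mapsto V(t,x)$ is continuously differentiable for a.e. $x$, with derivative $\dot V(t,x)$. Suppose that for every bounded interval $(a,b)$ there is a real function $W\in R$ (which may depend on $(a,b)$) with $|V(t,x)|\le W(x)$ and $|\dot V(t,x)|\le W(x)$ for a.e. $x$ and all $t\in(a,b)$. Then: 1. (Form sum.) For every $t\in\mathbb R$ there are $a<1$ and $b\in\mathbb R$ with $\int |V(t)||u|^2\le a\|\nabla u\|^2+b\|u\|^2$ for all $u\in H^1(\mathbb R^3)$, and the operator $H(t)=-\Delta+V(t)$ associated with the quadratic form $q_t(w,u)=\langle\nabla w,\nabla u\rangle+\int V(t)\bar w u$ on $H^1(\mathbb R^3)$ (that is, $u\in D(H(t))$, $H(t)u=f$ if and only if $u\in H^1$ and $q_t(w,u)=\langle w,f\rangle$ for all $w\in H^1$) is self-adjoint on $X$. 2.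 (Sohr's hypotheses.) For every $r>0$ there are $\beta,k>0$ such that, for $|t|\le r$, $H(t)\ge 1-\beta$, the map $t\mapsto(\beta+H(t))^{-1}$ is weakly continuously differentiable on $[-r,r]$, and $$\tfrac12\tfrac{d}{dt}\langle x,(\beta+H(t))^{-1}x\rangle+k\langle x,(\beta+H(t))^{-1}x\rangle\ge0\qquad(x\in X).$$ 3. (Evolution semigroup conditions, $p=2$.) Put $A(t)=-iH(t)$. Let $F_2$ be the space of all $f\in W^{1,2}(\mathbb R,X)$ with $f(t)\in D(A(t))$ for a.e. $t$ and $A(\cdot)f\in L^2(\mathbb R,X)$, and let $G_0=-\frac{d}{dt}+A(\cdot)$ on $F_2$. Then the $A(t)$ are generators of strongly continuous semigroups and form a Kato-stable family: there are $M,w>0$ with $(w,\infty)\subset\rho(A(t))$ for all $t$ and $\|R(\lambda,A(t_k))\cdots R(\lambda,A(t_1))\|\le M(\lambda-w)^{-k}$ for $\lambda>w$ and $t_1\le\dots\le t_k$. For some $w'>w$ the map $t\mapsto R(w',A(t))$ is strongly continuous and $(w'-G_0)F_2$ is dense in $L^2(\mathbb R,X)$. Moreover $F_2$ is dense in $L^2(\mathbb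 R,X)$ and in $C_0(\mathbb R,X)$. The same conditions hold for the adjoints $A(t)^*$, both with $-\frac{d}{dt}+A(\cdot)^*$ and, after time reversal $t\mapsto -t$ (under which it becomes $-\frac{d}{dt}+A(-\cdot)^*$), with $\frac{d}{dt}+A(\cdot)^*$, in place of $G_0$. 4. (Propagator.) There is a unitary evolution family $U(t,s)$, $t,s\in\mathbb R$, on $X$ (unitary operators with $U(t,r)U(r,s)=U(t,s)$, $U(t,t)=1$, and $(t,s)\mapsto U(t,s)$ strongly continuous) such that for all $s\in\mathbb R$, $x\in X$ the function $u=U(\cdot,s)x$ is the unique mild solution and the unique continuous weak solution on $\mathbb R$ of $\dot u(t)=A(t)u(t)$, $u(s)=x$. Here $u\in C(\mathbb R,X)$ is a *mild solution* if $u(s)=x$ and for each $d>|s|$ there are $u_n\in W^{1,2}((-d,d),X)$ with $u_n(t)\in D(A(t))$ for a.e. $t$, $A(\cdot)u_n\in L^2([-d,d],X)$, $u_n\to u$ uniformly on $[-d,d]$ and $-\dot u_n+A(\cdot)u_n\to0$ in $L^2([-d,d],X)$. A function $u\in C(\mathbb R,X)$ is a *continuous weak solution* if $u(s)=x$ and $\int_{\mathbb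 R}\langle u(\tau),\dot v(\tau)+A(\tau)^*v(\tau)\rangle\,d\tau=0$ for all compactly supported $v\in W^{1,2}(\mathbb R,X)$ with $v(\tau)\in D(A(\tau)^*)$ a.e. and $A(\cdot)^*v\in L^2(\mathbb R,X)$. -/

import Mathlib

open MeasureTheory Set Filter Topology
open scoped SchwartzMap LineDeriv ComplexConjugate ENNReal InnerProductSpace ZeroAtInfty

noncomputable section

namespace RollnikSchroedinger

section Abstract

variable {X : Type*} [NormedAddCommGroup X] [InnerProductSpace ℂ X]

/-! ### Unbounded operators: resolvents and generators of strongly continuous semigroups -/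

/-- `z` lies in the resolvent set of the unbounded operator `A` and
`R = (z - A)⁻¹` (everywhere defined and bounded). -/
def IsResolvent (A : X →ₗ.[ℂ] X) (z : ℂ) (R : X →L[ℂ] X) : Prop :=
  (∀ x : X, ∃ h : R x ∈ A.domain, z • R x - A ⟨R x, h⟩ = x) ∧
    ∀ u : A.domain, R (z • (u : X) - A u) = u

/-- `A` is the (infinitesimal) generator of a strongly continuous semigroup `(T σ)_{σ ≥ 0}`. -/
def IsGenerator (A : X →ₗ.[ℂ] X) : Prop :=
  ∃ T : ℝ → X →L[ℂ] X,
    T 0 = 1 ∧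
    (∀ σ τ : ℝ, 0 ≤ σ → 0 ≤ τ → T (σ + τ) = T σ * T τ) ∧
    (∀ x : X, ContinuousOn (fun σ => T σ x) (Ici 0)) ∧
    ∀ x y : X, (x, y) ∈ A.graph ↔
      Tendsto (fun σ : ℝ => σ⁻¹ • (T σ x - x)) (𝓝[>] 0) (𝓝 y)

/-- Kato stability of the family `A(t)`, `t ∈ ℝ`, with constants `M`, `w`.  The products of
resolvents are time ordered, the factor with the largest time standing on the left. -/
def IsKatoStable (A : ℝ → X →ₗ.[ℂ] X) (M w : ℝ) : Prop :=
  ∀ l : ℝ, w < l → ∃ R : ℝ → X →L[ℂ] X,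
    (∀ t, IsResolvent (A t) (l : ℂ) (R t)) ∧
    ∀ ts : List ℝ, ts.Pairwise (fun t t' => t ≥ t') →
      ‖(ts.map R).prod‖ ≤ M * ((l - w) ^ ts.length)⁻¹

/-! ### Function spaces in the time variable -/

/-- `f ∈ W^{1,2}` on the interval `J` with derivative `g`, where `f` is the continuous
representative (continuous up to the end points of `J`): `f` and `g` are square integrable and `f`
is an indefinite integral of `g`. -/
structure IsW12 (J : Set ℝ) (f g : ℝ → X) : Prop where
  memLp : MemLp f 2 (volume.restrict J)
  memLp_deriv : MemLp g 2 (volume.restrict J)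
  sub_eq_integral : ∀ s ∈ J, ∀ t ∈ J, f t - f s = ∫ τ in s..t, g τ

/-- `f ∈ W^{1,2}(J, X)`, `f(t) ∈ D(A(t))` for a.e. `t ∈ J`, and `A(·)f(·) ∈ L²(J, X)`;
here `g` is the derivative of `f` and `h = A(·)f(·)`. For `J = ℝ` these `f` form the space
`F₂`, the domain of `G₀ = -d/dt + A(·)` in `L²(ℝ, X)`. -/
structure IsRegular (A : ℝ → X →ₗ.[ℂ] X) (J : Set ℝ) (f g h : ℝ → X) : Prop where
  isW12 : IsW12 J f g
  mem_graph : ∀ᵐ t ∂(volume.restrict J), (f t, h t) ∈ (A t).graph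
  memLp_apply : MemLp h 2 (volume.restrict J)

/-- The conditions, with `p = 2` and time interval `ℝ`, under which the closure of
`G₀ = -d/dt + A(·)`, defined on `F₂`, generates an evolution semigroup on `L²(ℝ, X)`:
the `A(t)` are Kato-stable generators with constants `(M, w)`; for some `w' > w` the resolvent
`R(w', A(t))` is strongly continuous in `t` and the range `(w' - G₀) F₂` is dense in `L²(ℝ, X)`;
`F₂` is dense in `L²(ℝ, X)` and in `C₀(ℝ, X)`. -/
def EvolutionConditions (A : ℝ → X →ₗ.[ℂ] X) : Prop :=
  (∀ t, IsGenerator (A t)) ∧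
  ∃ M w : ℝ, 0 < M ∧ 0 < w ∧ IsKatoStable A M w ∧
    (∃ w' : ℝ, w < w' ∧
      (∃ R : ℝ → X →L[ℂ] X, (∀ t, IsResolvent (A t) (w' : ℂ) (R t)) ∧
        ∀ x, Continuous fun t => R t x) ∧
      ∀ φ : ℝ → X, MemLp φ 2 volume → ∀ ε : ℝ≥0∞, 0 < ε → ∃ f g h : ℝ → X,
        IsRegular A univ f g h ∧
        eLpNorm (fun t => φ t - (w' • f t - (-g t + h t))) 2 volume ≤ ε) ∧
    (∀ φ : ℝ → X, MemLp φ 2 volume → ∀ ε : ℝ≥0∞, 0 < ε → ∃ f g h : ℝ → X,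
      IsRegular A univ f g h ∧ eLpNorm (fun t => φ t - f t) 2 volume ≤ ε) ∧
    ∀ φ : C₀(ℝ, X), ∀ ε : ℝ, 0 < ε → ∃ f g h : ℝ → X,
      IsRegular A univ f g h ∧ ∀ t, ‖φ t - f t‖ ≤ ε

/-- The same conditions for the operator `d/dt + A(·)` (right shifts being replaced by left
shifts). The reflection `t ↦ -t` turns `d/dt + A(t)` into `-d/dt + A(-t)`. -/
def BackwardEvolutionConditions (A : ℝ → X →ₗ.[ℂ] X) : Prop :=
  EvolutionConditions fun t => A (-t)

/-! ### Solutions of the nonautonomous Cauchy problem `u'(t) = A(t) u(t)`, `u(s) = x` -/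

/-- `u` is an (`L²`-)mild solution on `ℝ`: it is continuous, `u(s) = x`, and on every
interval `[-d, d]`, `d > |s|`, it is the uniform limit of functions `uₙ ∈ W^{1,2}` with
`uₙ(t) ∈ D(A(t))` a.e., `A(·)uₙ ∈ L²` and `-uₙ' + A(·)uₙ → 0` in `L²`. -/
structure IsMildSolution (A : ℝ → X →ₗ.[ℂ] X) (s : ℝ) (x : X) (u : ℝ → X) : Prop where
  continuous : Continuous u
  initial : u s = x
  approx : ∀ d : ℝ, |s| < d → ∃ f g h : ℕ → ℝ → X,
    (∀ n, IsRegular A (Icc (-d) d) (f n) (g n) (h n)) ∧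
    TendstoUniformlyOn f u atTop (Icc (-d) d) ∧
    Tendsto (fun n => eLpNorm (fun t => -g n t + h n t) 2 (volume.restrict (Icc (-d) d)))
      atTop (𝓝 0)

/-- A unitary evolution family (unitary propagator) with time interval `ℝ`, strongly continuous
and exponentially bounded. Being invertible, it is indexed by all pairs `(t, s) ∈ ℝ²`. -/
structure IsUnitaryPropagator [CompleteSpace X] (U : ℝ → ℝ → X →L[ℂ] X) : Prop where
  comp : ∀ t r s, U t r * U r s = U t s
  refl : ∀ t, U t t = 1
  unitary : ∀ t s, U t s ∈ unitary (X →L[ℂ] X)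
  continuous : ∀ x, Continuous fun p : ℝ × ℝ => U p.1 p.2 x
  expBounded : ∃ M w : ℝ, ∀ t s, s ≤ t → ‖U t s‖ ≤ M * Real.exp (w * (t - s))

variable [CompleteSpace X]

/-- `u` is a continuous weak solution on `ℝ`: it is continuous, `u(s) = x`, and
`∫ ⟨u(τ), v'(τ) + A(τ)* v(τ)⟩ dτ = 0` for all compactly supported test functions
`v ∈ W^{1,2}(ℝ, X)` with `v(τ) ∈ D(A(τ)*)` a.e. and `A(·)* v ∈ L²(ℝ, X)`. -/
structure IsWeakSolution (A : ℝ → X →ₗ.[ℂ] X) (s : ℝ) (x : X) (u : ℝ → X) : Prop where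
  continuous : Continuous u
  initial : u s = x
  weak_eq : ∀ v v' h : ℝ → X, IsRegular (fun t => (A t).adjoint) univ v v' h →
    HasCompactSupport v → ∫ τ, ⟪u τ, v' τ + h τ⟫_ℂ = 0

/-- The hypotheses of Sohr's theorem on a family `H(t)` of self-adjoint operators: for every
`r > 0` there are `β, k > 0` such that, for `|t| ≤ r`, `H(t) ≥ 1 - β`, the map
`t ↦ (β + H(t))⁻¹` is weakly continuously differentiable and
`½ d/dt ⟨x, (β + H(t))⁻¹ x⟩ + k ⟨x, (β + H(t))⁻¹ x⟩ ≥ 0` for all `x`. -/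
def SohrHypotheses (H : ℝ → X →ₗ.[ℂ] X) : Prop :=
  (∀ t, IsSelfAdjoint (H t)) ∧
  ∀ r : ℝ, 0 < r → ∃ β k : ℝ, 0 < β ∧ 0 < k ∧
    (∀ t ∈ Icc (-r) r, ∀ u : (H t).domain,
      (1 - β) * ‖(u : X)‖ ^ 2 ≤ (⟪(u : X), H t u⟫_ℂ).re) ∧
    ∃ R : ℝ → X →L[ℂ] X,
      -- `R t = (β + H(t))⁻¹ = (β - (-H(t)))⁻¹`
      (∀ t ∈ Icc (-r) r, IsResolvent (-(H t)) (β : ℂ) (R t)) ∧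
      (∀ x y : X, ContDiffOn ℝ 1 (fun t => ⟪x, R t y⟫_ℂ) (Icc (-r) r)) ∧
      ∀ x : X, ∀ t ∈ Icc (-r) r,
        0 ≤ 1 / 2 * derivWithin (fun τ => (⟪x, R τ x⟫_ℂ).re) (Icc (-r) r) t +
          k * (⟪x, R t x⟫_ℂ).re

end Abstract

/-! ### The Schrödinger operator on `L²(ℝ³)` -/

/-- Euclidean space `ℝ³`. -/
abbrev R3 : Type := EuclideanSpace ℝ (Fin 3)

/-- The Hilbert space `L²(ℝ³) = L²(ℝ³; ℂ)`. -/
abbrev L2 : Type := Lp ℂ 2 (volume : Measure R3)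

/-- The Rollnik class. -/
def MemRollnik (W : R3 → ℂ) : Prop :=
  AEMeasurable W volume ∧
    ∫⁻ x : R3, ∫⁻ y : R3, ENNReal.ofReal (‖W x * W y‖ / ‖x - y‖ ^ 2) < ∞

/-- `g = (∂₁u, ∂₂u, ∂₃u)` in the sense of (tempered) distributions, all of `u, g` in `L²(ℝ³)`.
The Sobolev space `H¹(ℝ³) = D((-Δ)^{1/2})` consists of all `u` that have such a `g`. -/
def HasWeakGradient (u : L2) (g : Fin 3 → L2) : Prop :=
  ∀ i : Fin 3, ∂_{(EuclideanSpace.single i (1 : ℝ) : R3)} (u : 𝓢'(R3, ℂ)) = (g i : 𝓢'(R3, ℂ))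

/-- The graph of the operator associated with the quadratic form
`q(w, u) = ⟨∇w, ∇u⟩ + ∫ v w̄ u` with form domain `H¹(ℝ³)`: the pairs `(u, f)` such that `u ∈ H¹`
and `q(w, u) = ⟨w, f⟩` for all `w ∈ H¹`. -/
def formGraph (v : R3 → ℝ) : Submodule ℂ (L2 × L2) where
  carrier := {p | ∃ g : Fin 3 → L2, HasWeakGradient p.1 g ∧
    ∀ (w : L2) (k : Fin 3 → L2), HasWeakGradient w k →
      Integrable (fun x => conj (w x) * ((v x : ℂ) * p.1 x)) volume ∧
      ∑ i, ⟪k i, g i⟫_ℂ + ∫ x, conj (w x) * ((v x : ℂ) * p.1 x) = ⟪w, p.2⟫_ℂ}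
  zero_mem' := by
    refine ⟨fun _ => 0, ?_, ?_⟩
    · intro i
      simp only [Prod.fst_zero, ← Lp.toTemperedDistributionCLM_apply, map_zero]
      exact LineDeriv.lineDerivOp_zero _
    · intro w k _
      have h0 : (fun x => conj (w x) * ((v x : ℂ) * (0 : L2) x)) =ᵐ[volume] fun _ => (0 : ℂ) := by
        filter_upwards [Lp.coeFn_zero ℂ 2 (volume : Measure R3)] with x hx
        simp
      refine ⟨(integrable_zero _ _ _).congr h0.symm, ?_⟩
      simp only [Prod.fst_zero, Prod.snd_zero, inner_zero_right, Finset.sum_const_zero, zero_add]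
      rw [integral_congr_ae h0]
      simp
  add_mem' := by
    rintro p q ⟨g, hg, hp⟩ ⟨g', hg', hq⟩
    refine ⟨g + g', ?_, ?_⟩
    · intro i
      have h1 := hg i
      have h2 := hg' i
      simp only [← Lp.toTemperedDistributionCLM_apply] at h1 h2 ⊢
      simp only [Prod.fst_add, map_add, Pi.add_apply, LineDeriv.lineDerivOp_add, h1, h2]
    · intro w k hw
      obtain ⟨i1, e1⟩ := hp w k hw
      obtain ⟨i2, e2⟩ := hq w k hw
      have h0 : (fun x => conj (w x) * ((v x : ℂ) * (p.1 + q.1 : L2) x)) =ᵐ[volume]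
          fun x => conj (w x) * ((v x : ℂ) * p.1 x) + conj (w x) * ((v x : ℂ) * q.1 x) := by
        filter_upwards [Lp.coeFn_add p.1 q.1] with x hx
        simp only [hx, Pi.add_apply]
        ring
      refine ⟨(i1.add i2).congr h0.symm, ?_⟩
      simp only [Prod.fst_add, Prod.snd_add]
      rw [integral_congr_ae h0, integral_add i1 i2, inner_add_right, ← e1, ← e2]
      simp only [Pi.add_apply, inner_add_right, Finset.sum_add_distrib]
      ring
  smul_mem' := by
    rintro c p ⟨g, hg, hp⟩
    refine ⟨c • g, ?_, ?_⟩
    · intro i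
      have h1 := hg i
      simp only [← Lp.toTemperedDistributionCLM_apply] at h1 ⊢
      simp only [Prod.smul_fst, map_smul, Pi.smul_apply, LineDeriv.lineDerivOp_smul, h1]
    · intro w k hw
      obtain ⟨i1, e1⟩ := hp w k hw
      have h0 : (fun x => conj (w x) * ((v x : ℂ) * (c • p.1 : L2) x)) =ᵐ[volume]
          fun x => c * (conj (w x) * ((v x : ℂ) * p.1 x)) := by
        filter_upwards [Lp.coeFn_smul c p.1] with x hx
        simp only [hx, Pi.smul_apply, smul_eq_mul]
        ring
      refine ⟨(i1.const_mul c).congr h0.symm, ?_⟩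
      simp only [Prod.smul_fst, Prod.smul_snd]
      rw [integral_congr_ae h0, integral_const_mul, inner_smul_right, ← e1]
      simp only [Pi.smul_apply, inner_smul_right, mul_add, Finset.mul_sum]

/-- The Schrödinger operator `-Δ + v` as a form sum. -/
def schroedingerOp (v : R3 → ℝ) : L2 →ₗ.[ℂ] L2 := (formGraph v).toLinearPMap

/-- `H = -Δ + v` in the sense of the KLMN theorem: `v` is form bounded relative to `-Δ` with
relative bound `< 1` (so that the form `⟨∇w, ∇u⟩ + ∫ v w̄ u` on `H¹(ℝ³)` is well defined, closed and
bounded from below) and `H` is the self-adjoint operator associated with this form. -/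
structure IsKLMNFormSum (v : R3 → ℝ) (H : L2 →ₗ.[ℂ] L2) : Prop where
  formBounded : ∃ a b : ℝ, a < 1 ∧ ∀ (u : L2) (g : Fin 3 → L2), HasWeakGradient u g →
    Integrable (fun x => |v x| * ‖u x‖ ^ 2) volume ∧
    ∫ x, |v x| * ‖u x‖ ^ 2 ≤ a * ∑ i, ‖g i‖ ^ 2 + b * ‖u‖ ^ 2
  selfAdjoint : IsSelfAdjoint H
  graph_eq : H.graph = formGraph v

end RollnikSchroedinger

end

open RollnikSchroedinger

/-! The argument has an analytic half, which puts the Schrödinger operators into an abstract frame,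
and an abstract half, which solves the evolution equation in that frame.

Analytic half. For `w ≥ 0` and `h = w u`, Plancherel and Cauchy–Schwarz give `(∫ w|u|²)² ≤ ‖∇u‖² ∫
|ĥ|²/(4π²|ξ|²)`. The last integral is a Coulomb energy of `h`, seen by writing `1/|ξ|²` as a time
integral of Gaussians. A second Cauchy–Schwarz bounds it by the Rollnik norm of `w` times `∫ w|u|²`.
Hence `∫ w|u|² ≤ 24 ‖w‖_R ‖∇u‖²`, and cutting `W` at a large height makes it form bounded with
relative bound zero (`MemRollnik.formBound`). On a bounded time interval with majorant `W` the
potential factors as `V(t) = √W · m_t · √W`, where `m_t = V(t)/|W|` and its time derivative are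
bounded by 1. The form domain `H¹` does not depend on `t`, although `D(H(t))` may. So the form of `β
+ H(t)` is a bounded invertible operator `B(t)` on `H¹`, strongly C¹ in `t`, and with `J : H¹ → L²`
the embedding, `R(t) = (β + H(t))⁻¹ = J B(t)⁻¹ J*` is strongly C¹ too. The derivative satisfies the
form bound `|⟨x, R'y⟩| ≤ C ⟨x,Rx⟩^{1/2} ⟨y,Ry⟩^{1/2}` (`isSmoothResolvent_of_form`). This already
contains Sohr's hypotheses, with `k = C`.

Abstract half. Only `R` and that bound are used (`IsSmoothResolvent`). Replace `H` by the bounded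
operator `(R + ε)⁻¹ - β` and solve `u' = c((R + ε)⁻¹ - β)u`, `c = ±i`. The norm is conserved, and
the energy `⟨u, (R+ε)⁻¹u⟩` grows at most exponentially at a rate independent of `ε`, by the bound on
`R'`. Two such solutions are compared in the weak norm `⟨d, Rd⟩^{1/2}`, where the equations differ
only by terms `O(√ε)`; interpolation with the energy bound gives uniform convergence in `X`
(`norm_sub_sq_le_of_regularised`). The limit is a mild solution, because `R(R+ε)⁻¹u` lies in `D(H)`
and nearly solves the equation (`exists_regular_near`). Mild solutions of a skew-adjoint family
conserve the norm. Hence they are unique, and existence extends from the dense range of `R(s)` to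
all of `X`. Solving in both time directions makes the propagator unitary.

The remaining claims follow from the propagator. A weak solution can be tested against cut-off
approximations of `U(·,r)y`, so `⟨u(t), U(t,r)y⟩` is constant and `u` is an orbit. Freezing the time
in `H` shows that each `A(t)` is a generator. In the moving frame of `U` the operator `-d/dt + A`
becomes `-d/dt`, so density of its range reduces to a scalar ODE. Working with `c = ±i` and with `t
↦ -t` throughout covers the adjoint and backward statements at no extra cost. -/

set_option linter.unusedSectionVars false

/-! ### Product rule for vector-valued indefinite integrals, and Grönwall inequalities. -/

section Calculus

/-- A function whose oscillation is dominated by that of an absolutely continuous function is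
absolutely continuous. -/
theorem AbsolutelyContinuousOnInterval.of_dist_le {E F : Type*} [PseudoMetricSpace E]
    [PseudoMetricSpace F] {P : ℝ → E} {Φ : ℝ → F} {a b : ℝ}
    (hΦ : AbsolutelyContinuousOnInterval Φ a b)
    (h : ∀ s ∈ uIcc a b, ∀ t ∈ uIcc a b, dist (P s) (P t) ≤ dist (Φ s) (Φ t)) :
    AbsolutelyContinuousOnInterval P a b := by
  rw [absolutelyContinuousOnInterval_iff] at hΦ ⊢
  intro ε hε
  obtain ⟨δ, hδ, H⟩ := hΦ ε hε
  refine ⟨δ, hδ, fun E hE hlt => (Finset.sum_le_sum fun i hi => ?_).trans_lt (H E hE hlt)⟩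
  exact h _ (hE.1 i hi).1 _ (hE.1 i hi).2

variable {E F G : Type*} [NormedAddCommGroup E] [NormedSpace ℝ E] [CompleteSpace E]
  [NormedAddCommGroup F] [NormedSpace ℝ F] [CompleteSpace F]
  [NormedAddCommGroup G] [NormedSpace ℝ G] [CompleteSpace G]

theorem continuousOn_of_sub_eq_integral {f f' : ℝ → E} {a b : ℝ} (hab : a ≤ b)
    (hf' : IntervalIntegrable f' volume a b)
    (hf : ∀ s ∈ Icc a b, ∀ t ∈ Icc a b, f t - f s = ∫ τ in s..t, f' τ) :
    ContinuousOn f (Icc a b) := by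
  have h1 : ContinuousOn (fun t => f a + ∫ τ in a..t, f' τ) (Icc a b) := by
    refine continuousOn_const.add ?_
    have := intervalIntegral.continuousOn_primitive_interval' hf' left_mem_uIcc
    rwa [uIcc_of_le hab] at this
  refine h1.congr fun t ht => ?_
  simp only [← hf a (left_mem_Icc.2 hab) t ht]; abel

theorem intervalIntegrable_bilin {f' : ℝ → E} {h : ℝ → F} {a b : ℝ}
    (B : E →L[ℝ] F →L[ℝ] G) (hf' : IntervalIntegrable f' volume a b)
    (hh : ContinuousOn h (uIcc a b)) :
    IntervalIntegrable (fun τ => B (f' τ) (h τ)) volume a b := by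
  obtain ⟨M, hM⟩ := isCompact_uIcc.exists_bound_of_continuousOn hh
  refine (hf'.norm.const_mul (‖B‖ * M)).mono_fun ?_ ?_
  · have h1 : AEStronglyMeasurable h (volume.restrict (uIoc a b)) :=
      (hh.mono uIoc_subset_uIcc).aestronglyMeasurable measurableSet_uIoc
    have h2 : AEStronglyMeasurable f' (volume.restrict (uIoc a b)) :=
      (intervalIntegrable_iff.1 hf').aestronglyMeasurable
    exact B.aestronglyMeasurable_comp₂ h2 h1
  · filter_upwards [ae_restrict_mem measurableSet_uIoc] with τ hτ
    have h3 := hM τ (uIoc_subset_uIcc hτ)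
    calc ‖B (f' τ) (h τ)‖ ≤ ‖B‖ * ‖f' τ‖ * ‖h τ‖ := B.le_opNorm₂ _ _
      _ ≤ ‖B‖ * ‖f' τ‖ * M := by gcongr
      _ = ‖B‖ * M * ‖f' τ‖ := by ring
      _ ≤ ‖‖B‖ * M * ‖f' τ‖‖ := le_abs_self _

/-- Product rule for indefinite integrals and a continuous bilinear map. -/
theorem bilin_sub_eq_integral (B : E →L[ℝ] F →L[ℝ] G) {f f' : ℝ → E} {g g' : ℝ → F} {a b : ℝ}
    (hab : a ≤ b) (hf' : IntervalIntegrable f' volume a b) (hg' : IntervalIntegrable g' volume a b)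
    (hf : ∀ s ∈ Icc a b, ∀ t ∈ Icc a b, f t - f s = ∫ τ in s..t, f' τ)
    (hg : ∀ s ∈ Icc a b, ∀ t ∈ Icc a b, g t - g s = ∫ τ in s..t, g' τ) :
    ∀ s ∈ Icc a b, ∀ t ∈ Icc a b,
      B (f t) (g t) - B (f s) (g s) = ∫ τ in s..t, (B (f' τ) (g τ) + B (f τ) (g' τ)) := by
  have hfc := continuousOn_of_sub_eq_integral hab hf' hf
  have hgc := continuousOn_of_sub_eq_integral hab hg' hg
  obtain ⟨M, hM⟩ := isCompact_Icc.exists_bound_of_continuousOn hfc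
  obtain ⟨N, hN⟩ := isCompact_Icc.exists_bound_of_continuousOn hgc
  have ha : a ∈ Icc a b := left_mem_Icc.2 hab
  have hM0 : 0 ≤ M := (norm_nonneg _).trans (hM a ha)
  have hN0 : 0 ≤ N := (norm_nonneg _).trans (hN a ha)
  set p : ℝ → G := fun τ => B (f' τ) (g τ) + B (f τ) (g' τ) with hp
  have hpi : IntervalIntegrable p volume a b := by
    refine (intervalIntegrable_bilin B hf' (by rwa [uIcc_of_le hab])).add ?_
    exact intervalIntegrable_bilin B.flip hg' (by rwa [uIcc_of_le hab])
  have hsub : ∀ s ∈ Icc a b, ∀ t ∈ Icc a b, uIcc s t ⊆ uIcc a b := fun s hs t ht => by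
    rw [uIcc_of_le hab]; exact uIcc_subset_Icc hs ht
  -- It is enough that `P` is constant. Its oscillation is dominated by that of `∫ φ`, hence it is
  -- absolutely continuous, and its derivative vanishes almost everywhere by Lebesgue
  -- differentiation. The factor 2 in `φ` pays once for the increment of `B (f, g)` and once for the
  -- integral of `p`.
  set P : ℝ → G := fun t => B (f t) (g t) - ∫ τ in a..t, p τ with hP
  set φ : ℝ → ℝ := fun τ => 2 * (‖B‖ * (N * ‖f' τ‖ + M * ‖g' τ‖)) with hφ
  have hφi : IntervalIntegrable φ volume a b :=
    (((hf'.norm.const_mul N).add (hg'.norm.const_mul M)).const_mul _).const_mul _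
  have key : ∀ s ∈ Icc a b, ∀ t ∈ Icc a b, s ≤ t →
      ‖P t - P s‖ ≤ ∫ τ in s..t, φ τ := by
    intro s hs t ht hst
    have i1 := hf'.mono_set (hsub s hs t ht)
    have i2 := hg'.mono_set (hsub s hs t ht)
    have i3 := hpi.mono_set (hsub s hs t ht)
    have e1 : P t - P s = B (f t - f s) (g t) + B (f s) (g t - g s) - ∫ τ in s..t, p τ := by
      have : (∫ τ in a..t, p τ) - ∫ τ in a..s, p τ = ∫ τ in s..t, p τ :=
        intervalIntegral.integral_interval_sub_left (hpi.mono_set (hsub a ha t ht))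
          (hpi.mono_set (hsub a ha s hs))
      simp only [hP, map_sub, _root_.sub_apply]
      rw [← this]; abel
    have n1 : ‖f t - f s‖ ≤ ∫ τ in s..t, ‖f' τ‖ := by
      rw [hf s hs t ht]; exact intervalIntegral.norm_integral_le_integral_norm hst
    have n2 : ‖g t - g s‖ ≤ ∫ τ in s..t, ‖g' τ‖ := by
      rw [hg s hs t ht]; exact intervalIntegral.norm_integral_le_integral_norm hst
    have n3 : ‖∫ τ in s..t, p τ‖ ≤ ∫ τ in s..t, ‖B‖ * (N * ‖f' τ‖ + M * ‖g' τ‖) := by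
      refine intervalIntegral.norm_integral_le_of_norm_le hst ?_
        (((i1.norm.const_mul N).add (i2.norm.const_mul M)).const_mul _)
      refine Eventually.of_forall fun τ hτ => ?_
      have hτ' : τ ∈ Icc a b := ⟨hs.1.trans hτ.1.le, hτ.2.trans ht.2⟩
      calc ‖p τ‖ ≤ ‖B‖ * ‖f' τ‖ * ‖g τ‖ + ‖B‖ * ‖f τ‖ * ‖g' τ‖ :=
            (norm_add_le _ _).trans (add_le_add (B.le_opNorm₂ _ _) (B.le_opNorm₂ _ _))
        _ ≤ ‖B‖ * ‖f' τ‖ * N + ‖B‖ * M * ‖g' τ‖ := by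
            gcongr
            · exact hN τ hτ'
            · exact hM τ hτ'
        _ = ‖B‖ * (N * ‖f' τ‖ + M * ‖g' τ‖) := by ring
    have e2 : ∫ τ in s..t, φ τ = (∫ τ in s..t, ‖B‖ * (N * ‖f' τ‖ + M * ‖g' τ‖)) +
        ‖B‖ * (N * (∫ τ in s..t, ‖f' τ‖) + M * ∫ τ in s..t, ‖g' τ‖) := by
      simp only [hφ]
      rw [intervalIntegral.integral_const_mul, intervalIntegral.integral_const_mul,
        intervalIntegral.integral_add (i1.norm.const_mul N) (i2.norm.const_mul M),
        intervalIntegral.integral_const_mul, intervalIntegral.integral_const_mul]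
      ring
    rw [e1, e2]
    have m1 : ‖B (f t - f s) (g t)‖ ≤ ‖B‖ * (∫ τ in s..t, ‖f' τ‖) * N := by
      refine (B.le_opNorm₂ _ _).trans ?_
      have := (norm_nonneg _).trans n1
      have := hN t ht
      gcongr
    have m2 : ‖B (f s) (g t - g s)‖ ≤ ‖B‖ * M * (∫ τ in s..t, ‖g' τ‖) := by
      refine (B.le_opNorm₂ _ _).trans ?_
      have := hM s hs
      gcongr
    have := norm_sub_le (B (f t - f s) (g t) + B (f s) (g t - g s)) (∫ τ in s..t, p τ)
    have := norm_add_le (B (f t - f s) (g t)) (B (f s) (g t - g s))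
    nlinarith
  have hPac : AbsolutelyContinuousOnInterval P a b := by
    refine AbsolutelyContinuousOnInterval.of_dist_le
      (hφi.absolutelyContinuousOnInterval_intervalIntegral (c := a) left_mem_uIcc) ?_
    have main : ∀ s ∈ Icc a b, ∀ t ∈ Icc a b, s ≤ t →
        dist (P s) (P t) ≤ dist (∫ τ in a..s, φ τ) (∫ τ in a..t, φ τ) := by
      intro s hs t ht hst
      rw [dist_comm, dist_eq_norm, dist_comm, dist_eq_norm,
        intervalIntegral.integral_interval_sub_left (hφi.mono_set (hsub a ha t ht))
          (hφi.mono_set (hsub a ha s hs))]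
      exact (key s hs t ht hst).trans (le_abs_self _)
    intro s hs t ht
    rw [uIcc_of_le hab] at hs ht
    rcases le_total s t with h | h
    · exact main s hs t ht h
    · rw [dist_comm, dist_comm (∫ τ in a..s, φ τ)]; exact main t ht s hs h
  have hae : ∀ᵐ x, x ∈ uIcc a b → HasDerivAt P 0 x := by
    have hnull : ∀ᵐ x : ℝ, x ∉ ({a, b} : Set ℝ) :=
      (measure_eq_zero_iff_ae_notMem).1 ((Set.toFinite _).measure_zero _)
    filter_upwards [hf'.ae_hasDerivAt_integral, hg'.ae_hasDerivAt_integral,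
      hpi.ae_hasDerivAt_integral, hnull] with x h1 h2 h3 hx hxab
    have hx' : x ∈ Icc a b := by rwa [uIcc_of_le hab] at hxab
    have hxo : x ∈ Ioo a b := by
      simp only [mem_insert_iff, mem_singleton_iff, not_or] at hx
      exact ⟨lt_of_le_of_ne hx'.1 (Ne.symm hx.1), lt_of_le_of_ne hx'.2 hx.2⟩
    have hev : ∀ᶠ t in 𝓝 x, t ∈ Icc a b := Icc_mem_nhds hxo.1 hxo.2
    have d1 : HasDerivAt f (f' x) x := by
      refine ((h1 hxab a left_mem_uIcc).const_add (f a)).congr_of_eventuallyEq ?_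
      filter_upwards [hev] with t ht
      rw [← hf a ha t ht]; abel
    have d2 : HasDerivAt g (g' x) x := by
      refine ((h2 hxab a left_mem_uIcc).const_add (g a)).congr_of_eventuallyEq ?_
      filter_upwards [hev] with t ht
      rw [← hg a ha t ht]; abel
    have d3 := ((B.hasFDerivAt_of_bilinear d1.hasFDerivAt d2.hasFDerivAt).hasDerivAt).sub
      (h3 hxab a left_mem_uIcc)
    refine d3.congr_deriv ?_
    simp [hp]
    abel
  obtain ⟨C, hC⟩ := hPac.const_of_ae_hasDerivAt_zero hae
  intro s hs t ht
  have h1 := hC s (by rwa [uIcc_of_le hab])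
  have h2 := hC t (by rwa [uIcc_of_le hab])
  have h3 : (∫ τ in a..t, p τ) - ∫ τ in a..s, p τ = ∫ τ in s..t, p τ :=
    intervalIntegral.integral_interval_sub_left (hpi.mono_set (hsub a ha t ht))
      (hpi.mono_set (hsub a ha s hs))
  rw [← h3]
  have : P t = P s := h2.trans h1.symm
  simp only [hP] at this
  exact sub_eq_sub_iff_sub_eq_sub.1 this

/-- Two-sided Grönwall inequality: `|f'| ≤ C f` implies `f t ≤ exp (C |t - s|) f s`. -/
theorem le_exp_mul_of_abs_deriv_le {f f' : ℝ → ℝ} {a b C : ℝ} (hf : ContinuousOn f (Icc a b))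
    (hf' : ∀ t ∈ Ioo a b, HasDerivAt f (f' t) t) (hC : ∀ t ∈ Ioo a b, |f' t| ≤ C * f t)
    {s t : ℝ} (hs : s ∈ Icc a b) (ht : t ∈ Icc a b) :
    f t ≤ Real.exp (C * |t - s|) * f s := by
  have dexp : ∀ (k t : ℝ), HasDerivAt (fun t => Real.exp (k * t)) (Real.exp (k * t) * k) t :=
    fun k t => by simpa using ((hasDerivAt_id t).const_mul k).exp
  have cexp : ∀ k : ℝ, ContinuousOn (fun t => Real.exp (k * t)) (Icc a b) := fun k => by fun_prop
  rcases le_total s t with h | h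
  · have anti : AntitoneOn (fun t => Real.exp (-C * t) * f t) (Icc a b) := by
      refine antitoneOn_of_hasDerivWithinAt_nonpos (convex_Icc a b) ((cexp _).mul hf)
        (f' := fun t => Real.exp (-C * t) * -C * f t + Real.exp (-C * t) * f' t) ?_ ?_
      · intro x hx; rw [interior_Icc] at hx ⊢
        exact ((dexp (-C) x).mul (hf' x hx)).hasDerivWithinAt
      · intro x hx; rw [interior_Icc] at hx
        have := (abs_le.1 (hC x hx)).2
        have := Real.exp_pos (-C * x)
        nlinarith
    have := anti hs ht h
    simp only at this
    rw [abs_of_nonneg (by linarith), mul_sub, Real.exp_sub]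
    rw [neg_mul, neg_mul, Real.exp_neg, Real.exp_neg] at this
    have p1 := Real.exp_pos (C * t)
    rw [inv_mul_eq_div, div_le_iff₀ p1] at this
    rw [div_mul_eq_mul_div, mul_div_assoc]
    calc f t ≤ (Real.exp (C * s))⁻¹ * f s * Real.exp (C * t) := this
      _ = _ := by rw [div_eq_mul_inv]; ring
  · have mono : MonotoneOn (fun t => Real.exp (C * t) * f t) (Icc a b) := by
      refine monotoneOn_of_hasDerivWithinAt_nonneg (convex_Icc a b) ((cexp _).mul hf)
        (f' := fun t => Real.exp (C * t) * C * f t + Real.exp (C * t) * f' t) ?_ ?_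
      · intro x hx; rw [interior_Icc] at hx ⊢
        exact ((dexp C x).mul (hf' x hx)).hasDerivWithinAt
      · intro x hx; rw [interior_Icc] at hx
        have := (abs_le.1 (hC x hx)).1
        have := Real.exp_pos (C * x)
        nlinarith
    have := mono ht hs h
    simp only at this
    rw [abs_of_nonpos (by linarith), neg_sub, mul_sub, Real.exp_sub]
    have p1 := Real.exp_pos (C * t)
    rw [div_mul_eq_mul_div, le_div_iff₀ p1]
    linarith

/-- A Grönwall inequality with a constant inhomogeneity. -/
theorem le_exp_mul_add_of_abs_deriv_le {f f' : ℝ → ℝ} {a b C η : ℝ} (hC0 : 0 < C)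
    (hf : ContinuousOn f (Icc a b))
    (hf' : ∀ t ∈ Ioo a b, HasDerivAt f (f' t) t) (hC : ∀ t ∈ Ioo a b, |f' t| ≤ C * f t + η)
    {s t : ℝ} (hs : s ∈ Icc a b) (ht : t ∈ Icc a b) :
    f t + η / C ≤ Real.exp (C * |t - s|) * (f s + η / C) :=
  le_exp_mul_of_abs_deriv_le (f := fun t => f t + η / C) (hf.add continuousOn_const)
    (fun t ht => (hf' t ht).add_const _)
    (fun t ht => (hC t ht).trans_eq (by field_simp)) hs ht

theorem sub_eq_integral_real {f g : ℝ → ℝ} (hf : ∀ t, HasDerivAt f (g t) t) (hg : Continuous g)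
    {a b : ℝ} : ∀ s ∈ Icc a b, ∀ t ∈ Icc a b, f t - f s = ∫ τ in s..t, g τ := fun s _ t _ =>
  (intervalIntegral.integral_eq_sub_of_hasDerivAt (fun x _ => hf x)
    (hg.intervalIntegrable s t)).symm

end Calculus

/-! ### Strongly continuous and strongly differentiable operator families. -/

section StrongFamilies

variable {X Y : Type*} [NormedAddCommGroup X] [NormedSpace ℂ X]
  [NormedAddCommGroup Y] [NormedSpace ℂ Y]

theorem tendsto_clm_apply {ι : Type*} {l : Filter ι} {D : ι → X →L[ℂ] Y} {D₀ : X →L[ℂ] Y} {M : ℝ}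
    (hM : ∀ᶠ τ in l, ‖D τ‖ ≤ M) {v : ι → X} {v₀ : X}
    (hD : Tendsto (fun τ => D τ v₀) l (𝓝 (D₀ v₀))) (hv : Tendsto v l (𝓝 v₀)) :
    Tendsto (fun τ => D τ (v τ)) l (𝓝 (D₀ v₀)) := by
  have h1 : Tendsto (fun τ => D τ (v τ - v₀)) l (𝓝 0) := by
    refine squeeze_zero_norm' (a := fun τ => M * ‖v τ - v₀‖) ?_ ?_
    · filter_upwards [hM] with τ h
      exact (D τ).le_of_opNorm_le h _
    · have : Tendsto (fun τ => ‖v τ - v₀‖) l (𝓝 0) := by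
        simpa using (hv.sub_const v₀).norm
      simpa using this.const_mul M
  simpa using hD.add h1

theorem ContinuousOn.strong_clm_apply {D : ℝ → X →L[ℂ] Y} {s : Set ℝ} {M : ℝ}
    (hM : ∀ τ ∈ s, ‖D τ‖ ≤ M) {v : ℝ → X}
    (hD : ∀ x, ContinuousOn (fun τ => D τ x) s) (hv : ContinuousOn v s) :
    ContinuousOn (fun τ => D τ (v τ)) s := fun t ht =>
  tendsto_clm_apply (eventually_mem_nhdsWithin.mono hM) (hD (v t) t ht) (hv t ht)

/-- Because `v t = 0`, the difference quotient of `D τ (v τ)` is `D τ` applied to that of `v`. So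
strong continuity of `D` is enough, without differentiability; this is the second half of the
product rule below. -/
theorem hasDerivAt_clm_apply_of_eq_zero {D : ℝ → X →L[ℂ] Y} {t M : ℝ}
    (hM : ∀ᶠ τ in 𝓝 t, ‖D τ‖ ≤ M) (hD : ∀ x, ContinuousAt (fun τ => D τ x) t)
    {v : ℝ → X} {v' : X} (hv : HasDerivAt v v' t) (h0 : v t = 0) :
    HasDerivAt (fun τ => D τ (v τ)) (D t v') t := by
  rw [hasDerivAt_iff_tendsto_slope] at hv ⊢
  have h1 := tendsto_clm_apply (hM.filter_mono nhdsWithin_le_nhds)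
    ((hD v').tendsto.mono_left nhdsWithin_le_nhds) hv
  refine h1.congr' ?_
  filter_upwards with τ
  simp only [slope, vsub_eq_sub, h0, sub_zero, map_zero]
  exact (D τ).map_smul_of_tower _ _

theorem HasDerivAt.strong_clm_apply {D : ℝ → X →L[ℂ] Y} {D' : X → Y} {t M : ℝ}
    (hM : ∀ᶠ τ in 𝓝 t, ‖D τ‖ ≤ M) (hD : ∀ x, HasDerivAt (fun τ => D τ x) (D' x) t)
    {v : ℝ → X} {v' : X} (hv : HasDerivAt v v' t) :
    HasDerivAt (fun τ => D τ (v τ)) (D' (v t) + D t v') t := by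
  have h1 := hasDerivAt_clm_apply_of_eq_zero hM (fun x => (hD x).continuousAt)
    (hv.sub_const (v t)) (sub_self _)
  refine ((hD (v t)).add h1).congr_of_eventuallyEq (Eventually.of_forall fun τ => ?_)
  simp

/-- Strong convergence of operators does not by itself pass to inverses. With a uniform bound it
does, through the identity `D τ x = D t x - D τ (B τ (D t x) - x)`; the derivative lemma that
follows uses the same identity. -/
theorem continuousAt_strong_inverse {B D : ℝ → X →L[ℂ] X} {t M : ℝ}
    (hM : ∀ᶠ τ in 𝓝 t, ‖D τ‖ ≤ M) (hB : ∀ x, ContinuousAt (fun τ => B τ x) t)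
    (hDB : ∀ᶠ τ in 𝓝 t, ∀ x, D τ (B τ x) = x) (hBD : ∀ x, B t (D t x) = x) (x : X) :
    ContinuousAt (fun τ => D τ x) t := by
  have h0 : Tendsto (fun τ => B τ (D t x) - x) (𝓝 t) (𝓝 0) := by
    have := (hB (D t x)).tendsto.sub_const x
    rwa [hBD, sub_self] at this
  have h1 : Tendsto (fun τ => D τ (B τ (D t x) - x)) (𝓝 t) (𝓝 0) := by
    refine squeeze_zero_norm' (a := fun τ => M * ‖B τ (D t x) - x‖) ?_ ?_
    · filter_upwards [hM] with τ h
      exact (D τ).le_of_opNorm_le h _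
    · simpa using h0.norm.const_mul M
  have h2 : Tendsto (fun τ => D t x - D τ (B τ (D t x) - x)) (𝓝 t) (𝓝 (D t x)) := by
    simpa using h1.const_sub (D t x)
  refine Tendsto.congr' ?_ h2
  filter_upwards [hDB] with τ h
  rw [map_sub, h]; abel

theorem hasDerivAt_strong_inverse {B D : ℝ → X →L[ℂ] X} {B' : X → X} {t M : ℝ}
    (hM : ∀ᶠ τ in 𝓝 t, ‖D τ‖ ≤ M) (hB : ∀ x, HasDerivAt (fun τ => B τ x) (B' x) t)
    (hDB : ∀ᶠ τ in 𝓝 t, ∀ x, D τ (B τ x) = x) (hBD : ∀ x, B t (D t x) = x) (x : X) :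
    HasDerivAt (fun τ => D τ x) (-D t (B' (D t x))) t := by
  have h1 := hasDerivAt_clm_apply_of_eq_zero hM
    (continuousAt_strong_inverse hM (fun x => (hB x).continuousAt) hDB hBD)
    ((hB (D t x)).sub_const x) (by simp [hBD])
  refine (h1.const_sub (D t x)).congr_of_eventuallyEq ?_
  filter_upwards [hDB] with τ h
  rw [map_sub, h]; abel

end StrongFamilies

/-! ### Linear ODEs with bounded skew-symmetric coefficients. -/

section SkewODE

variable {X : Type*} [NormedAddCommGroup X]

/-- The radial retraction onto the ball of radius `a`. -/
noncomputable def radialRetraction [NormedSpace ℝ X] (a : ℝ) (u : X) : X :=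
  (a / max a ‖u‖) • u

theorem radialRetraction_of_norm_le [NormedSpace ℝ X] {a : ℝ} (ha : 0 < a) {u : X} (hu : ‖u‖ ≤ a) :
    radialRetraction a u = u := by
  rw [radialRetraction, max_eq_left hu, div_self ha.ne', one_smul]

theorem norm_radialRetraction_le [NormedSpace ℝ X] {a : ℝ} (ha : 0 < a) (u : X) :
    ‖radialRetraction a u‖ ≤ a := by
  have hm : 0 < max a ‖u‖ := lt_max_of_lt_left ha
  rw [radialRetraction, norm_smul, Real.norm_of_nonneg (by positivity), div_mul_eq_mul_div,
    div_le_iff₀ hm]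
  exact mul_le_mul_of_nonneg_left (le_max_right _ _) ha.le

theorem norm_radialRetraction_sub_le [NormedSpace ℝ X] {a : ℝ} (ha : 0 < a) (u v : X) :
    ‖radialRetraction a u - radialRetraction a v‖ ≤ 2 * ‖u - v‖ := by
  set m := max a ‖u‖ with hm
  set n := max a ‖v‖ with hn
  have hm0 : 0 < m := lt_max_of_lt_left ha
  have hn0 : 0 < n := lt_max_of_lt_left ha
  have e : radialRetraction a u - radialRetraction a v =
      (a / m) • (u - v) + (a / m * ((n - m) / n)) • v := by
    simp only [radialRetraction, ← hm, ← hn]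
    have : a / m * ((n - m) / n) = a / m - a / n := by field_simp
    rw [this]; module
  have h1 : a / m ≤ 1 := (div_le_one hm0).2 (le_max_left _ _)
  have h2 : |n - m| ≤ ‖u - v‖ := by
    refine (abs_max_sub_max_le_abs _ _ a).trans_eq' ?_ |>.trans ?_ (b := |‖v‖ - ‖u‖|)
    · simp only [hm, hn, max_comm]
    · rw [abs_sub_comm]; exact abs_norm_sub_norm_le u v
  rw [e, two_mul]
  refine (norm_add_le _ _).trans (add_le_add ?_ ?_)
  · rw [norm_smul, Real.norm_of_nonneg (by positivity)]
    exact mul_le_of_le_one_left (norm_nonneg _) h1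
  · rw [norm_smul, norm_mul, norm_div (n - m), Real.norm_of_nonneg (by positivity : 0 ≤ a / m),
      Real.norm_of_nonneg hn0.le, Real.norm_eq_abs]
    calc a / m * (|n - m| / n) * ‖v‖ ≤ 1 * (|n - m| / n) * n := by
          gcongr
          exact le_max_right _ _
      _ = |n - m| := by field_simp
      _ ≤ _ := h2

variable [InnerProductSpace ℂ X] [CompleteSpace X]

theorem hasDerivAt_norm_sq {u : ℝ → X} {u' : X} {t : ℝ} (h : HasDerivAt u u' t) :
    HasDerivAt (fun τ => ‖u τ‖ ^ 2) (2 * (⟪u t, u'⟫_ℂ).re) t := by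
  have h1 := (Complex.reCLM.hasFDerivAt.comp_hasDerivAt t (h.inner ℂ h))
  refine (h1.congr_deriv ?_).congr_of_eventuallyEq (Eventually.of_forall fun τ => ?_)
  · simp only [Complex.reCLM_apply, Complex.add_re]
    rw [← inner_conj_symm u' (u t), Complex.conj_re]; ring
  · simp only [Function.comp, Complex.reCLM_apply]
    exact (inner_self_eq_norm_sq (𝕜 := ℂ) (u τ)).symm

/-- The equation `u' = S(t) u` with bounded, strongly continuous, skew-symmetric `S(t)` is solvable
on every interval, and the norm is conserved. -/
theorem exists_solution_of_skew {a b K : ℝ} {S : ℝ → X →L[ℂ] X}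
    (hS : ∀ x, ContinuousOn (fun t => S t x) (Icc a b)) (hK : ∀ t ∈ Icc a b, ‖S t‖ ≤ K)
    (hskew : ∀ t ∈ Icc a b, ∀ x, (⟪x, S t x⟫_ℂ).re = 0) {s : ℝ} (hs : s ∈ Icc a b) (x : X) :
    ∃ u : ℝ → X, u s = x ∧ ContinuousOn u (Icc a b) ∧
      (∀ t ∈ Ioo a b, HasDerivAt u (S t (u t)) t) ∧ ∀ t ∈ Icc a b, ‖u t‖ = ‖x‖ := by
  have hK0 : 0 ≤ K := (norm_nonneg _).trans (hK s hs)
  set α := ‖x‖ + 1 with hα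
  have hα0 : 0 < α := by positivity
  -- The retraction makes the vector field globally bounded by `K * α`, so that one application of
  -- Picard–Lindelöf covers all of `[a, b]`. It multiplies `u` by a real scalar, hence skew-symmetry
  -- still conserves the norm; since `‖x‖ < α`, the retraction is never active along the solution.
  set f : ℝ → X → X := fun t u => S t (radialRetraction α u) with hf
  have hPL : IsPicardLindelof f (⟨s, hs⟩ : Icc a b) x
      (K * α * (b - a)).toNNReal 0 (K * α).toNNReal (K * 2).toNNReal := by
    constructor
    · intro t ht
      refine LipschitzWith.lipschitzOnWith (LipschitzWith.of_dist_le_mul fun u v => ?_)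
      rw [Real.coe_toNNReal _ (by positivity), dist_eq_norm, dist_eq_norm, ← map_sub, mul_assoc]
      exact (S t).le_of_opNorm_le_of_le (hK t ht) (norm_radialRetraction_sub_le hα0 u v)
    · intro y _
      exact hS _
    · intro t ht y _
      rw [Real.coe_toNNReal _ (by positivity)]
      exact (S t).le_of_opNorm_le_of_le (hK t ht) (norm_radialRetraction_le hα0 y)
    · have : 0 ≤ b - a := by linarith [hs.1, hs.2]
      rw [Real.coe_toNNReal _ (by positivity), Real.coe_toNNReal _ (by positivity)]
      simp only [NNReal.coe_zero, sub_zero]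
      refine mul_le_mul_of_nonneg_left (max_le ?_ ?_) (by positivity) <;> linarith [hs.1, hs.2]
  obtain ⟨u, hus, hu⟩ := hPL.exists_eq_forall_mem_Icc_hasDerivWithinAt₀
  have huc : ContinuousOn u (Icc a b) := fun t ht => (hu t ht).continuousWithinAt
  have hud : ∀ t ∈ Ioo a b, HasDerivAt u (f t (u t)) t := fun t ht =>
    (hu t (Ioo_subset_Icc_self ht)).hasDerivAt (Icc_mem_nhds ht.1 ht.2)
  have hn : ∀ t ∈ Icc a b, ‖u t‖ = ‖x‖ := by
    have h0 : ∀ t ∈ Ioo a b, HasDerivAt (fun τ => ‖u τ‖ ^ 2) 0 t := by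
      intro t ht
      refine (hasDerivAt_norm_sq (hud t ht)).congr_deriv ?_
      simp only [hf, radialRetraction]
      rw [(S t).map_smul_of_tower, ← Complex.coe_smul, inner_smul_right, Complex.re_ofReal_mul,
        hskew t (Ioo_subset_Icc_self ht)]
      simp
    have key : ∀ s ∈ Icc a b, ∀ t ∈ Icc a b, ‖u t‖ ^ 2 ≤ ‖u s‖ ^ 2 := by
      intro s hs t ht
      have := le_exp_mul_of_abs_deriv_le (f := fun τ => ‖u τ‖ ^ 2) (f' := fun _ => 0) (C := 0)
        (huc.norm.pow 2) h0 (by simp) hs ht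
      simpa using this
    intro t ht
    have := le_antisymm (key s hs t ht) (key t ht s hs)
    rw [show x = u s from hus.symm]
    exact (sq_eq_sq₀ (norm_nonneg _) (norm_nonneg _)).1 this
  refine ⟨u, hus, huc, fun t ht => ?_, hn⟩
  have := hud t ht
  simp only [hf] at this
  rwa [radialRetraction_of_norm_le hα0 (by rw [hn t (Ioo_subset_Icc_self ht)]; simp [hα])] at this

end SkewODE

namespace RollnikSchroedinger

variable {X : Type*} [NormedAddCommGroup X] [InnerProductSpace ℂ X] [CompleteSpace X]

/-! ### Positive operators and their regularised inverses `(T + ε)⁻¹`. -/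

section Positive

variable {T : X →L[ℂ] X}

theorem inner_left_of_isPositive (hT : T.IsPositive) (x y : X) : ⟪T x, y⟫_ℂ = ⟪x, T y⟫_ℂ :=
  hT.isSymmetric x y

theorem re_inner_nonneg_of_isPositive (hT : T.IsPositive) (x : X) : 0 ≤ (⟪x, T x⟫_ℂ).re :=
  hT.re_inner_nonneg_right x

theorem im_inner_eq_zero_of_isPositive (hT : T.IsPositive) (x : X) : (⟪x, T x⟫_ℂ).im = 0 := by
  have h := inner_conj_symm (𝕜 := ℂ) x (T x)
  rw [inner_left_of_isPositive hT] at h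
  exact Complex.conj_eq_iff_im.1 h

theorem re_inner_comm_of_isPositive (hT : T.IsPositive) (x y : X) :
    (⟪x, T y⟫_ℂ).re = (⟪y, T x⟫_ℂ).re := by
  rw [← inner_left_of_isPositive hT, ← inner_conj_symm, Complex.conj_re]

/-- Cauchy–Schwarz for the semi-inner product `⟨x, T y⟩`, from the discriminant of the nonnegative
quadratic `l ↦ ⟨x + l y, T (x + l y)⟩`. -/
theorem abs_re_inner_le_of_isPositive (hT : T.IsPositive) (x y : X) :
    |(⟪x, T y⟫_ℂ).re| ≤ √(⟪x, T x⟫_ℂ).re * √(⟪y, T y⟫_ℂ).re := by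
  have h : ∀ l : ℝ, 0 ≤ (⟪y, T y⟫_ℂ).re * (l * l) + 2 * (⟪x, T y⟫_ℂ).re * l + (⟪x, T x⟫_ℂ).re := by
    intro l
    have := re_inner_nonneg_of_isPositive hT (x + (l : ℂ) • y)
    simp only [map_add, map_smul, inner_add_left, inner_add_right, inner_smul_left,
      inner_smul_right, Complex.add_re, Complex.conj_ofReal, Complex.re_ofReal_mul,
      re_inner_comm_of_isPositive hT y x] at this
    linarith
  have hd := discrim_le_zero h
  rw [discrim] at hd
  rw [← Real.sqrt_mul (re_inner_nonneg_of_isPositive hT x)]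
  refine Real.abs_le_sqrt ?_
  nlinarith

theorem re_inner_sub_le_of_isPositive (hT : T.IsPositive) (x y : X) :
    (⟪x - y, T (x - y)⟫_ℂ).re ≤ 2 * (⟪x, T x⟫_ℂ).re + 2 * (⟪y, T y⟫_ℂ).re := by
  have := re_inner_nonneg_of_isPositive hT (x + y)
  simp only [map_add, map_sub, inner_add_left, inner_add_right, inner_sub_left,
      inner_sub_right, Complex.add_re, Complex.sub_re] at this ⊢
  linarith

/-- The bounded operator `(T + ε)⁻¹`. -/
noncomputable def regInv (T : X →L[ℂ] X) (ε : ℝ) : X →L[ℂ] X := Ring.inverse (T + (ε : ℂ) • 1)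

variable {ε : ℝ}

theorem isUnit_add_smul_one (hT : T.IsPositive) (hε : 0 < ε) : IsUnit (T + (ε : ℂ) • 1) := by
  refine ContinuousLinearMap.isUnit_of_forall_le_norm_inner_map _ (c := ⟨ε, hε.le⟩) hε fun x => ?_
  have h1 : (⟪(T + (ε : ℂ) • (1 : X →L[ℂ] X)) x, x⟫_ℂ).re = (⟪x, T x⟫_ℂ).re + ε * ‖x‖ ^ 2 := by
    have h2 : ((T + (ε : ℂ) • (1 : X →L[ℂ] X)) x) = T x + (ε : ℂ) • x := rfl
    rw [h2, inner_add_left, inner_smul_left, inner_left_of_isPositive hT, Complex.add_re,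
      Complex.conj_ofReal, Complex.re_ofReal_mul]
    congr 2
    exact inner_self_eq_norm_sq (𝕜 := ℂ) x
  have h3 := re_inner_nonneg_of_isPositive hT x
  have h4 := Complex.re_le_norm (⟪(T + (ε : ℂ) • (1 : X →L[ℂ] X)) x, x⟫_ℂ)
  change ‖x‖ ^ 2 * ε ≤ _
  linarith

theorem apply_regInv (hT : T.IsPositive) (hε : 0 < ε) (x : X) :
    T (regInv T ε x) = x - (ε : ℂ) • regInv T ε x := by
  have h := congrArg (fun S : X →L[ℂ] X => S x)
    (Ring.mul_inverse_cancel _ (isUnit_add_smul_one hT hε))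
  have h' : T (regInv T ε x) + (ε : ℂ) • regInv T ε x = x := h
  exact eq_sub_of_add_eq h'

theorem regInv_apply (hT : T.IsPositive) (hε : 0 < ε) (x : X) :
    regInv T ε (T x) = x - (ε : ℂ) • regInv T ε x := by
  have h := congrArg (fun S : X →L[ℂ] X => S x)
    (Ring.inverse_mul_cancel _ (isUnit_add_smul_one hT hε))
  have h' : regInv T ε (T x + (ε : ℂ) • x) = x := h
  rw [map_add, map_smul] at h'
  exact eq_sub_of_add_eq h'

theorem inner_regInv_left (hT : T.IsPositive) (hε : 0 < ε) (x y : X) :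
    ⟪regInv T ε x, y⟫_ℂ = ⟪x, regInv T ε y⟫_ℂ := by
  have hx : x = T (regInv T ε x) + (ε : ℂ) • regInv T ε x := by rw [apply_regInv hT hε]; abel
  have hy : y = T (regInv T ε y) + (ε : ℂ) • regInv T ε y := by rw [apply_regInv hT hε]; abel
  conv_lhs => rw [hy]
  conv_rhs => rw [hx]
  rw [inner_add_left, inner_add_right, inner_smul_left, inner_smul_right,
    inner_left_of_isPositive hT, Complex.conj_ofReal]

/-- Write `x = (T + ε) K x` with `K = (T + ε)⁻¹` and pair with `K x`. The energy `⟨x, K x⟩` splits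
into two nonnegative parts, so it controls both `⟨K x, T K x⟩` and `ε ‖K x‖²`. -/
theorem re_inner_regInv (hT : T.IsPositive) (hε : 0 < ε) (x : X) :
    (⟪x, regInv T ε x⟫_ℂ).re =
      (⟪regInv T ε x, T (regInv T ε x)⟫_ℂ).re + ε * ‖regInv T ε x‖ ^ 2 := by
  have hx : ⟪x, regInv T ε x⟫_ℂ =
      ⟪T (regInv T ε x) + (ε : ℂ) • regInv T ε x, regInv T ε x⟫_ℂ := by
    rw [apply_regInv hT hε, sub_add_cancel]
  rw [hx, inner_add_left, inner_smul_left, inner_left_of_isPositive hT, Complex.add_re,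
      Complex.conj_ofReal, Complex.re_ofReal_mul]
  congr 2
  exact inner_self_eq_norm_sq (𝕜 := ℂ) (regInv T ε x)

theorem re_inner_regInv_nonneg (hT : T.IsPositive) (hε : 0 < ε) (x : X) :
    0 ≤ (⟪x, regInv T ε x⟫_ℂ).re := by
  rw [re_inner_regInv hT hε]
  have := re_inner_nonneg_of_isPositive hT (regInv T ε x)
  positivity

theorem im_inner_regInv (hT : T.IsPositive) (hε : 0 < ε) (x : X) :
    (⟪x, regInv T ε x⟫_ℂ).im = 0 := by
  have h := inner_conj_symm (𝕜 := ℂ) x (regInv T ε x)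
  rw [inner_regInv_left hT hε] at h
  exact Complex.conj_eq_iff_im.1 h

theorem norm_regInv_le (hT : T.IsPositive) (hε : 0 < ε) : ‖regInv T ε‖ ≤ ε⁻¹ := by
  refine ContinuousLinearMap.opNorm_le_bound _ (by positivity) fun x => ?_
  have h1 := re_inner_regInv hT hε x
  have h2 := re_inner_nonneg_of_isPositive hT (regInv T ε x)
  have h3 := (Complex.re_le_norm _).trans (norm_inner_le_norm (𝕜 := ℂ) x (regInv T ε x))
  rw [inv_mul_eq_div, le_div_iff₀ hε]
  rcases (norm_nonneg (regInv T ε x)).eq_or_lt with h | h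
  · rw [← h]; simp
  · refine le_of_mul_le_mul_right ?_ h
    nlinarith

theorem re_inner_apply_regInv_le (hT : T.IsPositive) (hε : 0 < ε) (x : X) :
    (⟪regInv T ε x, T (regInv T ε x)⟫_ℂ).re ≤ (⟪x, regInv T ε x⟫_ℂ).re := by
  rw [re_inner_regInv hT hε]
  have : 0 ≤ ε * ‖regInv T ε x‖ ^ 2 := by positivity
  linarith

/-- This is the source of smallness: on vectors of bounded energy the regularisation error `x - T K
x = ε K x` is `O(√ε)`. -/
theorem norm_regInv_apply_le (hT : T.IsPositive) (hε : 0 < ε) (x : X) {E : ℝ}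
    (hE : (⟪x, regInv T ε x⟫_ℂ).re ≤ E) : ε * ‖regInv T ε x‖ ≤ √(ε * E) := by
  refine Real.le_sqrt_of_sq_le ?_
  have h1 := re_inner_regInv hT hε x
  have h2 := re_inner_nonneg_of_isPositive hT (regInv T ε x)
  have : ε * ‖regInv T ε x‖ ^ 2 ≤ E := by linarith
  nlinarith

/-- The energy of `T y` with respect to `(T + ε)⁻¹`. -/
theorem re_inner_regInv_apply_le (hT : T.IsPositive) (hε : 0 < ε) (y : X) :
    (⟪T y, regInv T ε (T y)⟫_ℂ).re ≤ (⟪y, T y⟫_ℂ).re := by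
  have h1 : 0 ≤ (⟪T y, regInv T ε y⟫_ℂ).re := by
    rw [inner_left_of_isPositive hT]
    have hy : ⟪y, T (regInv T ε y)⟫_ℂ =
        ⟪T (regInv T ε y) + (ε : ℂ) • regInv T ε y, T (regInv T ε y)⟫_ℂ := by
      nth_rewrite 2 [apply_regInv hT hε]; rw [sub_add_cancel]
    have : (⟪y, T (regInv T ε y)⟫_ℂ).re =
        ‖T (regInv T ε y)‖ ^ 2 + ε * (⟪regInv T ε y, T (regInv T ε y)⟫_ℂ).re := by
      rw [hy, inner_add_left, inner_smul_left, Complex.add_re, Complex.conj_ofReal,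
        Complex.re_ofReal_mul]
      congr 1
      exact inner_self_eq_norm_sq (𝕜 := ℂ) _
    rw [this]
    have := re_inner_nonneg_of_isPositive hT (regInv T ε y)
    positivity
  rw [regInv_apply hT hε, inner_sub_right, inner_smul_right, Complex.sub_re,
    Complex.re_ofReal_mul]
  have h2 : (⟪T y, y⟫_ℂ).re = (⟪y, T y⟫_ℂ).re := by rw [inner_left_of_isPositive hT]
  rw [h2]
  nlinarith

end Positive

/-! ### Smooth resolvent families and the regularised equation. -/

/-- `R t = (β + H t)⁻¹` is a strongly continuously differentiable family of positive operators on
the time interval `J`, with derivative `R'` bounded by `R` in the sense of forms. -/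
structure IsSmoothResolvent (H : ℝ → X →ₗ.[ℂ] X) (J : Set ℝ) (β C : ℝ) (R R' : ℝ → X →L[ℂ] X) :
    Prop where
  isOpen : IsOpen J
  beta_pos : 0 < β
  const_pos : 0 < C
  isPositive : ∀ t ∈ J, (R t).IsPositive
  norm_sq_le : ∀ t ∈ J, ∀ x, ‖R t x‖ ^ 2 ≤ (⟪x, R t x⟫_ℂ).re
  mem_graph_iff : ∀ t ∈ J, ∀ u f, (u, f) ∈ (H t).graph ↔ R t (f + (β : ℂ) • u) = u
  hasDerivAt : ∀ t ∈ J, ∀ x, HasDerivAt (fun τ => R τ x) (R' t x) t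
  continuousOn_deriv : ∀ x, ContinuousOn (fun t => R' t x) J
  norm_inner_deriv_le : ∀ t ∈ J, ∀ x y,
    ‖⟪x, R' t y⟫_ℂ‖ ≤ C * (√(⟪x, R t x⟫_ℂ).re * √(⟪y, R t y⟫_ℂ).re)

namespace IsSmoothResolvent

variable {H : ℝ → X →ₗ.[ℂ] X} {J : Set ℝ} {β C : ℝ} {R R' : ℝ → X →L[ℂ] X}
  (h : IsSmoothResolvent H J β C R R')
include h

theorem norm_le_one {t : ℝ} (ht : t ∈ J) : ‖R t‖ ≤ 1 := by
  refine ContinuousLinearMap.opNorm_le_bound _ zero_le_one fun x => ?_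
  have h1 := h.norm_sq_le t ht x
  have h2 := (Complex.re_le_norm _).trans (norm_inner_le_norm (𝕜 := ℂ) x (R t x))
  rw [one_mul]
  rcases (norm_nonneg (R t x)).eq_or_lt with h | h
  · rw [← h]; positivity
  · refine le_of_mul_le_mul_right ?_ h
    nlinarith

theorem re_inner_le {t : ℝ} (ht : t ∈ J) (x : X) : (⟪x, R t x⟫_ℂ).re ≤ ‖x‖ ^ 2 := by
  refine (Complex.re_le_norm _).trans ((norm_inner_le_norm (𝕜 := ℂ) x (R t x)).trans ?_)
  have := (R t).le_of_opNorm_le (h.norm_le_one ht) x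
  nlinarith [norm_nonneg x]

theorem sqrt_re_inner_le {t : ℝ} (ht : t ∈ J) (x : X) : √(⟪x, R t x⟫_ℂ).re ≤ ‖x‖ :=
  (Real.sqrt_le_sqrt (h.re_inner_le ht x)).trans_eq (Real.sqrt_sq (norm_nonneg x))

theorem norm_deriv_le {t : ℝ} (ht : t ∈ J) : ‖R' t‖ ≤ C := by
  have hC := h.const_pos
  refine ContinuousLinearMap.opNorm_le_bound _ hC.le fun y => ?_
  have h1 := h.norm_inner_deriv_le t ht (R' t y) y
  rw [inner_self_eq_norm_sq_to_K] at h1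
  have h2 : ‖((‖R' t y‖ : ℂ)) ^ 2‖ = ‖R' t y‖ ^ 2 := by simp
  have h3 : C * (√(⟪R' t y, R t (R' t y)⟫_ℂ).re * √(⟪y, R t y⟫_ℂ).re) ≤
      C * (‖R' t y‖ * ‖y‖) := by
    gcongr
    · exact h.sqrt_re_inner_le ht _
    · exact h.sqrt_re_inner_le ht _
  have h4 : ‖R' t y‖ ^ 2 ≤ C * (‖R' t y‖ * ‖y‖) := by
    rw [← h2]; exact h1.trans h3
  rcases (norm_nonneg (R' t y)).eq_or_lt with h | h
  · rw [← h]; positivity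
  · refine le_of_mul_le_mul_right ?_ h
    nlinarith

theorem hasDerivAt_regInv {t ε : ℝ} (ht : t ∈ J) (hε : 0 < ε) (x : X) :
    HasDerivAt (fun τ => regInv (R τ) ε x)
      (-regInv (R t) ε (R' t (regInv (R t) ε x))) t := by
  have hJ : ∀ᶠ τ in 𝓝 t, τ ∈ J := h.isOpen.mem_nhds ht
  refine hasDerivAt_strong_inverse (B := fun τ => R τ + (ε : ℂ) • 1) (M := ε⁻¹)
    (B' := fun x => R' t x) ?_ ?_ ?_ ?_ x
  · filter_upwards [hJ] with τ hτ using norm_regInv_le (h.isPositive τ hτ) hε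
  · intro y
    exact (h.hasDerivAt t ht y).add_const _
  · filter_upwards [hJ] with τ hτ y
    change regInv (R τ) ε (R τ y + (ε : ℂ) • y) = y
    rw [map_add, map_smul, regInv_apply (h.isPositive τ hτ) hε]; abel
  · intro y
    change R t (regInv (R t) ε y) + (ε : ℂ) • regInv (R t) ε y = y
    rw [apply_regInv (h.isPositive t ht) hε]; abel

theorem continuousOn_regInv {ε : ℝ} (hε : 0 < ε) (x : X) :
    ContinuousOn (fun τ => regInv (R τ) ε x) J := fun _ ht =>
  (h.hasDerivAt_regInv ht hε x).continuousAt.continuousWithinAt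

theorem continuousOn_apply (x : X) : ContinuousOn (fun τ => R τ x) J := fun _ ht =>
  (h.hasDerivAt _ ht x).continuousAt.continuousWithinAt

theorem hasDerivAt_regInv_apply {t ε : ℝ} (ht : t ∈ J) (hε : 0 < ε) {u : ℝ → X} {u' : X}
    (hu : HasDerivAt u u' t) :
    HasDerivAt (fun τ => regInv (R τ) ε (u τ))
      (-regInv (R t) ε (R' t (regInv (R t) ε (u t))) + regInv (R t) ε u') t :=
  HasDerivAt.strong_clm_apply (M := ε⁻¹)
    (by filter_upwards [h.isOpen.mem_nhds ht] with τ hτ using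
      norm_regInv_le (h.isPositive τ hτ) hε)
    (h.hasDerivAt_regInv ht hε) hu

variable {c : ℂ} (hc : c = Complex.I ∨ c = -Complex.I)
include hc

omit h hc in
theorem re_I_mul_eq_zero (hc : c = Complex.I ∨ c = -Complex.I) {z : ℂ} (hz : z.im = 0) :
    (c * z).re = 0 := by
  rcases hc with rfl | rfl <;> simp [hz]

omit h hc in
theorem norm_of_I (hc : c = Complex.I ∨ c = -Complex.I) : ‖c‖ = 1 := by
  rcases hc with rfl | rfl <;> simp

/-- Solutions of the regularised equation `u' = c ((R + ε)⁻¹ - β) u`. -/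
theorem exists_regularised_solution {a b : ℝ} (hJ : Icc a b ⊆ J) {s : ℝ} (hs : s ∈ Icc a b)
    (y : X) {ε : ℝ} (hε : 0 < ε) :
    ∃ u : ℝ → X, u s = R s y ∧ ContinuousOn u (Icc a b) ∧
      (∀ t ∈ Ioo a b, HasDerivAt u (c • (regInv (R t) ε (u t) - (β : ℂ) • u t)) t) ∧
      (∀ t ∈ Icc a b, ‖u t‖ = ‖R s y‖) ∧
      ∀ t ∈ Icc a b, (⟪u t, regInv (R t) ε (u t)⟫_ℂ).re ≤
        Real.exp (C * (b - a)) * (⟪y, R s y⟫_ℂ).re := by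
  have hβ := h.beta_pos
  have hp : ∀ t ∈ Icc a b, (R t).IsPositive := fun t ht => h.isPositive t (hJ ht)
  obtain ⟨u, hus, huc, hud, hun⟩ := exists_solution_of_skew
    (S := fun t => c • (regInv (R t) ε - (β : ℂ) • 1)) (K := ε⁻¹ + β) (a := a) (b := b)
    (fun x => (((h.continuousOn_regInv hε x).mono hJ).sub continuousOn_const).const_smul c)
    (fun t ht => by
      rw [norm_smul, norm_of_I hc, one_mul]
      refine (norm_sub_le _ _).trans (add_le_add (norm_regInv_le (hp t ht) hε) ?_)
      rw [norm_smul, Complex.norm_of_nonneg hβ.le]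
      exact mul_le_of_le_one_right hβ.le ContinuousLinearMap.norm_id_le)
    (fun t ht x => by
      change (⟪x, c • (regInv (R t) ε x - (β : ℂ) • x)⟫_ℂ).re = 0
      rw [inner_smul_right, inner_sub_right, inner_smul_right]
      refine re_I_mul_eq_zero hc ?_
      rw [Complex.sub_im, im_inner_regInv (hp t ht) hε, Complex.im_ofReal_mul]
      have : (⟪x, x⟫_ℂ).im = 0 := inner_self_im (𝕜 := ℂ) x
      rw [this]; simp) hs (R s y)
  have hud' : ∀ t ∈ Ioo a b,
      HasDerivAt u (c • (regInv (R t) ε (u t) - (β : ℂ) • u t)) t := hud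
  refine ⟨u, hus, huc, hud', hun, fun t ht => ?_⟩
  set z : ℝ → X := fun t => regInv (R t) ε (u t) with hz
  have hzc : ContinuousOn z (Icc a b) :=
    ContinuousOn.strong_clm_apply (M := ε⁻¹) (fun t ht => norm_regInv_le (hp t ht) hε)
      (fun x => (h.continuousOn_regInv hε x).mono hJ) huc
  -- The generator `c (K - β)` is a function of `K = (R + ε)⁻¹`, so the terms from `u'` drop out and
  -- only `K' = -K R' K` contributes. The form bound on `R'` turns this into at most `C` times the
  -- energy, with no dependence on `ε`.
  have hE : ∀ t ∈ Ioo a b, HasDerivAt (fun τ => (⟪u τ, z τ⟫_ℂ).re)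
      (-(⟪z t, R' t (z t)⟫_ℂ).re) t := by
    intro t ht
    have ht' := Ioo_subset_Icc_self ht
    have hpt := hp t ht'
    have d1 := hud' t ht
    have d2 := h.hasDerivAt_regInv_apply (hJ ht') hε d1
    have d3 := Complex.reCLM.hasFDerivAt.comp_hasDerivAt t (d1.inner ℂ d2)
    refine d3.congr_deriv ?_
    have e1 : (⟪u t, regInv (R t) ε (c • (z t - (β : ℂ) • u t))⟫_ℂ).re = 0 := by
      rw [← inner_regInv_left hpt hε, inner_smul_right, inner_sub_right, inner_smul_right]
      refine re_I_mul_eq_zero hc ?_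
      rw [Complex.sub_im, Complex.im_ofReal_mul, inner_regInv_left hpt hε,
        inner_regInv_left hpt hε, im_inner_regInv hpt hε, ← inner_regInv_left hpt hε]
      have : (⟪regInv (R t) ε (u t), z t⟫_ℂ).im = 0 := inner_self_im (𝕜 := ℂ) (z t)
      rw [this]; simp
    have e2 : (⟪c • (z t - (β : ℂ) • u t), z t⟫_ℂ).re = 0 := by
      rw [← inner_conj_symm, Complex.conj_re, ← e1, ← inner_regInv_left hpt hε]
    have e3 : ⟪u t, regInv (R t) ε (R' t (z t))⟫_ℂ = ⟪z t, R' t (z t)⟫_ℂ := by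
      rw [← inner_regInv_left hpt hε]
    change (⟪u t, -regInv (R t) ε (R' t (z t)) + regInv (R t) ε (c • (z t - (β : ℂ) • u t))⟫_ℂ +
      ⟪c • (z t - (β : ℂ) • u t), z t⟫_ℂ).re = _
    rw [inner_add_right, inner_neg_right, Complex.add_re, Complex.add_re, e1, e2, e3,
      Complex.neg_re]
    ring
  have hEc : ContinuousOn (fun τ => (⟪u τ, z τ⟫_ℂ).re) (Icc a b) :=
    Complex.continuous_re.comp_continuousOn (huc.inner hzc)
  have hEb : ∀ t ∈ Ioo a b, |-(⟪z t, R' t (z t)⟫_ℂ).re| ≤ C * (⟪u t, z t⟫_ℂ).re := by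
    intro t ht
    have ht' := Ioo_subset_Icc_self ht
    have hpt := hp t ht'
    rw [abs_neg]
    refine (Complex.abs_re_le_norm _).trans ((h.norm_inner_deriv_le t (hJ ht') _ _).trans ?_)
    rw [Real.mul_self_sqrt (re_inner_nonneg_of_isPositive hpt _)]
    exact mul_le_mul_of_nonneg_left (re_inner_apply_regInv_le hpt hε _) h.const_pos.le
  refine (le_exp_mul_of_abs_deriv_le hEc hE hEb hs ht).trans ?_
  have hCp := h.const_pos
  refine mul_le_mul (Real.exp_le_exp.2 (mul_le_mul_of_nonneg_left ?_ hCp.le)) ?_ ?_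
    (Real.exp_nonneg _)
  · rw [abs_le]; constructor <;> linarith [hs.1, hs.2, ht.1, ht.2]
  · simp only [hz, hus]
    exact re_inner_regInv_apply_le (hp s hs) hε y
  · exact re_inner_regInv_nonneg (hp s hs) hε _

/-- Two regularised solutions with the same initial value are close. -/
theorem norm_sub_sq_le_of_regularised {a b : ℝ} (hJ : Icc a b ⊆ J) {s : ℝ} (hs : s ∈ Icc a b)
    {ε δ E N : ℝ} (hε : 0 < ε) (hδ : 0 < δ) {u v : ℝ → X} (huv : u s = v s)
    (huc : ContinuousOn u (Icc a b)) (hvc : ContinuousOn v (Icc a b))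
    (hu : ∀ t ∈ Ioo a b, HasDerivAt u (c • (regInv (R t) ε (u t) - (β : ℂ) • u t)) t)
    (hv : ∀ t ∈ Ioo a b, HasDerivAt v (c • (regInv (R t) δ (v t) - (β : ℂ) • v t)) t)
    (hun : ∀ t ∈ Icc a b, ‖u t‖ ≤ N) (hvn : ∀ t ∈ Icc a b, ‖v t‖ ≤ N)
    (huE : ∀ t ∈ Icc a b, (⟪u t, regInv (R t) ε (u t)⟫_ℂ).re ≤ E)
    (hvE : ∀ t ∈ Icc a b, (⟪v t, regInv (R t) δ (v t)⟫_ℂ).re ≤ E) {t : ℝ} (ht : t ∈ Icc a b) :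
    ‖u t - v t‖ ^ 2 ≤
      √(Real.exp (C * (b - a)) * (4 * N * (√(ε * E) + √(δ * E)) / C)) * (2 * √E) +
        2 * N * (√(ε * E) + √(δ * E)) := by
  have hp : ∀ t ∈ Icc a b, (R t).IsPositive := fun t ht => h.isPositive t (hJ ht)
  have hCp := h.const_pos
  set σ := √(ε * E) + √(δ * E) with hσ
  have hσ0 : 0 ≤ σ := by positivity
  have hN0 : 0 ≤ N := (norm_nonneg _).trans (hun s hs)
  set p : ℝ → X := fun t => regInv (R t) ε (u t) with hpdef
  set q : ℝ → X := fun t => regInv (R t) δ (v t) with hqdef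
  have hdn : ∀ t ∈ Icc a b, ‖u t - v t‖ ≤ 2 * N := fun t ht =>
    (norm_sub_le _ _).trans (by linarith [hun t ht, hvn t ht])
  have hRp : ∀ t ∈ Icc a b, R t (p t) = u t - (ε : ℂ) • p t := fun t ht =>
    apply_regInv (hp t ht) hε _
  have hRq : ∀ t ∈ Icc a b, R t (q t) = v t - (δ : ℂ) • q t := fun t ht =>
    apply_regInv (hp t ht) hδ _
  have hsm : ∀ t ∈ Icc a b, ‖(ε : ℂ) • p t - (δ : ℂ) • q t‖ ≤ σ := by
    intro t ht
    refine (norm_sub_le _ _).trans ?_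
    rw [norm_smul, norm_smul, Complex.norm_of_nonneg hε.le, Complex.norm_of_nonneg hδ.le]
    exact add_le_add (norm_regInv_apply_le (hp t ht) hε _ (huE t ht))
      (norm_regInv_apply_le (hp t ht) hδ _ (hvE t ht))
  -- Derivative of `⟨d, R d⟩` for `d = u - v`. Applying `R` to the difference of the equations
  -- undoes both regularised inverses up to `ε p - δ q`; the rest is `c` times a real quantity after
  -- pairing with `d`.
  set e' : ℝ → ℝ := fun t => (⟪u t - v t, R' t (u t - v t)⟫_ℂ).re -
    2 * (c * ⟪u t - v t, (ε : ℂ) • p t - (δ : ℂ) • q t⟫_ℂ).re with he'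
  have hed : ∀ t ∈ Ioo a b,
      HasDerivAt (fun τ => (⟪u τ - v τ, R τ (u τ - v τ)⟫_ℂ).re) (e' t) t := by
    intro t ht
    have ht' := Ioo_subset_Icc_self ht
    have hpt := hp t ht'
    have d1 := (hu t ht).sub (hv t ht)
    have d2 := HasDerivAt.strong_clm_apply (D := R) (M := 1)
      (by filter_upwards [h.isOpen.mem_nhds (hJ ht')] with τ hτ using h.norm_le_one hτ)
      (h.hasDerivAt t (hJ ht')) d1
    have d3 := Complex.reCLM.hasFDerivAt.comp_hasDerivAt t (d1.inner ℂ d2)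
    refine d3.congr_deriv ?_
    set w := c • (p t - (β : ℂ) • u t) - c • (q t - (β : ℂ) • v t) with hw
    have e1 : R t w = c • ((u t - v t) - ((ε : ℂ) • p t - (δ : ℂ) • q t)
        - (β : ℂ) • R t (u t - v t)) := by
      have : w = c • (p t - q t - (β : ℂ) • (u t - v t)) := by rw [hw]; module
      rw [this, map_smul, map_sub, map_sub, hRp t ht', hRq t ht', map_smul]
      congr 1; abel
    have e2 : (⟪u t - v t, R t w⟫_ℂ).re =
        -(c * ⟪u t - v t, (ε : ℂ) • p t - (δ : ℂ) • q t⟫_ℂ).re := by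
      rw [e1, inner_smul_right, inner_sub_right, inner_sub_right, inner_smul_right, mul_sub,
        mul_sub, Complex.sub_re, Complex.sub_re, re_I_mul_eq_zero hc (inner_self_im (𝕜 := ℂ) _),
        re_I_mul_eq_zero hc (z := (β : ℂ) * ⟪u t - v t, R t (u t - v t)⟫_ℂ)]
      · ring
      · rw [Complex.im_ofReal_mul, im_inner_eq_zero_of_isPositive hpt, mul_zero]
    have e3 : (⟪w, R t (u t - v t)⟫_ℂ).re = (⟪u t - v t, R t w⟫_ℂ).re :=
      re_inner_comm_of_isPositive hpt _ _
    change (⟪u t - v t, R' t (u t - v t) + R t w⟫_ℂ + ⟪w, R t (u t - v t)⟫_ℂ).re = _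
    rw [inner_add_right, Complex.add_re, Complex.add_re, e3, e2, he']
    ring
  have hec : ContinuousOn (fun τ => (⟪u τ - v τ, R τ (u τ - v τ)⟫_ℂ).re) (Icc a b) := by
    refine Complex.continuous_re.comp_continuousOn ((huc.sub hvc).inner ?_)
    exact ContinuousOn.strong_clm_apply (M := 1) (fun t ht => h.norm_le_one (hJ ht))
      (fun x => (h.continuousOn_apply x).mono hJ) (huc.sub hvc)
  have heb : ∀ t ∈ Ioo a b, |e' t| ≤ C * (⟪u t - v t, R t (u t - v t)⟫_ℂ).re + 4 * N * σ := by
    intro t ht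
    have ht' := Ioo_subset_Icc_self ht
    have hpt := hp t ht'
    refine (abs_sub _ _).trans (add_le_add ?_ ?_)
    · refine (Complex.abs_re_le_norm _).trans ((h.norm_inner_deriv_le t (hJ ht') _ _).trans ?_)
      rw [Real.mul_self_sqrt (re_inner_nonneg_of_isPositive hpt _)]
    · rw [abs_mul, abs_two]
      have : |(c * ⟪u t - v t, (ε : ℂ) • p t - (δ : ℂ) • q t⟫_ℂ).re| ≤ 2 * N * σ := by
        refine (Complex.abs_re_le_norm _).trans ?_
        rw [norm_mul, norm_of_I hc, one_mul]
        exact (norm_inner_le_norm _ _).trans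
          (mul_le_mul (hdn t ht') (hsm t ht') (norm_nonneg _) (by positivity))
      linarith
  have hgron := le_exp_mul_add_of_abs_deriv_le hCp hec hed heb hs ht
  have hes : (⟪u s - v s, R s (u s - v s)⟫_ℂ).re = 0 := by rw [huv]; simp
  rw [hes, zero_add] at hgron
  have hpt := hp t ht
  have h1 : (⟪u t - v t, R t (u t - v t)⟫_ℂ).re ≤ Real.exp (C * (b - a)) * (4 * N * σ / C) := by
    have h2 : Real.exp (C * |t - s|) ≤ Real.exp (C * (b - a)) := by
      refine Real.exp_le_exp.2 (mul_le_mul_of_nonneg_left ?_ hCp.le)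
      rw [abs_le]; constructor <;> linarith [hs.1, hs.2, ht.1, ht.2]
    have h3 : 0 ≤ 4 * N * σ / C := by positivity
    have := mul_le_mul_of_nonneg_right h2 h3
    linarith
  have h2 : (⟪p t - q t, R t (p t - q t)⟫_ℂ).re ≤ 4 * E := by
    have a1 := re_inner_sub_le_of_isPositive hpt (p t) (q t)
    have a2 := (re_inner_apply_regInv_le hpt hε (u t)).trans (huE t ht)
    have a3 := (re_inner_apply_regInv_le hpt hδ (v t)).trans (hvE t ht)
    linarith
  -- Interpolation: pairing this identity with `u - v` bounds its norm by the weak norm, which is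
  -- small by Grönwall, times the bounded energy of `p - q`, plus the `O(√ε + √δ)` remainder.
  have h3 : u t - v t = R t (p t - q t) + ((ε : ℂ) • p t - (δ : ℂ) • q t) := by
    rw [map_sub, hRp t ht, hRq t ht]; abel
  have h4 : ‖u t - v t‖ ^ 2 = (⟪u t - v t, R t (p t - q t)⟫_ℂ).re +
      (⟪u t - v t, (ε : ℂ) • p t - (δ : ℂ) • q t⟫_ℂ).re := by
    rw [← Complex.add_re, ← inner_add_right, ← h3]
    exact (inner_self_eq_norm_sq (𝕜 := ℂ) _).symm
  rw [h4]
  refine add_le_add ?_ ?_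
  · refine ((le_abs_self _).trans (abs_re_inner_le_of_isPositive hpt _ _)).trans ?_
    refine mul_le_mul (Real.sqrt_le_sqrt h1) ((Real.sqrt_le_sqrt h2).trans_eq ?_)
      (Real.sqrt_nonneg _) (Real.sqrt_nonneg _)
    rw [Real.sqrt_mul (by norm_num), show (4 : ℝ) = 2 ^ 2 by norm_num,
      Real.sqrt_sq (by norm_num)]
  · refine (Complex.re_le_norm _).trans ((norm_inner_le_norm _ _).trans ?_)
    exact mul_le_mul (hdn t ht) (hsm t ht) (norm_nonneg _) (by positivity)

end IsSmoothResolvent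

end RollnikSchroedinger

/-! ### Mild solutions on compact intervals: stability under limits, norm conservation, uniqueness.
-/

namespace RollnikSchroedinger

variable {X : Type*} [NormedAddCommGroup X] [InnerProductSpace ℂ X] [CompleteSpace X]

theorem mem_graph_smul {A : X →ₗ.[ℂ] X} {x y : X} (c : ℂ) (h : (x, y) ∈ A.graph) :
    (x, c • y) ∈ (c • A).graph := by
  rw [LinearPMap.smul_graph]
  exact ⟨(x, y), h, rfl⟩

theorem exists_of_mem_graph_smul {A : X →ₗ.[ℂ] X} {x y : X} {c : ℂ}
    (h : (x, y) ∈ (c • A).graph) : ∃ f, (x, f) ∈ A.graph ∧ c • f = y := by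
  rw [LinearPMap.smul_graph] at h
  obtain ⟨⟨p, q⟩, hp, e⟩ := h
  have e1 : p = x := congrArg Prod.fst e
  have e2 : c • q = y := congrArg Prod.snd e
  exact ⟨q, e1 ▸ hp, e2⟩

/-- The inner product as a real bilinear map. -/
noncomputable def innerRealBilin (X : Type*) [NormedAddCommGroup X] [InnerProductSpace ℂ X] :
    X →L[ℝ] X →L[ℝ] ℂ :=
  (isBoundedBilinearMap_inner (𝕜 := ℂ) (E := X)).toContinuousLinearMap

@[simp] theorem innerRealBilin_apply (x y : X) : innerRealBilin X x y = ⟪x, y⟫_ℂ := rfl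

section W12

variable {a b : ℝ}

theorem intervalIntegrable_of_memLp (hab : a ≤ b) {g : ℝ → X}
    (hg : MemLp g 2 (volume.restrict (Icc a b))) : IntervalIntegrable g volume a b :=
  (intervalIntegrable_iff_integrableOn_Icc_of_le hab).2 (hg.integrable one_le_two)

theorem memLp_of_continuousOn {g : ℝ → X} (hg : ContinuousOn g (Icc a b)) (p : ℝ≥0∞) :
    MemLp g p (volume.restrict (Icc a b)) := by
  obtain ⟨M, hM⟩ := isCompact_Icc.exists_bound_of_continuousOn hg
  exact MemLp.of_bound (hg.aestronglyMeasurable measurableSet_Icc) M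
    (ae_restrict_of_forall_mem measurableSet_Icc hM)

theorem sub_eq_integral_of_hasDerivAt {f g : ℝ → X} (hf : ContinuousOn f (Icc a b))
    (hd : ∀ t ∈ Ioo a b, HasDerivAt f (g t) t) (hg : ContinuousOn g (Icc a b)) :
    ∀ s ∈ Icc a b, ∀ t ∈ Icc a b, f t - f s = ∫ τ in s..t, g τ := by
  intro s hs t ht
  have hsub : uIcc s t ⊆ Icc a b := uIcc_subset_Icc hs ht
  refine (intervalIntegral.integral_eq_sub_of_hasDeriv_right (hf.mono hsub) ?_
    (hg.mono hsub).intervalIntegrable).symm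
  intro x hx
  exact (hd x ⟨(le_min hs.1 ht.1).trans_lt hx.1, hx.2.trans_le (max_le hs.2 ht.2)⟩).hasDerivWithinAt

theorem isW12_of_hasDerivAt {f g : ℝ → X} (hf : ContinuousOn f (Icc a b))
    (hd : ∀ t ∈ Ioo a b, HasDerivAt f (g t) t) (hg : ContinuousOn g (Icc a b)) :
    IsW12 (Icc a b) f g :=
  ⟨memLp_of_continuousOn hf _, memLp_of_continuousOn hg _, sub_eq_integral_of_hasDerivAt hf hd hg⟩

theorem IsW12.continuousOn {f g : ℝ → X} (hab : a ≤ b) (h : IsW12 (Icc a b) f g) :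
    ContinuousOn f (Icc a b) :=
  continuousOn_of_sub_eq_integral hab (intervalIntegrable_of_memLp hab h.memLp_deriv)
    h.sub_eq_integral

theorem IsW12.mono {f g : ℝ → X} {J J' : Set ℝ} (h : IsW12 J f g) (hJ : J' ⊆ J) :
    IsW12 J' f g :=
  ⟨h.memLp.mono_measure (Measure.restrict_mono_set _ hJ),
    h.memLp_deriv.mono_measure (Measure.restrict_mono_set _ hJ),
    fun s hs t ht => h.sub_eq_integral s (hJ hs) t (hJ ht)⟩

theorem IsRegular.mono {A : ℝ → X →ₗ.[ℂ] X} {f g h : ℝ → X} {J J' : Set ℝ}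
    (hr : IsRegular A J f g h) (hJ : J' ⊆ J) : IsRegular A J' f g h :=
  ⟨hr.isW12.mono hJ, ae_mono (Measure.restrict_mono_set _ hJ) hr.mem_graph,
    hr.memLp_apply.mono_measure (Measure.restrict_mono_set _ hJ)⟩

theorem IsRegular.sub {A : ℝ → X →ₗ.[ℂ] X} {f g h f' g' h' : ℝ → X}
    (hr : IsRegular A (Icc a b) f g h) (hr' : IsRegular A (Icc a b) f' g' h') (hab : a ≤ b) :
    IsRegular A (Icc a b) (f - f') (g - g') (h - h') := by
  have i1 := intervalIntegrable_of_memLp hab hr.isW12.memLp_deriv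
  have i2 := intervalIntegrable_of_memLp hab hr'.isW12.memLp_deriv
  refine ⟨⟨hr.isW12.memLp.sub hr'.isW12.memLp, hr.isW12.memLp_deriv.sub hr'.isW12.memLp_deriv, ?_⟩,
    ?_, hr.memLp_apply.sub hr'.memLp_apply⟩
  · intro s hs t ht
    have hsub : uIcc s t ⊆ uIcc a b := by rw [uIcc_of_le hab]; exact uIcc_subset_Icc hs ht
    simp only [Pi.sub_apply]
    rw [intervalIntegral.integral_sub (i1.mono_set hsub) (i2.mono_set hsub),
      ← hr.isW12.sub_eq_integral s hs t ht, ← hr'.isW12.sub_eq_integral s hs t ht]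
    abel
  · filter_upwards [hr.mem_graph, hr'.mem_graph] with t h1 h2
    exact (A t).graph.sub_mem h1 h2

theorem IsW12.inner_sub_eq_integral {f g f' g' : ℝ → X} (hab : a ≤ b) (h : IsW12 (Icc a b) f g)
    (h' : IsW12 (Icc a b) f' g') {s t : ℝ} (hs : s ∈ Icc a b) (ht : t ∈ Icc a b) :
    ⟪f t, f' t⟫_ℂ - ⟪f s, f' s⟫_ℂ = ∫ τ in s..t, (⟪g τ, f' τ⟫_ℂ + ⟪f τ, g' τ⟫_ℂ) :=
  bilin_sub_eq_integral (innerRealBilin X) hab (intervalIntegrable_of_memLp hab h.memLp_deriv)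
    (intervalIntegrable_of_memLp hab h'.memLp_deriv) h.sub_eq_integral h'.sub_eq_integral s hs t ht

theorem integral_norm_le_of_eLpNorm_le {r : ℝ → X} {η : ℝ} (hab : a ≤ b) (hη : 0 ≤ η)
    (hr : MemLp r 2 (volume.restrict (Icc a b)))
    (h : eLpNorm r 2 (volume.restrict (Icc a b)) ≤ ENNReal.ofReal η) :
    ∫ τ in a..b, ‖r τ‖ ≤ η * √(b - a) := by
  rw [intervalIntegral.integral_of_le hab, ← integral_Icc_eq_integral_Ioc,
    integral_norm_eq_lintegral_enorm hr.aestronglyMeasurable, ← eLpNorm_one_eq_lintegral_enorm]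
  refine ENNReal.toReal_le_of_le_ofReal (by positivity) ?_
  refine (eLpNorm_le_eLpNorm_mul_rpow_measure_univ one_le_two hr.aestronglyMeasurable).trans ?_
  have e1 : (volume.restrict (Icc a b)) univ ^ (1 / (1 : ℝ≥0∞).toReal - 1 / (2 : ℝ≥0∞).toReal) =
      ENNReal.ofReal (√(b - a)) := by
    rw [Measure.restrict_apply_univ, Real.volume_Icc, Real.sqrt_eq_rpow,
      ENNReal.ofReal_rpow_of_nonneg (by linarith) (by norm_num)]
    norm_num
  rw [e1, ENNReal.ofReal_mul hη]
  gcongr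

end W12

/-- Uniform limits of regular functions that solve `u' = A(t) u` up to a small `L²` error. -/
def IsMildOn (A : ℝ → X →ₗ.[ℂ] X) (a b : ℝ) (u : ℝ → X) : Prop :=
  ContinuousOn u (Icc a b) ∧ ∀ ε : ℝ, 0 < ε → ∃ f g h : ℝ → X, IsRegular A (Icc a b) f g h ∧
    (∀ t ∈ Icc a b, ‖f t - u t‖ ≤ ε) ∧
    eLpNorm (fun t => -g t + h t) 2 (volume.restrict (Icc a b)) ≤ ENNReal.ofReal ε

namespace IsMildOn

variable {A : ℝ → X →ₗ.[ℂ] X} {a b : ℝ} {u v : ℝ → X}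

theorem of_bound (hab : a ≤ b) (huc : ContinuousOn u (Icc a b))
    (h : ∀ ε : ℝ, 0 < ε → ∃ f g h : ℝ → X, IsRegular A (Icc a b) f g h ∧
      (∀ t ∈ Icc a b, ‖f t - u t‖ ≤ ε) ∧ ∀ t ∈ Icc a b, ‖-g t + h t‖ ≤ ε) : IsMildOn A a b u := by
  refine ⟨huc, fun ε hε => ?_⟩
  have hk : 0 < 1 + √(b - a) := by positivity
  -- Passing from a sup bound to an `L²` bound on `[a, b]` costs `√(b - a)`; the summand 1 also
  -- keeps the uniform error below `ε`.
  obtain ⟨f, g, h, hr, h1, h2⟩ := h (ε / (1 + √(b - a))) (by positivity)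
  refine ⟨f, g, h, hr, fun t ht => (h1 t ht).trans (div_le_self hε.le (by simp)), ?_⟩
  refine (eLpNorm_le_of_ae_bound (ae_restrict_of_forall_mem measurableSet_Icc h2)).trans ?_
  rw [Measure.restrict_apply_univ, Real.volume_Icc,
    ENNReal.ofReal_rpow_of_nonneg (by linarith) (by norm_num),
    ← ENNReal.ofReal_mul (by positivity)]
  refine ENNReal.ofReal_le_ofReal ?_
  have : (b - a) ^ (ENNReal.toReal 2)⁻¹ = √(b - a) := by
    rw [Real.sqrt_eq_rpow]; norm_num
  rw [this, ← mul_div_assoc, div_le_iff₀ hk]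
  nlinarith [Real.sqrt_nonneg (b - a)]

theorem mono (h : IsMildOn A a b u) {a' b' : ℝ} (hs : Icc a' b' ⊆ Icc a b) :
    IsMildOn A a' b' u := by
  refine ⟨h.1.mono hs, fun ε hε => ?_⟩
  obtain ⟨f, g, k, hr, h1, h2⟩ := h.2 ε hε
  exact ⟨f, g, k, hr.mono hs, fun t ht => h1 t (hs ht),
    (eLpNorm_mono_measure _ (Measure.restrict_mono_set _ hs)).trans h2⟩

theorem congr (h : IsMildOn A a b u) (huv : ∀ t ∈ Icc a b, v t = u t) : IsMildOn A a b v := by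
  refine ⟨h.1.congr huv, fun ε hε => ?_⟩
  obtain ⟨f, g, k, hr, h1, h2⟩ := h.2 ε hε
  exact ⟨f, g, k, hr, fun t ht => by rw [huv t ht]; exact h1 t ht, h2⟩

theorem of_tendstoUniformlyOn {U : ℕ → ℝ → X} (hU : ∀ n, IsMildOn A a b (U n))
    (h : TendstoUniformlyOn U u atTop (Icc a b)) : IsMildOn A a b u := by
  refine ⟨h.continuousOn (Frequently.of_forall fun n => (hU n).1), fun ε hε => ?_⟩
  obtain ⟨n, hn⟩ := (Metric.tendstoUniformlyOn_iff.1 h (ε / 2) (by positivity)).exists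
  obtain ⟨f, g, k, hr, h1, h2⟩ := (hU n).2 (ε / 2) (by positivity)
  refine ⟨f, g, k, hr, fun t ht => ?_, h2.trans (ENNReal.ofReal_le_ofReal (by linarith))⟩
  have h3 := hn t ht
  rw [dist_comm, dist_eq_norm] at h3
  have := norm_sub_le_norm_sub_add_norm_sub (f t) (U n t) (u t)
  linarith [h1 t ht]

theorem sub (hab : a ≤ b) (hu : IsMildOn A a b u) (hv : IsMildOn A a b v) :
    IsMildOn A a b (u - v) := by
  refine ⟨hu.1.sub hv.1, fun ε hε => ?_⟩
  obtain ⟨f, g, k, hr, h1, h2⟩ := hu.2 (ε / 2) (by positivity)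
  obtain ⟨f', g', k', hr', h1', h2'⟩ := hv.2 (ε / 2) (by positivity)
  refine ⟨f - f', g - g', k - k', hr.sub hr' hab, fun t ht => ?_, ?_⟩
  · have : (f - f') t - (u - v) t = (f t - u t) - (f' t - v t) := by
      simp only [Pi.sub_apply]; abel
    rw [this]
    exact (norm_sub_le _ _).trans (by linarith [h1 t ht, h1' t ht])
  · have : (fun t => -(g - g') t + (k - k') t) =
        (fun t => -g t + k t) - fun t => -g' t + k' t := by
      ext t; simp only [Pi.sub_apply]; abel
    rw [this]
    refine (eLpNorm_sub_le (hr.isW12.memLp_deriv.neg.add hr.memLp_apply).aestronglyMeasurable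
      (hr'.isW12.memLp_deriv.neg.add hr'.memLp_apply).aestronglyMeasurable one_le_two).trans ?_
    refine (add_le_add h2 h2').trans ?_
    rw [← ENNReal.ofReal_add (by positivity) (by positivity)]
    exact ENNReal.ofReal_le_ofReal (by linarith)

/-- For skew-symmetric `A(t)` mild solutions have constant norm. -/
theorem norm_eq (hA : ∀ t x y, (x, y) ∈ (A t).graph → (⟪x, y⟫_ℂ).re = 0) (hab : a ≤ b)
    (hu : IsMildOn A a b u) {s t : ℝ} (hs : s ∈ Icc a b) (ht : t ∈ Icc a b) : ‖u t‖ = ‖u s‖ := by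
  obtain ⟨N, hN⟩ := isCompact_Icc.exists_bound_of_continuousOn hu.1
  have hN0 : 0 ≤ N := (norm_nonneg _).trans (hN s hs)
  have key : ∀ ε : ℝ, 0 < ε → |‖u t‖ ^ 2 - ‖u s‖ ^ 2| ≤
      2 * ((2 * N + ε) * ε) + 2 * (N + ε) * (ε * √(b - a)) := by
    intro ε hε
    obtain ⟨f, g, k, hr, h1, h2⟩ := hu.2 ε hε
    have hfN : ∀ τ ∈ Icc a b, ‖f τ‖ ≤ N + ε := fun τ hτ => by
      have := norm_sub_norm_le (f τ) (u τ); linarith [h1 τ hτ, hN τ hτ]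
    have hcl : ∀ τ ∈ Icc a b, |‖f τ‖ ^ 2 - ‖u τ‖ ^ 2| ≤ (2 * N + ε) * ε := by
      intro τ hτ
      rw [sq_sub_sq, abs_mul, abs_of_nonneg (by positivity)]
      refine mul_le_mul ?_ ((abs_norm_sub_norm_le _ _).trans (h1 τ hτ)) (abs_nonneg _)
        (by positivity)
      linarith [hfN τ hτ, hN τ hτ]
    have hrm : MemLp (fun t => -g t + k t) 2 (volume.restrict (Icc a b)) :=
      hr.isW12.memLp_deriv.neg.add hr.memLp_apply
    have hri := (intervalIntegrable_of_memLp hab hrm).norm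
    have hmain : |‖f t‖ ^ 2 - ‖f s‖ ^ 2| ≤ 2 * (N + ε) * (ε * √(b - a)) := by
      have e := hr.isW12.inner_sub_eq_integral hab hr.isW12 hs ht
      have e1 : ‖⟪f t, f t⟫_ℂ - ⟪f s, f s⟫_ℂ‖ = |‖f t‖ ^ 2 - ‖f s‖ ^ 2| := by
        rw [inner_self_eq_norm_sq_to_K, inner_self_eq_norm_sq_to_K]
        have q := Complex.norm_real (‖f t‖ ^ 2 - ‖f s‖ ^ 2)
        push_cast at q
        exact q
      rw [← e1, e]
      have hsub : uIoc s t ⊆ Icc a b := uIoc_subset_uIcc.trans (uIcc_subset_Icc hs ht)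
      have hint : IntegrableOn (fun τ => 2 * (N + ε) * ‖-g τ + k τ‖) (Icc a b) :=
        ((intervalIntegrable_iff_integrableOn_Icc_of_le hab).1 hri).const_mul _
      refine (intervalIntegral.norm_integral_le_integral_norm_uIoc).trans ?_
      calc ∫ τ in uIoc s t, ‖⟪g τ, f τ⟫_ℂ + ⟪f τ, g τ⟫_ℂ‖
          ≤ ∫ τ in uIoc s t, 2 * (N + ε) * ‖-g τ + k τ‖ := by
            refine integral_mono_of_nonneg (Eventually.of_forall fun _ => norm_nonneg _)
              (hint.mono_set hsub) ?_
            filter_upwards [ae_mono (Measure.restrict_mono_set _ hsub) hr.mem_graph,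
              ae_restrict_mem measurableSet_uIoc] with τ hτ hτ'
            have z := hA τ _ _ hτ
            -- Skew-symmetry gives `Re ⟨f, k⟩ = 0`, so `g` may be replaced by `g - k` in the
            -- derivative of `‖f‖²`; what is left is the defect, which is small in `L²`.
            have z1 : ⟪g τ, f τ⟫_ℂ + ⟪f τ, g τ⟫_ℂ =
                ((-(2 * (⟪f τ, -g τ + k τ⟫_ℂ).re) : ℝ) : ℂ) := by
              rw [← inner_conj_symm (g τ), add_comm, Complex.add_conj, inner_add_right,
                inner_neg_right, Complex.add_re, Complex.neg_re, z]
              push_cast; ring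
            rw [z1, Complex.norm_real, norm_neg, norm_mul, Real.norm_two, mul_assoc]
            gcongr
            refine (Complex.abs_re_le_norm _).trans ((norm_inner_le_norm _ _).trans ?_)
            gcongr
            exact hfN τ (hsub hτ')
        _ ≤ ∫ τ in Icc a b, 2 * (N + ε) * ‖-g τ + k τ‖ :=
            setIntegral_mono_set hint (Eventually.of_forall fun _ => by positivity)
              (Eventually.of_forall hsub)
        _ ≤ _ := by
            rw [integral_const_mul]
            gcongr
            rw [integral_Icc_eq_integral_Ioc, ← intervalIntegral.integral_of_le hab]
            exact integral_norm_le_of_eLpNorm_le hab hε.le hrm h2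
    have h3 := abs_le.1 (hcl t ht)
    have h4 := abs_le.1 (hcl s hs)
    have h5 := abs_le.1 hmain
    rw [abs_le]; constructor <;> linarith
  have hlim : Tendsto (fun ε : ℝ => 2 * ((2 * N + ε) * ε) + 2 * (N + ε) * (ε * √(b - a)))
      (𝓝[>] 0) (𝓝 0) := by
    have : Continuous (fun ε : ℝ => 2 * ((2 * N + ε) * ε) + 2 * (N + ε) * (ε * √(b - a))) := by
      fun_prop
    have := this.tendsto 0
    simp only [mul_zero, zero_mul, add_zero] at this
    exact this.mono_left nhdsWithin_le_nhds
  have h0 : |‖u t‖ ^ 2 - ‖u s‖ ^ 2| ≤ 0 :=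
    ge_of_tendsto hlim (eventually_mem_nhdsWithin.mono fun ε hε => key ε hε)
  have h1 := abs_eq_zero.1 (le_antisymm h0 (abs_nonneg _))
  exact (sq_eq_sq₀ (norm_nonneg _) (norm_nonneg _)).1 (sub_eq_zero.1 h1)

theorem eq_of_eq (hA : ∀ t x y, (x, y) ∈ (A t).graph → (⟪x, y⟫_ℂ).re = 0) (hab : a ≤ b)
    (hu : IsMildOn A a b u) (hv : IsMildOn A a b v) {s t : ℝ} (hs : s ∈ Icc a b)
    (ht : t ∈ Icc a b) (h : u s = v s) : u t = v t := by
  have := (hu.sub hab hv).norm_eq hA hab hs ht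
  simpa [h, sub_eq_zero] using this

end IsMildOn

/-! ### Mild solutions as limits of regularised solutions. -/

namespace IsSmoothResolvent

variable {H : ℝ → X →ₗ.[ℂ] X} {J : Set ℝ} {β C : ℝ} {R R' : ℝ → X →L[ℂ] X}
  (h : IsSmoothResolvent H J β C R R') {c : ℂ} (hc : c = Complex.I ∨ c = -Complex.I)
include h

/-- Pair `w = ε K R' K p` with itself. The form bound on `R'` leaves `⟨K w, R K w⟩^{1/2} ≤ ε^{-1/2}
‖w‖` and the root of the energy of `p`, so one power of `‖w‖` cancels and a factor `√ε` survives. An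
operator-norm estimate would give no smallness. -/
theorem norm_regInv_deriv_le {t ε E : ℝ} (ht : t ∈ J) (hε : 0 < ε) {p : X}
    (hE : (⟪p, regInv (R t) ε p⟫_ℂ).re ≤ E) :
    ‖(ε : ℂ) • regInv (R t) ε (R' t (regInv (R t) ε p))‖ ≤ C * √(ε * E) := by
  have hp := h.isPositive t ht
  have hC := h.const_pos
  set K := regInv (R t) ε with hK
  set w := (ε : ℂ) • K (R' t (K p)) with hw
  have e1 : ⟪w, w⟫_ℂ = (ε : ℂ) * ⟪K w, R' t (K p)⟫_ℂ := by
    conv_lhs => rw [hw]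
    rw [inner_smul_right, ← hw, inner_regInv_left hp hε]
  have e2 : ‖w‖ ^ 2 = ε * ‖⟪K w, R' t (K p)⟫_ℂ‖ := by
    have q := congrArg norm e1
    rw [norm_mul, Complex.norm_of_nonneg hε.le, inner_self_eq_norm_sq_to_K] at q
    rw [← q]; simp
  have e3 : √(⟪K w, R t (K w)⟫_ℂ).re ≤ √(ε⁻¹ * ‖w‖ ^ 2) := by
    refine Real.sqrt_le_sqrt ((re_inner_apply_regInv_le hp hε w).trans ?_)
    refine (Complex.re_le_norm _).trans ((norm_inner_le_norm _ _).trans ?_)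
    have := K.le_of_opNorm_le (norm_regInv_le hp hε) w
    nlinarith [norm_nonneg w]
  have e4 : √(⟪K p, R t (K p)⟫_ℂ).re ≤ √E :=
    Real.sqrt_le_sqrt ((re_inner_apply_regInv_le hp hε p).trans hE)
  have e5 : ‖w‖ ^ 2 ≤ ε * (C * (√(ε⁻¹ * ‖w‖ ^ 2) * √E)) := by
    rw [e2]
    gcongr
    refine (h.norm_inner_deriv_le t ht _ _).trans ?_
    rw [← e2]
    gcongr
  have e6 : ε * (C * (√(ε⁻¹ * ‖w‖ ^ 2) * √E)) = (C * √(ε * E)) * ‖w‖ := by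
    rw [Real.sqrt_mul (by positivity), Real.sqrt_mul hε.le, Real.sqrt_sq (norm_nonneg w),
      Real.sqrt_inv]
    have : ε = √ε * √ε := (Real.mul_self_sqrt hε.le).symm
    have h0 : √ε ≠ 0 := (Real.sqrt_pos.2 hε).ne'
    field_simp
    rw [Real.sq_sqrt hε.le]
  rw [e6] at e5
  rcases (norm_nonneg w).eq_or_lt with h0 | h0
  · rw [← h0]; positivity
  · exact le_of_mul_le_mul_right (by nlinarith) h0

include hc

/-- Regularisation of the solution `u` of the regularised equation. -/
theorem exists_regular_near {a b : ℝ} (hJ : Icc a b ⊆ J) {ε δ E : ℝ} (hε : 0 < ε)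
    (hδ : 0 < δ) {u : ℝ → X} (huc : ContinuousOn u (Icc a b))
    (hu : ∀ t ∈ Ioo a b, HasDerivAt u (c • (regInv (R t) δ (u t) - (β : ℂ) • u t)) t)
    (huE : ∀ t ∈ Icc a b, (⟪u t, regInv (R t) δ (u t)⟫_ℂ).re ≤ E) :
    ∃ f g k : ℝ → X, IsRegular (fun t => c • H t) (Icc a b) f g k ∧
      (∀ t ∈ Icc a b, ‖f t - u t‖ ≤ √(ε * E) + √(δ * E)) ∧
      ∀ t ∈ Icc a b, ‖-g t + k t‖ ≤ C * √(ε * E) + (C + 1) * (√(δ * E) / ε) := by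
  have hp : ∀ t ∈ Icc a b, (R t).IsPositive := fun t ht => h.isPositive t (hJ ht)
  have hC := h.const_pos
  set K : ℝ → X →L[ℂ] X := fun t => regInv (R t) ε with hK
  set z : ℝ → X := fun t => regInv (R t) δ (u t) with hz
  have hKb : ∀ t ∈ Icc a b, ‖K t‖ ≤ ε⁻¹ := fun t ht => norm_regInv_le (hp t ht) hε
  have hKs : ∀ x, ContinuousOn (fun t => K t x) (Icc a b) := fun x =>
    (h.continuousOn_regInv hε x).mono hJ
  have hKc : ∀ {v : ℝ → X}, ContinuousOn v (Icc a b) →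
      ContinuousOn (fun t => K t (v t)) (Icc a b) := fun hv =>
    ContinuousOn.strong_clm_apply hKb hKs hv
  have hzc : ContinuousOn z (Icc a b) :=
    ContinuousOn.strong_clm_apply (fun t ht => norm_regInv_le (hp t ht) hδ)
      (fun x => (h.continuousOn_regInv hδ x).mono hJ) huc
  have hR'c : ∀ {v : ℝ → X}, ContinuousOn v (Icc a b) →
      ContinuousOn (fun t => R' t (v t)) (Icc a b) := fun hv =>
    ContinuousOn.strong_clm_apply (fun t ht => h.norm_deriv_le (hJ ht))
      (fun x => (h.continuousOn_deriv x).mono hJ) hv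
  set u' : ℝ → X := fun t => c • (z t - (β : ℂ) • u t) with hu'
  have hu'c : ContinuousOn u' (Icc a b) := (hzc.sub (huc.const_smul (β : ℂ))).const_smul c
  -- This is `R K u`, so it lies in the domain of `H`, and `H f = K u - β f`; hence the choice of
  -- `k` as `c H f`.
  set f : ℝ → X := fun t => u t - (ε : ℂ) • K t (u t) with hf
  set g : ℝ → X := fun t => u' t - (ε : ℂ) • (-K t (R' t (K t (u t))) + K t (u' t)) with hg
  set k : ℝ → X := fun t => c • (K t (u t) - (β : ℂ) • f t) with hk
  have hfc : ContinuousOn f (Icc a b) := huc.sub ((hKc huc).const_smul (ε : ℂ))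
  have hgc : ContinuousOn g (Icc a b) :=
    hu'c.sub (((hKc (hR'c (hKc huc))).neg.add (hKc hu'c)).const_smul (ε : ℂ))
  have hkc : ContinuousOn k (Icc a b) := ((hKc huc).sub (hfc.const_smul (β : ℂ))).const_smul c
  have hzn : ∀ t ∈ Icc a b, ‖(δ : ℂ) • z t‖ ≤ √(δ * E) := fun t ht => by
    rw [norm_smul, Complex.norm_of_nonneg hδ.le]
    exact norm_regInv_apply_le (hp t ht) hδ _ (huE t ht)
  -- The energy bound on `u` is for the parameter `δ`, not for `ε`. The part `R z` has `ε`-energy at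
  -- most `E`; the part `δ z` is of size `√(δ E)` and is estimated in norm, at the cost of factors
  -- `1/ε`.
  have hsplit : ∀ t ∈ Icc a b, u t = R t (z t) + (δ : ℂ) • z t := fun t ht => by
    rw [hz, apply_regInv (hp t ht) hδ]; abel
  have hpE : ∀ t ∈ Icc a b, (⟪R t (z t), K t (R t (z t))⟫_ℂ).re ≤ E := fun t ht =>
    (re_inner_regInv_apply_le (hp t ht) hε _).trans
      ((re_inner_apply_regInv_le (hp t ht) hδ _).trans (huE t ht))
  refine ⟨f, g, k, ⟨isW12_of_hasDerivAt hfc ?_ hgc, ?_, memLp_of_continuousOn hkc _⟩, ?_, ?_⟩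
  · intro t ht
    exact (hu t ht).sub
      ((h.hasDerivAt_regInv_apply (hJ (Ioo_subset_Icc_self ht)) hε (hu t ht)).const_smul (ε : ℂ))
  · refine ae_restrict_of_forall_mem measurableSet_Icc fun t ht => ?_
    refine mem_graph_smul c ((h.mem_graph_iff t (hJ ht) _ _).2 ?_)
    rw [sub_add_cancel]
    exact apply_regInv (hp t ht) hε _
  · intro t ht
    have e : f t - u t = -((ε : ℂ) • K t (R t (z t)) + (ε : ℂ) • K t ((δ : ℂ) • z t)) := by
      rw [← smul_add, ← map_add, ← hsplit t ht, hf]; simp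
    rw [e, norm_neg]
    refine (norm_add_le _ _).trans (add_le_add ?_ ?_)
    · rw [norm_smul, Complex.norm_of_nonneg hε.le]
      exact norm_regInv_apply_le (hp t ht) hε _ (hpE t ht)
    · rw [norm_smul, Complex.norm_of_nonneg hε.le]
      have := (K t).le_of_opNorm_le_of_le (hKb t ht) (hzn t ht)
      calc ε * _ ≤ ε * (ε⁻¹ * √(δ * E)) := by gcongr
        _ = _ := by field_simp
  · intro t ht
    have hRz : R t (z t) = u t - (δ : ℂ) • z t := apply_regInv (hp t ht) hδ _
    have hKRz : K t (R t (z t)) = z t - (ε : ℂ) • K t (z t) := regInv_apply (hp t ht) hε _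
    have eKz : (ε : ℂ) • K t (z t) = z t - K t (u t) + (δ : ℂ) • K t (z t) := by
      rw [hRz, map_sub, map_smul] at hKRz
      rw [eq_sub_iff_add_eq] at hKRz
      generalize K t (z t) = q at hKRz ⊢
      rw [← hKRz]; abel
    -- If `u` solved the exact equation, the defect would be only the commutator of `d/dt` with `ε
    -- K`, the term with `R'`. The last summand accounts for `u` solving the `δ`-equation instead.
    have e : -g t + k t = -((ε : ℂ) • K t (R' t (K t (R t (z t)))) +
        (ε : ℂ) • K t (R' t (K t ((δ : ℂ) • z t)))) + c • K t ((δ : ℂ) • z t) := by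
      rw [← smul_add, ← map_add, ← map_add, ← map_add, ← hsplit t ht]
      have e1 : (ε : ℂ) • K t (u' t) = c • ((ε : ℂ) • K t (z t) - (β : ℂ) • (ε : ℂ) • K t (u t)) := by
        simp only [hu', map_smul, map_sub]; module
      simp only [hg, hk, smul_add, smul_neg]
      rw [e1, eKz, map_smul]
      simp only [hf, hu']
      module
    rw [e]
    have n1 : ‖(ε : ℂ) • K t (R' t (K t (R t (z t))))‖ ≤ C * √(ε * E) :=
      h.norm_regInv_deriv_le (hJ ht) hε (hpE t ht)
    have n3 : ‖K t ((δ : ℂ) • z t)‖ ≤ √(δ * E) / ε :=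
      ((K t).le_of_opNorm_le_of_le (hKb t ht) (hzn t ht)).trans_eq (by rw [inv_mul_eq_div])
    have n2 : ‖(ε : ℂ) • K t (R' t (K t ((δ : ℂ) • z t)))‖ ≤ C * (√(δ * E) / ε) := by
      rw [norm_smul, Complex.norm_of_nonneg hε.le]
      have := (K t).le_of_opNorm_le_of_le (hKb t ht)
        ((R' t).le_of_opNorm_le_of_le (h.norm_deriv_le (hJ ht)) n3)
      calc ε * _ ≤ ε * (ε⁻¹ * (C * (√(δ * E) / ε))) := by gcongr
        _ = _ := by field_simp
    have n4 : ‖c • K t ((δ : ℂ) • z t)‖ ≤ √(δ * E) / ε := by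
      rw [norm_smul, norm_of_I hc, one_mul]; exact n3
    refine (norm_add_le _ _).trans ?_
    rw [norm_neg]
    have := norm_add_le ((ε : ℂ) • K t (R' t (K t (R t (z t)))))
      ((ε : ℂ) • K t (R' t (K t ((δ : ℂ) • z t))))
    linarith

theorem exists_mild_of_range {a b : ℝ} (hJ : Icc a b ⊆ J) {s : ℝ} (hs : s ∈ Icc a b) (y : X) :
    ∃ u : ℝ → X, u s = R s y ∧ IsMildOn (fun t => c • H t) a b u := by
  have hab : a ≤ b := hs.1.trans hs.2
  have hC := h.const_pos
  have hsol : ∀ ε : ℝ, ∃ u : ℝ → X, 0 < ε → u s = R s y ∧ ContinuousOn u (Icc a b) ∧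
      (∀ t ∈ Ioo a b, HasDerivAt u (c • (regInv (R t) ε (u t) - (β : ℂ) • u t)) t) ∧
      (∀ t ∈ Icc a b, ‖u t‖ = ‖R s y‖) ∧
      ∀ t ∈ Icc a b, (⟪u t, regInv (R t) ε (u t)⟫_ℂ).re ≤
        Real.exp (C * (b - a)) * (⟪y, R s y⟫_ℂ).re := by
    intro ε
    by_cases hε : 0 < ε
    · obtain ⟨u, hu⟩ := h.exists_regularised_solution hc hJ hs y hε
      exact ⟨u, fun _ => hu⟩
    · exact ⟨0, fun h => absurd h hε⟩
  choose v hv using hsol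
  set E := Real.exp (C * (b - a)) * (⟪y, R s y⟫_ℂ).re with hE
  set N := ‖R s y‖ with hN
  set F : ℝ × ℝ → ℝ := fun p =>
    √(Real.exp (C * (b - a)) * (4 * N * (√(p.1 * E) + √(p.2 * E)) / C)) * (2 * √E) +
        2 * N * (√(p.1 * E) + √(p.2 * E)) with hF
  have hFc : Continuous F := by fun_prop
  have hF0 : Tendsto F (𝓝[>] 0 ×ˢ 𝓝[>] 0) (𝓝 0) := by
    have h1 := hFc.tendsto (0, 0)
    rw [show F (0, 0) = 0 by simp [hF]] at h1
    refine h1.mono_left ?_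
    rw [nhds_prod_eq]
    exact Filter.prod_mono nhdsWithin_le_nhds nhdsWithin_le_nhds
  have hUC : UniformCauchySeqOn v (𝓝[>] 0) (Icc a b) := by
    intro W hW
    obtain ⟨η, hη, hηW⟩ := Metric.mem_uniformity_dist.1 hW
    have hpos : ∀ᶠ p : ℝ × ℝ in 𝓝[>] 0 ×ˢ 𝓝[>] 0, 0 < p.1 ∧ 0 < p.2 :=
      (eventually_mem_nhdsWithin (a := (0 : ℝ)) (s := Ioi 0)).prod_mk eventually_mem_nhdsWithin
    filter_upwards [hpos, hF0.eventually (gt_mem_nhds (show (0 : ℝ) < η ^ 2 by positivity))]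
      with p hp1 hp2 t ht
    refine hηW ?_
    obtain ⟨a1, a2, a3, a4, a5⟩ := hv p.1 hp1.1
    obtain ⟨b1, b2, b3, b4, b5⟩ := hv p.2 hp1.2
    have := h.norm_sub_sq_le_of_regularised hc hJ hs hp1.1 hp1.2 (a1.trans b1.symm) a2 b2 a3 b3
      (fun t ht => (a4 t ht).le) (fun t ht => (b4 t ht).le) a5 b5 ht
    rw [dist_eq_norm]
    exact lt_of_pow_lt_pow_left₀ 2 hη.le (this.trans_lt hp2)
  have hlim : ∀ t, ∃ w : X, t ∈ Icc a b → Tendsto (fun ε => v ε t) (𝓝[>] 0) (𝓝 w) := by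
    intro t
    by_cases ht : t ∈ Icc a b
    · obtain ⟨w, hw⟩ := CompleteSpace.complete (hUC.cauchy_map ht)
      exact ⟨w, fun _ => hw⟩
    · exact ⟨0, fun h => absurd h ht⟩
  choose u hu using hlim
  have hTU := hUC.tendstoUniformlyOn_of_tendsto hu
  have hev : ∀ᶠ ε : ℝ in 𝓝[>] 0, 0 < ε := eventually_mem_nhdsWithin
  refine ⟨u, ?_, IsMildOn.of_bound hab
    (hTU.continuousOn (hev.mono fun ε hε => (hv ε hε).2.1).frequently) fun η hη => ?_⟩
  · refine tendsto_nhds_unique (hu s hs) (tendsto_const_nhds.congr' ?_)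
    filter_upwards [hev] with ε hε using (hv ε hε).1.symm
  -- Take `δ = ε⁴`: then the loss `√(δ E) / ε` equals `ε √E` and still tends to zero.
  · have hpow : Tendsto (fun ε : ℝ => ε ^ 4) (𝓝[>] 0) (𝓝[>] 0) := by
      refine tendsto_nhdsWithin_iff.2 ⟨?_, hev.mono fun ε hε => pow_pos hε 4⟩
      have : Continuous fun ε : ℝ => ε ^ 4 := by fun_prop
      simpa using (this.tendsto 0).mono_left nhdsWithin_le_nhds
    have t1 : ∀ᶠ ε : ℝ in 𝓝[>] 0, ∀ t ∈ Icc a b, dist (u t) (v (ε ^ 4) t) < η / 2 :=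
      hpow.eventually (Metric.tendstoUniformlyOn_iff.1 hTU (η / 2) (by positivity))
    have t2 : ∀ᶠ ε : ℝ in 𝓝[>] 0, √(ε * E) + √(ε ^ 4 * E) < η / 2 := by
      have : Continuous fun ε : ℝ => √(ε * E) + √(ε ^ 4 * E) := by fun_prop
      have h1 := (this.tendsto 0).mono_left (nhdsWithin_le_nhds (s := Ioi 0))
      refine h1.eventually (gt_mem_nhds ?_)
      simpa using hη
    have t3 : ∀ᶠ ε : ℝ in 𝓝[>] 0, C * √(ε * E) + (C + 1) * (ε * √E) < η := by
      have : Continuous fun ε : ℝ => C * √(ε * E) + (C + 1) * (ε * √E) := by fun_prop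
      have h1 := (this.tendsto 0).mono_left (nhdsWithin_le_nhds (s := Ioi 0))
      refine h1.eventually (gt_mem_nhds ?_)
      simpa using hη
    obtain ⟨ε, ⟨⟨hε, h1⟩, h2⟩, h3⟩ := (((hev.and t1).and t2).and t3).exists
    obtain ⟨a1, a2, a3, a4, a5⟩ := hv (ε ^ 4) (pow_pos hε 4)
    obtain ⟨f, g, k, hr, m1, m2⟩ := h.exists_regular_near hc hJ hε (pow_pos hε 4) a2 a3 a5
    refine ⟨f, g, k, hr, fun t ht => ?_, fun t ht => ?_⟩
    · have q1 := m1 t ht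
      have q2 := h1 t ht
      rw [dist_comm, dist_eq_norm] at q2
      have := norm_sub_le_norm_sub_add_norm_sub (f t) (v (ε ^ 4) t) (u t)
      linarith
    · have q1 := m2 t ht
      have q2 : √(ε ^ 4 * E) / ε = ε * √E := by
        rw [Real.sqrt_mul (by positivity), show ε ^ 4 = (ε ^ 2) ^ 2 by ring,
          Real.sqrt_sq (by positivity)]
        field_simp
      rw [q2] at q1
      linarith

omit hc in
-- The orthogonal complement of the range is the kernel of `R`, and `R y = 0` puts `(0, y)` in the
-- graph of the single-valued operator `H`.
theorem dense_range {s : ℝ} (hs : s ∈ J) : DenseRange (R s) := by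
  have h1 : ((R s : X →ₗ[ℂ] X).range)ᗮ = ⊥ := by
    rw [Submodule.eq_bot_iff]
    intro y hy
    have h2 : R s y = 0 := by
      have := hy (R s (R s y)) ⟨R s y, rfl⟩
      rw [inner_left_of_isPositive (h.isPositive s hs)] at this
      exact inner_self_eq_zero.1 this
    have h3 : ((0 : X), y) ∈ (H s).graph := (h.mem_graph_iff s hs _ _).2 (by simpa using h2)
    exact LinearPMap.graph_fst_eq_zero_snd _ h3 rfl
  have h2 := Submodule.dense_iff_topologicalClosure_eq_top.2
    (Submodule.topologicalClosure_eq_top_iff.2 h1)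
  exact h2

/-- Norm conservation makes solutions depend isometrically on their initial value, so solutions
starting in the dense range of `R s` converge uniformly. -/
theorem exists_mild (hA : ∀ t x y, (x, y) ∈ (c • H t).graph → (⟪x, y⟫_ℂ).re = 0) {a b : ℝ}
    (hJ : Icc a b ⊆ J) {s : ℝ} (hs : s ∈ Icc a b) (x : X) :
    ∃ u : ℝ → X, u s = x ∧ IsMildOn (fun t => c • H t) a b u := by
  have hab : a ≤ b := hs.1.trans hs.2
  obtain ⟨p, hp, hpx⟩ := mem_closure_iff_seq_limit.1 (h.dense_range (hJ hs) x)
  choose y hy using hp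
  choose v hv1 hv2 using fun n => h.exists_mild_of_range hc hJ hs (y n)
  have hUC : UniformCauchySeqOn v atTop (Icc a b) := by
    rw [Metric.uniformCauchySeqOn_iff]
    intro ε hε
    obtain ⟨M, hM⟩ := Metric.cauchySeq_iff.1 hpx.cauchySeq ε hε
    refine ⟨M, fun m hm n hn t ht => ?_⟩
    have h1 := ((hv2 m).sub hab (hv2 n)).norm_eq hA hab hs ht
    simp only [Pi.sub_apply] at h1
    rw [dist_eq_norm, h1, hv1, hv1, hy, hy, ← dist_eq_norm]
    exact hM m hm n hn
  have hlim : ∀ t, ∃ w : X, t ∈ Icc a b → Tendsto (fun n => v n t) atTop (𝓝 w) := by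
    intro t
    by_cases ht : t ∈ Icc a b
    · obtain ⟨w, hw⟩ := CompleteSpace.complete (hUC.cauchy_map ht)
      exact ⟨w, fun _ => hw⟩
    · exact ⟨0, fun h => absurd h ht⟩
  choose u hu using hlim
  refine ⟨u, ?_, IsMildOn.of_tendstoUniformlyOn hv2 (hUC.tendstoUniformlyOn_of_tendsto hu)⟩
  refine tendsto_nhds_unique (hu s hs) (hpx.congr fun n => ?_)
  rw [hv1, hy]

end IsSmoothResolvent

end RollnikSchroedinger

/-! ### The unitary propagator and its orbits as mild and weak solutions. -/

namespace RollnikSchroedinger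

variable {X : Type*} [NormedAddCommGroup X] [InnerProductSpace ℂ X] [CompleteSpace X]

section W12

variable {J : Set ℝ}

theorem IsW12.const_smul {f g : ℝ → X} (h : IsW12 J f g) (c : ℂ) : IsW12 J (c • f) (c • g) := by
  refine ⟨h.memLp.const_smul c, h.memLp_deriv.const_smul c, fun s hs t ht => ?_⟩
  simp only [Pi.smul_apply]
  rw [intervalIntegral.integral_smul, ← h.sub_eq_integral s hs t ht, smul_sub]

theorem IsRegular.const_smul {A : ℝ → X →ₗ.[ℂ] X} {f g h : ℝ → X} (hr : IsRegular A J f g h)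
    (c : ℂ) : IsRegular A J (c • f) (c • g) (c • h) := by
  refine ⟨hr.isW12.const_smul c, ?_, hr.memLp_apply.const_smul c⟩
  filter_upwards [hr.mem_graph] with t ht
  exact (A t).graph.smul_mem c ht

end W12

theorem IsMildOn.const_smul {A : ℝ → X →ₗ.[ℂ] X} {a b : ℝ} {u : ℝ → X} (h : IsMildOn A a b u)
    (c : ℂ) : IsMildOn A a b (c • u) := by
  refine ⟨h.1.const_smul c, fun ε hε => ?_⟩
  have hk : 0 < ‖c‖ + 1 := by positivity
  obtain ⟨f, g, k, hr, h1, h2⟩ := h.2 (ε / (‖c‖ + 1)) (by positivity)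
  have hcε : ‖c‖ * (ε / (‖c‖ + 1)) ≤ ε := by
    rw [← mul_div_assoc, div_le_iff₀ hk]; nlinarith
  refine ⟨c • f, c • g, c • k, hr.const_smul c, fun t ht => ?_, ?_⟩
  · simp only [Pi.smul_apply]
    rw [← smul_sub, norm_smul]
    exact (mul_le_mul_of_nonneg_left (h1 t ht) (norm_nonneg c)).trans hcε
  · have e : (fun t => -(c • g) t + (c • k) t) = c • fun t => -g t + k t := by
      ext t; simp only [Pi.smul_apply]; rw [smul_add, smul_neg]
    rw [e, eLpNorm_const_smul]
    refine (mul_le_mul_right h2 _).trans ?_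
    rw [← ofReal_norm, ← ENNReal.ofReal_mul (norm_nonneg c)]
    exact ENNReal.ofReal_le_ofReal hcε

/-- Every `A(t)` is skew-adjoint, in the form in which this is used. -/
structure IsSkewAdjointFamily (A : ℝ → X →ₗ.[ℂ] X) : Prop where
  inner_eq : ∀ t x y z w, (x, y) ∈ (A t).graph → (z, w) ∈ (A t).adjoint.graph → ⟪y, z⟫_ℂ = ⟪x, w⟫_ℂ
  mem_adjoint : ∀ t x y, (x, y) ∈ (A t).graph → (x, -y) ∈ (A t).adjoint.graph
  mem_of_inner : ∀ t x y, (∀ z w, (z, w) ∈ (A t).adjoint.graph → ⟪y, z⟫_ℂ = ⟪x, w⟫_ℂ) →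
    (x, y) ∈ (A t).graph

theorem IsSkewAdjointFamily.re_inner {A : ℝ → X →ₗ.[ℂ] X} (hA : IsSkewAdjointFamily A) (t : ℝ)
    (x y : X) (h : (x, y) ∈ (A t).graph) : (⟪x, y⟫_ℂ).re = 0 := by
  have h1 := hA.inner_eq t x y x (-y) h (hA.mem_adjoint t x y h)
  rw [inner_neg_right, ← inner_conj_symm] at h1
  have := congrArg Complex.re h1
  simp only [Complex.conj_re, Complex.neg_re] at this
  linarith

/-- A unitary propagator all of whose orbits are mild solutions. -/
structure IsMildPropagator (A : ℝ → X →ₗ.[ℂ] X) (U : ℝ → ℝ → X →L[ℂ] X) : Prop where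
  isUnitary : IsUnitaryPropagator U
  isMildOn : ∀ s x d, IsMildOn A (-d) d fun t => U t s x

theorem exists_isMildPropagator {A : ℝ → X →ₗ.[ℂ] X} (hA : IsSkewAdjointFamily A)
    (hex : ∀ d s x, s ∈ Icc (-d) d → ∃ u : ℝ → X, u s = x ∧ IsMildOn A (-d) d u) :
    ∃ U : ℝ → ℝ → X →L[ℂ] X, IsMildPropagator A U := by
  have hsk := hA.re_inner
  choose S hS1 hS2 using hex
  have hmem : ∀ s t : ℝ, s ∈ Icc (-(|s| + |t|)) (|s| + |t|) := fun s t =>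
    abs_le.1 (by linarith [abs_nonneg t])
  have hmem' : ∀ s t : ℝ, t ∈ Icc (-(|s| + |t|)) (|s| + |t|) := fun s t =>
    abs_le.1 (by linarith [abs_nonneg s])
  -- For each `t` a solution on an interval just large enough to contain `s` and `t` is evaluated.
  -- Uniqueness makes the values independent of the interval.
  set sol : ℝ → X → ℝ → X := fun s x t => S (|s| + |t|) s x (hmem s t) t with hsol
  have key : ∀ d s x (v : ℝ → X), s ∈ Icc (-d) d → IsMildOn A (-d) d v → v s = x →
      ∀ t ∈ Icc (-d) d, sol s x t = v t := by
    intro d s x v hs hv hvs t ht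
    set d' := |s| + |t|
    rcases le_total d d' with hd | hd
    · have hsub : Icc (-d) d ⊆ Icc (-d') d' := Icc_subset_Icc (by linarith) hd
      exact IsMildOn.eq_of_eq hsk (hs.1.trans hs.2) ((hS2 d' s x (hmem s t)).mono hsub) hv hs ht
        ((hS1 d' s x _).trans hvs.symm)
    · have hsub : Icc (-d') d' ⊆ Icc (-d) d := Icc_subset_Icc (by linarith) hd
      exact IsMildOn.eq_of_eq hsk ((hmem s t).1.trans (hmem s t).2) (hS2 d' s x (hmem s t))
        (hv.mono hsub) (hmem s t) (hmem' s t) ((hS1 d' s x _).trans hvs.symm)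
  have hsolm : ∀ s x d, IsMildOn A (-d) d (sol s x) := by
    intro s x d
    have hs : s ∈ Icc (-(|s| + |d|)) (|s| + |d|) := hmem s d
    have hsub : Icc (-d) d ⊆ Icc (-(|s| + |d|)) (|s| + |d|) := by
      have := le_abs_self d
      have := abs_nonneg s
      exact Icc_subset_Icc (by linarith) (by linarith)
    exact ((hS2 _ s x hs).congr fun t ht =>
      key _ s x _ hs (hS2 _ s x hs) (hS1 _ s x hs) t ht).mono hsub
  have hsol0 : ∀ s x, sol s x s = x := fun s x => hS1 _ s x _
  have huniq : ∀ s x (v : ℝ → X), (∀ d, IsMildOn A (-d) d v) → v s = x → ∀ t, v t = sol s x t :=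
    fun s x v hv hvs t =>
      (key (|s| + |t|) s x v (hmem s t) (hv _) hvs t (hmem' s t)).symm
  have hsolsub : ∀ s x y t, sol s (x - y) t = sol s x t - sol s y t := by
    intro s x y t
    refine (huniq s (x - y) (sol s x - sol s y) (fun d => ?_) (by simp [hsol0]) t).symm
    have hd : -(|d|) ≤ |d| := by linarith [abs_nonneg d]
    refine ((hsolm s x |d|).sub hd (hsolm s y |d|)).mono ?_
    have := le_abs_self d
    exact Icc_subset_Icc (by linarith) (by linarith)
  have hsolsmul : ∀ s (c : ℂ) x t, sol s (c • x) t = c • sol s x t := fun s c x t =>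
    (huniq s (c • x) (c • sol s x) (fun d => (hsolm s x d).const_smul c) (by simp [hsol0]) t).symm
  have hsoladd : ∀ s x y t, sol s (x + y) t = sol s x t + sol s y t := by
    intro s x y t
    have := hsolsub s (x + y) y t
    rw [add_sub_cancel_right] at this
    rw [this]; abel
  have hnorm : ∀ s x t, ‖sol s x t‖ = ‖x‖ := by
    intro s x t
    rw [(hsolm s x (|s| + |t|)).norm_eq hsk ((hmem s t).1.trans (hmem s t).2) (hmem s t)
      (hmem' s t), hsol0]
  set U : ℝ → ℝ → X →L[ℂ] X := fun t s => LinearMap.mkContinuous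
    { toFun := fun x => sol s x t
      map_add' := fun x y => hsoladd s x y t
      map_smul' := fun c x => hsolsmul s c x t } 1 (fun x => by
        rw [one_mul]; exact (hnorm s x t).le) with hU
  have hUa : ∀ t s x, U t s x = sol s x t := fun _ _ _ => rfl
  have hUn : ∀ t s x, ‖U t s x‖ = ‖x‖ := fun t s x => hnorm s x t
  have hcomp : ∀ t r s, U t r * U r s = U t s := by
    intro t r s
    ext x
    change sol r (sol s x r) t = sol s x t
    exact (huniq r _ (sol s x) (hsolm s x) rfl t).symm
  have hrefl : ∀ t, U t t = 1 := fun t => by ext x; exact hsol0 t x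
  have hcont1 : ∀ s x, Continuous fun t => U t s x := by
    intro s x
    rw [continuous_iff_continuousAt]
    intro t
    have h1 := (hsolm s x (|t| + 1)).1
    refine h1.continuousAt (Icc_mem_nhds ?_ ?_)
    · linarith [neg_abs_le t]
    · linarith [le_abs_self t]
  -- `U t s` is isometric and has the right inverse `U s t`, because the equation is solved in both
  -- time directions; so its adjoint is that inverse.
  have hadj : ∀ t s, star (U t s) = U s t := by
    intro t s
    have h1 : star (U t s) * U t s = 1 := by
      have : (U t s).adjoint ∘L U t s = 1 :=
        (ContinuousLinearMap.norm_map_iff_adjoint_comp_self (U t s)).1 (hUn t s)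
      exact this
    have h2 : U t s * U s t = 1 := by rw [hcomp, hrefl]
    calc star (U t s) = star (U t s) * (U t s * U s t) := by rw [h2, mul_one]
      _ = U s t := by rw [← mul_assoc, h1, one_mul]
  refine ⟨U, ⟨hcomp, hrefl, ?_, ?_, 1, 0, ?_⟩, fun s x d => hsolm s x d⟩
  · intro t s
    rw [Unitary.mem_iff, hadj, hcomp, hcomp, hrefl, hrefl]
    exact ⟨rfl, rfl⟩
  · intro x
    rw [continuous_iff_continuousAt]
    rintro ⟨t₀, s₀⟩
    have h1 : Tendsto (fun p : ℝ × ℝ => ‖U p.1 s₀ x - U t₀ s₀ x‖ + ‖x - U p.2 s₀ x‖)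
        (𝓝 (t₀, s₀)) (𝓝 0) := by
      have c1 : Continuous fun p : ℝ × ℝ => ‖U p.1 s₀ x - U t₀ s₀ x‖ + ‖x - U p.2 s₀ x‖ :=
        (((hcont1 s₀ x).comp continuous_fst).sub continuous_const).norm.add
          (continuous_const.sub ((hcont1 s₀ x).comp continuous_snd)).norm
      have := c1.tendsto (t₀, s₀)
      simpa [hrefl] using this
    rw [ContinuousAt, tendsto_iff_norm_sub_tendsto_zero]
    refine squeeze_zero (fun _ => norm_nonneg _) (fun p => ?_) h1
    -- Joint continuity from continuity in the first variable: the dependence on the second is moved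
    -- under the isometry `U p.1 p.2`, which does not enlarge `x - U p.2 s₀ x`.
    have e : U p.1 p.2 x - U t₀ s₀ x = (U p.1 s₀ x - U t₀ s₀ x) + U p.1 p.2 (x - U p.2 s₀ x) := by
      have : U p.1 p.2 (U p.2 s₀ x) = U p.1 s₀ x :=
        congrArg (fun T : X →L[ℂ] X => T x) (hcomp p.1 p.2 s₀)
      rw [map_sub, this]; abel
    rw [e, ← hUn p.1 p.2 (x - U p.2 s₀ x)]
    exact norm_add_le _ _
  · intro t s _
    rw [zero_mul, Real.exp_zero, mul_one]
    exact ContinuousLinearMap.opNorm_le_bound _ zero_le_one fun x => by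
      rw [one_mul]; exact (hUn t s x).le

/-- Pairing of a mild solution with a regular function for the adjoint family. -/
theorem IsMildOn.inner_sub_eq_integral {A : ℝ → X →ₗ.[ℂ] X} (hA : IsSkewAdjointFamily A) {a b : ℝ}
    (hab : a ≤ b) {u v v' h : ℝ → X} (hu : IsMildOn A a b u)
    (hv : IsRegular (fun t => (A t).adjoint) (Icc a b) v v' h) :
    ⟪u b, v b⟫_ℂ - ⟪u a, v a⟫_ℂ = ∫ τ in a..b, ⟪u τ, v' τ + h τ⟫_ℂ := by
  have ha : a ∈ Icc a b := left_mem_Icc.2 hab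
  have hb : b ∈ Icc a b := right_mem_Icc.2 hab
  have hvc := hv.isW12.continuousOn hab
  obtain ⟨M, hM⟩ := isCompact_Icc.exists_bound_of_continuousOn hvc
  have hM0 : 0 ≤ M := (norm_nonneg _).trans (hM a ha)
  have hqm : MemLp (fun τ => v' τ + h τ) 2 (volume.restrict (Icc a b)) :=
    hv.isW12.memLp_deriv.add hv.memLp_apply
  have hqi := intervalIntegrable_of_memLp hab hqm
  have int1 : ∀ {p q : ℝ → X}, ContinuousOn p (Icc a b) → IntervalIntegrable q volume a b →
      IntervalIntegrable (fun τ => ⟪p τ, q τ⟫_ℂ) volume a b := fun {p q} hp hq =>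
    intervalIntegrable_bilin (innerRealBilin X).flip hq (by rwa [uIcc_of_le hab])
  have int2 : ∀ {p q : ℝ → X}, IntervalIntegrable p volume a b → ContinuousOn q (Icc a b) →
      IntervalIntegrable (fun τ => ⟪p τ, q τ⟫_ℂ) volume a b := fun {p q} hp hq =>
    intervalIntegrable_bilin (innerRealBilin X) hp (by rwa [uIcc_of_le hab])
  set I := ∫ τ in a..b, ‖v' τ + h τ‖ with hI
  have key : ∀ ε : ℝ, 0 < ε →
      ‖(⟪u b, v b⟫_ℂ - ⟪u a, v a⟫_ℂ) - ∫ τ in a..b, ⟪u τ, v' τ + h τ⟫_ℂ‖ ≤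
        ε * (M + M + I + √(b - a) * M) := by
    intro ε hε
    obtain ⟨f, g, k, hr, h1, h2⟩ := hu.2 ε hε
    have hfc := hr.isW12.continuousOn hab
    have hrm : MemLp (fun t => -g t + k t) 2 (volume.restrict (Icc a b)) :=
      hr.isW12.memLp_deriv.neg.add hr.memLp_apply
    have gi := intervalIntegrable_of_memLp hab hr.isW12.memLp_deriv
    have ki := intervalIntegrable_of_memLp hab hr.memLp_apply
    have v'i := intervalIntegrable_of_memLp hab hv.isW12.memLp_deriv
    have hi := intervalIntegrable_of_memLp hab hv.memLp_apply
    have e0 := hr.isW12.inner_sub_eq_integral hab hv.isW12 ha hb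
    -- The adjoint is moved from `v` to the approximant `f`, which lies in `D(A(τ))` almost
    -- everywhere; the mild solution `u` itself need not.
    have e1 : ∫ τ in a..b, ⟪f τ, v' τ + h τ⟫_ℂ = ∫ τ in a..b, (⟪f τ, v' τ⟫_ℂ + ⟪k τ, v τ⟫_ℂ) := by
      refine intervalIntegral.integral_congr_ae' ?_ (by simp [Ioc_eq_empty (not_lt.2 hab)])
      have r1 := (ae_restrict_iff' measurableSet_Icc).1 hr.mem_graph
      have r2 := (ae_restrict_iff' measurableSet_Icc).1 hv.mem_graph
      filter_upwards [r1, r2] with τ t1 t2 hτ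
      have hτ' := Ioc_subset_Icc_self hτ
      rw [inner_add_right, hA.inner_eq τ _ _ _ _ (t1 hτ') (t2 hτ')]
    have e2 : (⟪u b, v b⟫_ℂ - ⟪u a, v a⟫_ℂ) - ∫ τ in a..b, ⟪u τ, v' τ + h τ⟫_ℂ =
        ⟪u b - f b, v b⟫_ℂ - ⟪u a - f a, v a⟫_ℂ - (∫ τ in a..b, ⟪u τ - f τ, v' τ + h τ⟫_ℂ) -
          ∫ τ in a..b, ⟪-g τ + k τ, v τ⟫_ℂ := by
      have q1 : ∫ τ in a..b, ⟪u τ - f τ, v' τ + h τ⟫_ℂ =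
          (∫ τ in a..b, ⟪u τ, v' τ + h τ⟫_ℂ) - ∫ τ in a..b, ⟪f τ, v' τ + h τ⟫_ℂ := by
        simp only [inner_sub_left]
        exact intervalIntegral.integral_sub (int1 hu.1 hqi) (int1 hfc hqi)
      have q2 : ∫ τ in a..b, ⟪-g τ + k τ, v τ⟫_ℂ =
          (∫ τ in a..b, ⟪k τ, v τ⟫_ℂ) - ∫ τ in a..b, ⟪g τ, v τ⟫_ℂ := by
        rw [← intervalIntegral.integral_sub (int2 ki hvc) (int2 gi hvc)]
        congr 1; ext τ
        rw [inner_add_left, inner_neg_left]; ring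
      rw [intervalIntegral.integral_add (int2 gi hvc) (int1 hfc v'i)] at e0
      rw [intervalIntegral.integral_add (int1 hfc v'i) (int2 ki hvc)] at e1
      rw [q1, q2, e1, inner_sub_left, inner_sub_left]
      linear_combination e0
    rw [e2]
    have n1 : ‖⟪u b - f b, v b⟫_ℂ‖ ≤ ε * M := (norm_inner_le_norm _ _).trans
      (mul_le_mul (by rw [norm_sub_rev]; exact h1 b hb) (hM b hb) (norm_nonneg _) hε.le)
    have n2 : ‖⟪u a - f a, v a⟫_ℂ‖ ≤ ε * M := (norm_inner_le_norm _ _).trans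
      (mul_le_mul (by rw [norm_sub_rev]; exact h1 a ha) (hM a ha) (norm_nonneg _) hε.le)
    have n3 : ‖∫ τ in a..b, ⟪u τ - f τ, v' τ + h τ⟫_ℂ‖ ≤ ε * I := by
      rw [hI, ← intervalIntegral.integral_const_mul]
      refine intervalIntegral.norm_integral_le_of_norm_le hab ?_ (hqi.norm.const_mul ε)
      refine Eventually.of_forall fun τ hτ => (norm_inner_le_norm _ _).trans ?_
      have := h1 τ (Ioc_subset_Icc_self hτ)
      rw [norm_sub_rev] at this
      gcongr
    have n4 : ‖∫ τ in a..b, ⟪-g τ + k τ, v τ⟫_ℂ‖ ≤ ε * √(b - a) * M := by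
      refine (intervalIntegral.norm_integral_le_of_norm_le (g := fun τ => ‖-g τ + k τ‖ * M) hab ?_
        ((intervalIntegrable_of_memLp hab hrm).norm.mul_const M)).trans ?_
      · refine Eventually.of_forall fun τ hτ => (norm_inner_le_norm _ _).trans ?_
        have := hM τ (Ioc_subset_Icc_self hτ)
        gcongr
      · rw [intervalIntegral.integral_mul_const]
        gcongr
        exact integral_norm_le_of_eLpNorm_le hab hε.le hrm h2
    have t1 := norm_sub_le (⟪u b - f b, v b⟫_ℂ - ⟪u a - f a, v a⟫_ℂ -
      (∫ τ in a..b, ⟪u τ - f τ, v' τ + h τ⟫_ℂ)) (∫ τ in a..b, ⟪-g τ + k τ, v τ⟫_ℂ)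
    have t2 := norm_sub_le (⟪u b - f b, v b⟫_ℂ - ⟪u a - f a, v a⟫_ℂ)
      (∫ τ in a..b, ⟪u τ - f τ, v' τ + h τ⟫_ℂ)
    have t3 := norm_sub_le ⟪u b - f b, v b⟫_ℂ ⟪u a - f a, v a⟫_ℂ
    linarith
  have hlim : Tendsto (fun ε : ℝ => ε * (M + M + I + √(b - a) * M)) (𝓝[>] 0) (𝓝 0) := by
    have : Continuous (fun ε : ℝ => ε * (M + M + I + √(b - a) * M)) := by fun_prop
    have := this.tendsto 0
    rw [zero_mul] at this
    exact this.mono_left nhdsWithin_le_nhds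
  have h0 := ge_of_tendsto hlim (eventually_mem_nhdsWithin.mono fun ε hε => key ε hε)
  exact sub_eq_zero.1 (norm_eq_zero.1 (le_antisymm h0 (norm_nonneg _)))

theorem IsMildPropagator.isMildSolution {A : ℝ → X →ₗ.[ℂ] X} {U : ℝ → ℝ → X →L[ℂ] X}
    (hU : IsMildPropagator A U) (s : ℝ) (x : X) : IsMildSolution A s x fun t => U t s x := by
  refine ⟨(hU.isUnitary.continuous x).comp (continuous_id.prodMk continuous_const), ?_, ?_⟩
  · rw [hU.isUnitary.refl]; rfl
  · intro d _
    have hpos : ∀ n : ℕ, (0 : ℝ) < 1 / ((n : ℝ) + 1) := fun n => Nat.one_div_pos_of_nat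
    choose f g h hr h1 h2 using fun n : ℕ => (hU.isMildOn s x d).2 (1 / ((n : ℝ) + 1)) (hpos n)
    refine ⟨f, g, h, hr, ?_, ?_⟩
    · rw [Metric.tendstoUniformlyOn_iff]
      intro ε hε
      filter_upwards [tendsto_one_div_add_atTop_nhds_zero_nat.eventually (gt_mem_nhds hε)]
        with n hn t ht
      rw [dist_comm, dist_eq_norm]
      exact (h1 n t ht).trans_lt hn
    · refine tendsto_of_tendsto_of_tendsto_of_le_of_le tendsto_const_nhds ?_
        (fun _ => zero_le) h2
      have := ENNReal.tendsto_ofReal tendsto_one_div_add_atTop_nhds_zero_nat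
      simpa using this

theorem IsMildSolution.isMildOn {A : ℝ → X →ₗ.[ℂ] X} {s : ℝ} {x : X} {u : ℝ → X}
    (hu : IsMildSolution A s x u) {d : ℝ} (hd : |s| < d) : IsMildOn A (-d) d u := by
  obtain ⟨f, g, h, hr, h1, h2⟩ := hu.approx d hd
  refine ⟨hu.continuous.continuousOn, fun ε hε => ?_⟩
  obtain ⟨n, hn1, hn2⟩ := ((Metric.tendstoUniformlyOn_iff.1 h1 ε hε).and
    (h2.eventually (gt_mem_nhds (ENNReal.ofReal_pos.2 hε)))).exists
  refine ⟨f n, g n, h n, hr n, fun t ht => ?_, hn2.le⟩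
  rw [← dist_eq_norm, dist_comm]
  exact (hn1 t ht).le

theorem IsMildPropagator.eq_of_isMildSolution {A : ℝ → X →ₗ.[ℂ] X} {U : ℝ → ℝ → X →L[ℂ] X}
    (hA : IsSkewAdjointFamily A) (hU : IsMildPropagator A U) {s : ℝ} {x : X} {u : ℝ → X}
    (hu : IsMildSolution A s x u) : u = fun t => U t s x := by
  ext t
  have hd : |s| < |s| + |t| + 1 := by linarith [abs_nonneg t]
  have hs : s ∈ Icc (-(|s| + |t| + 1)) (|s| + |t| + 1) := abs_le.1 hd.le
  refine IsMildOn.eq_of_eq hA.re_inner (hs.1.trans hs.2) (hu.isMildOn hd) (hU.isMildOn s x _) hs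
    (abs_le.1 (by linarith [abs_nonneg s])) ?_
  rw [hu.initial, hU.isUnitary.refl]; rfl

theorem IsMildPropagator.isWeakSolution {A : ℝ → X →ₗ.[ℂ] X} {U : ℝ → ℝ → X →L[ℂ] X}
    (hA : IsSkewAdjointFamily A) (hU : IsMildPropagator A U) (s : ℝ) (x : X) :
    IsWeakSolution A s x fun t => U t s x := by
  have hm := hU.isMildSolution s x
  refine ⟨hm.continuous, hm.initial, fun v v' h hv hvc => ?_⟩
  obtain ⟨r, hr⟩ := hvc.isCompact.isBounded.subset_closedBall 0
  have hv0 : ∀ t, r < |t| → v t = 0 := by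
    intro t ht
    refine image_eq_zero_of_notMem_tsupport fun h => ?_
    have := hr h
    rw [mem_closedBall_zero_iff, Real.norm_eq_abs] at this
    linarith
  by_cases hint : Integrable (fun τ => ⟪U τ s x, v' τ + h τ⟫_ℂ) volume
  · have t1 := intervalIntegral_tendsto_integral hint tendsto_neg_atTop_atBot tendsto_id
    refine tendsto_nhds_unique t1 (tendsto_const_nhds.congr' ?_)
    filter_upwards [eventually_gt_atTop (max r 0)] with d hd
    have hd0 : 0 < d := (le_max_right _ _).trans_lt hd
    have hdr : r < d := (le_max_left _ _).trans_lt hd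
    have := (hU.isMildOn s x d).inner_sub_eq_integral hA (by linarith) (hv.mono (subset_univ _))
    rw [hv0 d (by rwa [abs_of_pos hd0]), hv0 (-d) (by rwa [abs_neg, abs_of_pos hd0])] at this
    simpa using this
  -- The Bochner integral of a non-integrable function is 0 by convention, so integrability of the
  -- pairing never has to be proved.
  · exact integral_undef hint

end RollnikSchroedinger

/-! ### Cut-offs, and uniqueness of weak solutions. -/

namespace RollnikSchroedinger

variable {X : Type*} [NormedAddCommGroup X] [InnerProductSpace ℂ X] [CompleteSpace X]

theorem integral_eq_intervalIntegral_of_eq_zero {E : Type*} [NormedAddCommGroup E]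
    [NormedSpace ℝ E] {F : ℝ → E} {d : ℝ} (hd : 0 ≤ d) (h : ∀ t, d ≤ |t| → F t = 0) :
    ∫ t, F t = ∫ t in (-d)..d, F t := by
  rw [intervalIntegral.integral_of_le (by linarith), setIntegral_eq_integral_of_forall_compl_eq_zero]
  intro t ht
  refine h t ?_
  by_contra hlt
  have := abs_lt.1 (not_le.1 hlt)
  exact ht ⟨this.1, this.2.le⟩

theorem intervalIntegrable_of_memLp_univ {E : Type*} [NormedAddCommGroup E] {f : ℝ → E}
    (hf : MemLp f 2 volume) (s t : ℝ) : IntervalIntegrable f volume s t :=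
  intervalIntegrable_iff.2 (((hf.locallyIntegrable one_le_two).integrableOn_isCompact
    isCompact_uIcc).mono_set uIoc_subset_uIcc)

/-- A continuously differentiable real function vanishing outside `(-d, d)`. -/
structure IsCutoff (d : ℝ) (θ θ' : ℝ → ℝ) : Prop where
  nonneg : 0 ≤ d
  hasDerivAt : ∀ t, HasDerivAt θ (θ' t) t
  continuous_deriv : Continuous θ'
  eq_zero : ∀ t, d ≤ |t| → θ t = 0
  deriv_eq_zero : ∀ t, d ≤ |t| → θ' t = 0

theorem IsCutoff.continuous {d : ℝ} {θ θ' : ℝ → ℝ} (h : IsCutoff d θ θ') : Continuous θ :=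
  continuous_iff_continuousAt.2 fun t => (h.hasDerivAt t).continuousAt

/-- The gap `a < d` makes `θ` vanish in a neighbourhood of every `t` with `|t| ≥ d`, hence `θ'`
vanishes there too. -/
theorem isCutoff_of_eq_zero {a d : ℝ} (ha : 0 ≤ a) (had : a < d) {θ θ' : ℝ → ℝ}
    (hθ : ∀ t, HasDerivAt θ (θ' t) t) (hc : Continuous θ') (h0 : ∀ t, a ≤ |t| → θ t = 0) :
    IsCutoff d θ θ' := by
  refine ⟨ha.trans had.le, hθ, hc, fun t ht => h0 t (had.le.trans ht), fun t ht => ?_⟩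
  have h1 : θ =ᶠ[𝓝 t] fun _ => 0 := by
    filter_upwards [continuous_abs.continuousAt.eventually (lt_mem_nhds (had.trans_le ht))]
      with s hs using h0 s hs.le
  exact ((hθ t).congr_of_eventuallyEq h1.symm).unique (hasDerivAt_const t (0 : ℝ))

theorem memLp_smul_of_eq_zero {d : ℝ} {θ : ℝ → ℝ} (hθ : Continuous θ)
    (h0 : ∀ t, d ≤ |t| → θ t = 0) {f : ℝ → X} (hf : MemLp f 2 (volume.restrict (Icc (-d) d))) :
    MemLp (fun t => θ t • f t) 2 volume := by
  have e : (fun t => θ t • f t) = (Icc (-d) d).indicator fun t => θ t • f t := by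
    ext t
    by_cases ht : t ∈ Icc (-d) d
    · rw [indicator_of_mem ht]
    · rw [indicator_of_notMem ht, h0 t, zero_smul]
      by_contra hlt
      exact ht (abs_le.1 (not_le.1 hlt).le)
  rw [e, memLp_indicator_iff_restrict measurableSet_Icc]
  obtain ⟨M, hM⟩ := (isCompact_Icc (a := -d) (b := d)).exists_bound_of_continuousOn
    hθ.continuousOn
  refine hf.of_le_mul (c := M) (hθ.aestronglyMeasurable.smul hf.aestronglyMeasurable) ?_
  filter_upwards [ae_restrict_mem measurableSet_Icc] with t ht
  rw [norm_smul]
  exact mul_le_mul_of_nonneg_right (hM t ht) (norm_nonneg _)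

/-- Multiplying a regular function on `[-d, d]` by a cut-off gives a regular function on `ℝ`. -/
theorem IsRegular.cutoff {A : ℝ → X →ₗ.[ℂ] X} {f g k : ℝ → X} {d : ℝ} {θ θ' : ℝ → ℝ}
    (hr : IsRegular A (Icc (-d) d) f g k) (hθ : IsCutoff d θ θ') :
    IsRegular A univ (fun t => θ t • f t) (fun t => θ' t • f t + θ t • g t)
      (fun t => θ t • k t) := by
  have hd := hθ.nonneg
  have hdd : -d ≤ d := by linarith
  set p : ℝ → X := fun t => θ' t • f t + θ t • g t with hp
  have m1 := memLp_smul_of_eq_zero hθ.continuous hθ.eq_zero hr.isW12.memLp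
  have m2 : MemLp p 2 volume :=
    (memLp_smul_of_eq_zero hθ.continuous_deriv hθ.deriv_eq_zero hr.isW12.memLp).add
    (memLp_smul_of_eq_zero hθ.continuous hθ.eq_zero hr.isW12.memLp_deriv)
  have m3 := memLp_smul_of_eq_zero hθ.continuous hθ.eq_zero hr.memLp_apply
  have hpi : ∀ s t, IntervalIntegrable p volume s t := fun s t =>
    intervalIntegrable_of_memLp_univ m2 s t
  have hpz : ∀ t, d ≤ |t| → p t = 0 := fun t ht => by
    simp [hp, hθ.eq_zero t ht, hθ.deriv_eq_zero t ht]
  have hin : ∀ s ∈ Icc (-d) d, ∀ t ∈ Icc (-d) d, θ t • f t - θ s • f s = ∫ τ in s..t, p τ :=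
    bilin_sub_eq_integral (ContinuousLinearMap.lsmul ℝ ℝ) hdd
      (hθ.continuous_deriv.intervalIntegrable _ _)
      (intervalIntegrable_of_memLp hdd hr.isW12.memLp_deriv)
      (sub_eq_integral_real hθ.hasDerivAt hθ.continuous_deriv) hr.isW12.sub_eq_integral
  -- Clamping to `[-d, d]` changes neither `θ f` nor the integral of its derivative, since both
  -- vanish outside. This carries the product rule, known only on `[-d, d]`, over to all of `ℝ`.
  set κ : ℝ → ℝ := fun t => max (-d) (min d t) with hκ
  have hκm : ∀ t, κ t ∈ Icc (-d) d := fun t =>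
    ⟨le_max_left _ _, max_le hdd (min_le_left _ _)⟩
  have hκ0 : ∀ t, ∫ τ in (κ t)..t, p τ = 0 := by
    intro t
    refine intervalIntegral.integral_zero_ae (Eventually.of_forall fun τ hτ => hpz τ ?_)
    simp only [hκ] at hτ
    rcases le_total t (-d) with h1 | h1
    · rw [min_eq_right (h1.trans hdd), max_eq_left h1, uIoc_of_ge h1] at hτ
      rw [abs_of_nonpos (by linarith [hτ.2])]; linarith [hτ.2]
    · rcases le_total d t with h2 | h2
      · rw [min_eq_left h2, max_eq_right hdd, uIoc_of_le h2] at hτ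
        exact hτ.1.le.trans (le_abs_self _)
      · rw [min_eq_right h2, max_eq_right h1, uIoc_of_le le_rfl, Ioc_self] at hτ
        exact absurd hτ (notMem_empty _)
  have hκf : ∀ t, θ t • f t = θ (κ t) • f (κ t) := by
    intro t
    simp only [hκ]
    rcases le_total t (-d) with h1 | h1
    · rw [min_eq_right (h1.trans hdd), max_eq_left h1, hθ.eq_zero t, hθ.eq_zero (-d)]
      · simp
      · rw [abs_neg]; exact le_abs_self d
      · rw [abs_of_nonpos (by linarith)]; linarith
    · rcases le_total d t with h2 | h2
      · rw [min_eq_left h2, max_eq_right hdd, hθ.eq_zero t (h2.trans (le_abs_self t)),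
          hθ.eq_zero d (le_abs_self d)]; simp
      · rw [min_eq_right h2, max_eq_right h1]
  refine ⟨⟨m1.restrict _, m2.restrict _, fun s _ t _ => ?_⟩, ?_, m3.restrict _⟩
  · change θ t • f t - θ s • f s = _
    rw [hκf t, hκf s, hin _ (hκm s) _ (hκm t)]
    have e1 := intervalIntegral.integral_add_adjacent_intervals (hpi (κ s) (κ t)) (hpi (κ t) t)
    have e2 := intervalIntegral.integral_add_adjacent_intervals (hpi (κ s) s) (hpi s t)
    rw [hκ0, add_zero] at e1
    rw [hκ0, zero_add] at e2
    exact e1.trans e2.symm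
  · rw [Measure.restrict_univ]
    filter_upwards [(ae_restrict_iff' measurableSet_Icc).1 hr.mem_graph] with t ht
    by_cases htd : t ∈ Icc (-d) d
    · have := (A t).graph.smul_mem (θ t : ℂ) (ht htd)
      rwa [Prod.smul_mk, Complex.coe_smul, Complex.coe_smul] at this
    · have h0 : θ t = 0 := by
        refine hθ.eq_zero t ?_
        by_contra hlt
        exact htd (abs_le.1 (not_le.1 hlt).le)
      simp only [h0, zero_smul]
      exact (A t).graph.zero_mem

theorem IsRegular.adjoint {A : ℝ → X →ₗ.[ℂ] X} (hA : IsSkewAdjointFamily A) {J : Set ℝ}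
    {f g k : ℝ → X} (hr : IsRegular A J f g k) :
    IsRegular (fun t => (A t).adjoint) J f g (-k) := by
  refine ⟨hr.isW12, ?_, hr.memLp_apply.neg⟩
  filter_upwards [hr.mem_graph] with t ht using hA.mem_adjoint t _ _ ht

/-- A continuous function whose distributional derivative vanishes is constant. -/
theorem eq_of_forall_integral_deriv_smul_eq_zero {φ : ℝ → ℂ} (hφ : Continuous φ)
    (H : ∀ (d : ℝ) (θ θ' : ℝ → ℝ), IsCutoff d θ θ' → ∫ t, θ' t • φ t = 0) (a b : ℝ) :
    φ a = φ b := by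
  have avg : ∀ (c ε : ℝ) (ρ : ContDiffBump c), (∀ t ∈ Metric.closedBall c ρ.rOut, ‖φ t - φ c‖ ≤ ε) →
      ‖(∫ t, ρ.normed volume t • φ t) - φ c‖ ≤ ε := by
    intro c ε ρ h
    have hi : Integrable (fun t => ρ.normed volume t • φ t) :=
      (ρ.continuous_normed.smul hφ).integrable_of_hasCompactSupport
        (ρ.hasCompactSupport_normed.smul_right)
    have hi2 : Integrable (fun t => ρ.normed volume t • φ c) :=
      (ρ.continuous_normed.smul continuous_const).integrable_of_hasCompactSupport
        (ρ.hasCompactSupport_normed.smul_right)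
    rw [← ρ.integral_normed_smul (μ := volume) (φ c), ← integral_sub hi hi2, ← mul_one ε,
      ← ρ.integral_normed (μ := volume), ← integral_const_mul]
    refine norm_integral_le_of_norm_le (ρ.integrable_normed.const_mul ε)
      (Eventually.of_forall fun t => ?_)
    rw [← smul_sub, norm_smul, Real.norm_of_nonneg (ρ.nonneg_normed t), mul_comm]
    by_cases ht : t ∈ Metric.closedBall c ρ.rOut
    · exact mul_le_mul_of_nonneg_right (h t ht) (ρ.nonneg_normed t)
    · have : ρ.normed volume t = 0 := by
        by_contra hne
        have : t ∈ Function.support (ρ.normed volume) := hne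
        rw [ρ.support_normed_eq] at this
        exact ht (Metric.ball_subset_closedBall this)
      simp [this]
  have key : ∀ ε : ℝ, 0 < ε → ‖φ a - φ b‖ ≤ ε + ε := by
    intro ε hε
    obtain ⟨δ₁, hδ₁, h1⟩ := Metric.continuousAt_iff.1 (hφ.continuousAt (x := a)) ε hε
    obtain ⟨δ₂, hδ₂, h2⟩ := Metric.continuousAt_iff.1 (hφ.continuousAt (x := b)) ε hε
    set δ := min (min δ₁ δ₂) 1 / 2 with hδ
    have hδ0 : 0 < δ := by positivity
    have hδ1 : δ < δ₁ := by
      have := (min_le_left (min δ₁ δ₂) 1).trans (min_le_left _ _); linarith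
    have hδ2 : δ < δ₂ := by
      have := (min_le_left (min δ₁ δ₂) 1).trans (min_le_right _ _); linarith
    have hδ3 : δ < 1 := by
      have := min_le_right (min δ₁ δ₂) 1; linarith
    set ρa : ContDiffBump a := ⟨δ / 2, δ, by positivity, by linarith⟩ with hρa
    set ρb : ContDiffBump b := ⟨δ / 2, δ, by positivity, by linarith⟩ with hρb
    -- A difference of two bumps of mass 1 has integral zero, so its primitive is an admissible
    -- cut-off. Testing with it equates the local averages of `φ` near `a` and near `b`.
    set ψ : ℝ → ℝ := fun t => ρa.normed volume t - ρb.normed volume t with hψ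
    have hψc : Continuous ψ := ρa.continuous_normed.sub ρb.continuous_normed
    set d := |a| + |b| + 1 with hd
    have hz : ∀ t, d ≤ |t| → ψ t = 0 := by
      intro t ht
      have q1 : ρa.normed volume t = 0 := by
        by_contra hne
        have : t ∈ Function.support (ρa.normed volume) := hne
        rw [ρa.support_normed_eq, Metric.mem_ball, Real.dist_eq] at this
        have h3 : |t - a| < δ := this
        have := abs_sub_abs_le_abs_sub t a
        linarith [abs_nonneg b]
      have q2 : ρb.normed volume t = 0 := by
        by_contra hne
        have : t ∈ Function.support (ρb.normed volume) := hne
        rw [ρb.support_normed_eq, Metric.mem_ball, Real.dist_eq] at this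
        have h3 : |t - b| < δ := this
        have := abs_sub_abs_le_abs_sub t b
        linarith [abs_nonneg a]
      simp [hψ, q1, q2]
    have hd0 : 0 ≤ d := by positivity
    have hint : ∫ t in (-d)..d, ψ t = 0 := by
      rw [← integral_eq_intervalIntegral_of_eq_zero hd0 hz, hψ,
        integral_sub ρa.integrable_normed ρb.integrable_normed, ρa.integral_normed,
        ρb.integral_normed, sub_self]
    have hcut : IsCutoff d (fun t => ∫ τ in (-d)..t, ψ τ) ψ := by
      refine ⟨hd0, fun t => ?_, hψc, fun t ht => ?_, hz⟩
      · exact intervalIntegral.integral_hasDerivAt_right (hψc.intervalIntegrable _ _)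
          (hψc.stronglyMeasurableAtFilter _ _) hψc.continuousAt
      · have e := intervalIntegral.integral_add_adjacent_intervals
          (hψc.intervalIntegrable (μ := volume) (-d) d) (hψc.intervalIntegrable d t)
        rcases le_abs.1 ht with h | h
        · rw [hint, zero_add] at e
          rw [← e]
          refine intervalIntegral.integral_zero_ae (Eventually.of_forall fun τ hτ => hz τ ?_)
          rw [uIoc_of_le h] at hτ
          exact hτ.1.le.trans (le_abs_self _)
        · refine intervalIntegral.integral_zero_ae (Eventually.of_forall fun τ hτ => hz τ ?_)
          rw [uIoc_of_ge (by linarith)] at hτ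
          rw [abs_of_nonpos (by linarith [hτ.2])]; linarith [hτ.2]
    have h3 := H d _ ψ hcut
    have hia : Integrable (fun t => ρa.normed volume t • φ t) :=
      (ρa.continuous_normed.smul hφ).integrable_of_hasCompactSupport
        (ρa.hasCompactSupport_normed.smul_right)
    have hib : Integrable (fun t => ρb.normed volume t • φ t) :=
      (ρb.continuous_normed.smul hφ).integrable_of_hasCompactSupport
        (ρb.hasCompactSupport_normed.smul_right)
    simp only [hψ, sub_smul] at h3
    rw [integral_sub hia hib, sub_eq_zero] at h3
    have n1 := avg a ε ρa fun t ht => by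
      have : dist t a < δ₁ := (Metric.mem_closedBall.1 ht).trans_lt hδ1
      rw [← dist_eq_norm]; exact (h1 this).le
    have n2 := avg b ε ρb fun t ht => by
      have : dist t b < δ₂ := (Metric.mem_closedBall.1 ht).trans_lt hδ2
      rw [← dist_eq_norm]; exact (h2 this).le
    rw [h3, norm_sub_rev] at n1
    exact (norm_sub_le_norm_sub_add_norm_sub _ _ _).trans (add_le_add n1 n2)
  have hlim : Tendsto (fun ε : ℝ => ε + ε) (𝓝[>] 0) (𝓝 0) := by
    have : Continuous (fun ε : ℝ => ε + ε) := by fun_prop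
    have := this.tendsto 0
    rw [add_zero] at this
    exact this.mono_left nhdsWithin_le_nhds
  have h0 := ge_of_tendsto hlim (eventually_mem_nhdsWithin.mono fun ε hε => key ε hε)
  exact sub_eq_zero.1 (norm_eq_zero.1 (le_antisymm h0 (norm_nonneg _)))

/-- Formally `⟨u(t), U(t,r) y⟩` has derivative zero. The orbit is not itself an admissible test
function, but its regular approximants `f` are, once cut off, because `A* = -A`. Testing `u` with `θ
f` leaves only the error of `f` and its `L²` defect. -/
theorem IsMildPropagator.integral_deriv_smul_inner_eq_zero {A : ℝ → X →ₗ.[ℂ] X}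
    {U : ℝ → ℝ → X →L[ℂ] X} (hA : IsSkewAdjointFamily A) (hU : IsMildPropagator A U) {s r : ℝ}
    {x y : X} {u : ℝ → X} (hu : IsWeakSolution A s x u) {d : ℝ} {θ θ' : ℝ → ℝ}
    (hθ : IsCutoff d θ θ') : ∫ t, θ' t • ⟪u t, U t r y⟫_ℂ = 0 := by
  have hd := hθ.nonneg
  have hdd : -d ≤ d := by linarith
  set w : ℝ → X := fun t => U t r y with hw
  have hwc : Continuous w := (hU.isMildSolution r y).continuous
  obtain ⟨N, hN⟩ := (isCompact_Icc (a := -d) (b := d)).exists_bound_of_continuousOn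
    hu.continuous.continuousOn
  obtain ⟨M, hM⟩ := (isCompact_Icc (a := -d) (b := d)).exists_bound_of_continuousOn
    hθ.continuous.continuousOn
  obtain ⟨M', hM'⟩ := (isCompact_Icc (a := -d) (b := d)).exists_bound_of_continuousOn
    hθ.continuous_deriv.continuousOn
  have hmem : d ∈ Icc (-d) d := ⟨hdd, le_rfl⟩
  have hN0 : 0 ≤ N := (norm_nonneg _).trans (hN d hmem)
  have hM0 : 0 ≤ M := (norm_nonneg _).trans (hM d hmem)
  have hM'0 : 0 ≤ M' := (norm_nonneg _).trans (hM' d hmem)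
  have key : ∀ ε : ℝ, 0 < ε → ‖∫ t, θ' t • ⟪u t, w t⟫_ℂ‖ ≤
      ε * (M' * N * (d - -d) + M * N * √(d - -d)) := by
    intro ε hε
    obtain ⟨f, g, k, hr, h1, h2⟩ := (hU.isMildOn r y d).2 ε hε
    have hfc := hr.isW12.continuousOn hdd
    have hrm : MemLp (fun t => -g t + k t) 2 (volume.restrict (Icc (-d) d)) :=
      hr.isW12.memLp_deriv.neg.add hr.memLp_apply
    have hri := intervalIntegrable_of_memLp hdd hrm
    have hcs : HasCompactSupport fun t => θ t • f t := by
      refine HasCompactSupport.intro (isCompact_Icc (a := -d) (b := d)) fun t ht => ?_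
      rw [hθ.eq_zero t, zero_smul]
      by_contra hlt
      exact ht (abs_le.1 (not_le.1 hlt).le)
    have hweak := hu.weak_eq _ _ _ ((hr.cutoff hθ).adjoint hA) hcs
    have huc : ContinuousOn u (uIcc (-d) d) := hu.continuous.continuousOn
    have i1 : IntervalIntegrable (fun t => θ' t • ⟪u t, w t - f t⟫_ℂ) volume (-d) d := by
      have : ContinuousOn (fun t => θ' t • ⟪u t, w t - f t⟫_ℂ) (uIcc (-d) d) := by
        rw [uIcc_of_le hdd]
        exact hθ.continuous_deriv.continuousOn.smul
          (hu.continuous.continuousOn.inner (hwc.continuousOn.sub hfc))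
      exact this.intervalIntegrable
    have i2 : IntervalIntegrable (fun t => ⟪u t, θ t • (-g t + k t)⟫_ℂ) volume (-d) d := by
      refine intervalIntegrable_bilin (innerRealBilin X).flip ?_ huc
      exact hri.continuousOn_smul hθ.continuous.continuousOn
    have e : ∫ t, θ' t • ⟪u t, w t⟫_ℂ =
        (∫ t in (-d)..d, θ' t • ⟪u t, w t - f t⟫_ℂ) +
          ∫ t in (-d)..d, ⟪u t, θ t • (-g t + k t)⟫_ℂ := by
      rw [integral_eq_intervalIntegral_of_eq_zero hd
        (fun t ht => by simp [hθ.eq_zero t ht, hθ.deriv_eq_zero t ht])] at hweak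
      rw [integral_eq_intervalIntegral_of_eq_zero hd
        (fun t ht => by simp [hθ.deriv_eq_zero t ht]), ← intervalIntegral.integral_add i1 i2,
        ← sub_zero (∫ t in (-d)..d, θ' t • ⟪u t, w t⟫_ℂ), ← hweak, ← intervalIntegral.integral_sub]
      · congr 1; ext t
        simp only [Pi.neg_apply, inner_add_right, inner_sub_right, inner_neg_right,
          ← Complex.coe_smul, inner_smul_right, smul_eq_mul]
        ring
      · exact (hθ.continuous_deriv.smul (hu.continuous.inner hwc)).intervalIntegrable _ _
      · refine intervalIntegrable_bilin (innerRealBilin X).flip ?_ huc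
        have := (hr.cutoff hθ).isW12.memLp_deriv
        rw [Measure.restrict_univ] at this
        have q := (hr.cutoff hθ).memLp_apply
        rw [Measure.restrict_univ] at q
        exact intervalIntegrable_of_memLp_univ (this.add q.neg) _ _
    rw [e]
    have n1 : ‖∫ t in (-d)..d, θ' t • ⟪u t, w t - f t⟫_ℂ‖ ≤ ε * (M' * N * (d - -d)) := by
      refine (intervalIntegral.norm_integral_le_of_norm_le_const (C := M' * (N * ε)) ?_).trans ?_
      · intro t ht
        rw [uIoc_of_le hdd] at ht
        have ht' := Ioc_subset_Icc_self ht
        rw [norm_smul]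
        have q := h1 t ht'
        rw [norm_sub_rev] at q
        exact mul_le_mul (hM' t ht') ((norm_inner_le_norm _ _).trans
          (mul_le_mul (hN t ht') q (norm_nonneg _) hN0)) (norm_nonneg _) hM'0
      · rw [abs_of_nonneg (by linarith)]
        exact le_of_eq (by ring)
    have n2 : ‖∫ t in (-d)..d, ⟪u t, θ t • (-g t + k t)⟫_ℂ‖ ≤ ε * (M * N * √(d - -d)) := by
      refine (intervalIntegral.norm_integral_le_of_norm_le
        (g := fun t => M * N * ‖-g t + k t‖) hdd ?_ (hri.norm.const_mul _)).trans ?_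
      · refine Eventually.of_forall fun t ht => (norm_inner_le_norm _ _).trans ?_
        have ht' := Ioc_subset_Icc_self ht
        rw [norm_smul]
        calc ‖u t‖ * (‖θ t‖ * ‖-g t + k t‖) ≤ N * (M * ‖-g t + k t‖) := by
              gcongr
              · exact hN t ht'
              · exact hM t ht'
          _ = _ := by ring
      · rw [intervalIntegral.integral_const_mul]
        calc _ ≤ M * N * (ε * √(d - -d)) := by
              gcongr
              exact integral_norm_le_of_eLpNorm_le hdd hε.le hrm h2
          _ = _ := by ring
    exact (norm_add_le _ _).trans ((add_le_add n1 n2).trans_eq (by ring))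
  have hlim : Tendsto (fun ε : ℝ => ε * (M' * N * (d - -d) + M * N * √(d - -d)))
      (𝓝[>] 0) (𝓝 0) := by
    have : Continuous (fun ε : ℝ => ε * (M' * N * (d - -d) + M * N * √(d - -d))) := by fun_prop
    have := this.tendsto 0
    rw [zero_mul] at this
    exact this.mono_left nhdsWithin_le_nhds
  have h0 := ge_of_tendsto hlim (eventually_mem_nhdsWithin.mono fun ε hε => key ε hε)
  exact norm_eq_zero.1 (le_antisymm h0 (norm_nonneg _))

theorem IsUnitaryPropagator.apply_apply {U : ℝ → ℝ → X →L[ℂ] X} (hU : IsUnitaryPropagator U)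
    (t r s : ℝ) (x : X) : U t r (U r s x) = U t s x :=
  congrArg (fun T : X →L[ℂ] X => T x) (hU.comp t r s)

theorem IsUnitaryPropagator.refl_apply {U : ℝ → ℝ → X →L[ℂ] X} (hU : IsUnitaryPropagator U)
    (t : ℝ) (x : X) : U t t x = x :=
  congrArg (fun T : X →L[ℂ] X => T x) (hU.refl t)

theorem IsUnitaryPropagator.inner_map_map {U : ℝ → ℝ → X →L[ℂ] X} (hU : IsUnitaryPropagator U)
    (t s : ℝ) (x y : X) : ⟪U t s x, U t s y⟫_ℂ = ⟪x, y⟫_ℂ := by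
  have h := (Unitary.mem_iff.1 (hU.unitary t s)).1
  rw [← ContinuousLinearMap.adjoint_inner_right]
  have : (U t s).adjoint (U t s y) = y := congrArg (fun T : X →L[ℂ] X => T y) h
  rw [this]

theorem IsUnitaryPropagator.norm_map {U : ℝ → ℝ → X →L[ℂ] X} (hU : IsUnitaryPropagator U)
    (t s : ℝ) (x : X) : ‖U t s x‖ = ‖x‖ := by
  rw [← sq_eq_sq₀ (norm_nonneg _) (norm_nonneg _), ← inner_self_eq_norm_sq (𝕜 := ℂ),
    ← inner_self_eq_norm_sq (𝕜 := ℂ), hU.inner_map_map]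

/-- The pairing of `u` with the orbit of `U s t z` is constant. Its value at time `t` is `⟨u t, z⟩`,
and at time `s` it is `⟨x, U s t z⟩ = ⟨U t s x, z⟩`. -/
theorem IsMildPropagator.eq_of_isWeakSolution {A : ℝ → X →ₗ.[ℂ] X} {U : ℝ → ℝ → X →L[ℂ] X}
    (hA : IsSkewAdjointFamily A) (hU : IsMildPropagator A U) {s : ℝ} {x : X} {u : ℝ → X}
    (hu : IsWeakSolution A s x u) : u = fun t => U t s x := by
  have hUu := hU.isUnitary
  ext t
  refine ext_inner_right ℂ fun z => ?_
  have hc : Continuous fun τ => ⟪u τ, U τ s (U s t z)⟫_ℂ :=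
    hu.continuous.inner (hU.isMildSolution s _).continuous
  have := eq_of_forall_integral_deriv_smul_eq_zero hc
    (fun d θ θ' hθ => hU.integral_deriv_smul_inner_eq_zero hA hu hθ) t s
  rw [hUu.apply_apply, hUu.refl_apply, hUu.refl_apply, hu.initial] at this
  rw [this, ← hUu.inner_map_map t s, hUu.apply_apply, hUu.refl_apply]

end RollnikSchroedinger

/-! ### A single time: self-adjointness, resolvents of `±iH`, generators. -/

namespace RollnikSchroedinger

variable {X : Type*} [NormedAddCommGroup X] [InnerProductSpace ℂ X] [CompleteSpace X]

/-- `R = (β + T)⁻¹` is a positive operator with `R² ≤ R`. -/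
structure IsPosResolvent (T : X →ₗ.[ℂ] X) (β : ℝ) (R : X →L[ℂ] X) : Prop where
  beta_pos : 0 < β
  isPositive : R.IsPositive
  norm_sq_le : ∀ x, ‖R x‖ ^ 2 ≤ (⟪x, R x⟫_ℂ).re
  mem_graph_iff : ∀ u f, (u, f) ∈ T.graph ↔ R (f + (β : ℂ) • u) = u

theorem IsSmoothResolvent.isPosResolvent {H : ℝ → X →ₗ.[ℂ] X} {J : Set ℝ} {β C : ℝ}
    {R R' : ℝ → X →L[ℂ] X} (h : IsSmoothResolvent H J β C R R') {t : ℝ} (ht : t ∈ J) :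
    IsPosResolvent (H t) β (R t) :=
  ⟨h.beta_pos, h.isPositive t ht, h.norm_sq_le t ht, h.mem_graph_iff t ht⟩

namespace IsPosResolvent

variable {T : X →ₗ.[ℂ] X} {β : ℝ} {R : X →L[ℂ] X} (h : IsPosResolvent T β R)
include h

theorem mem_graph (x : X) : (R x, x - (β : ℂ) • R x) ∈ T.graph :=
  (h.mem_graph_iff _ _).2 (by rw [sub_add_cancel])

theorem eq_zero {x : X} (hx : R x = 0) : x = 0 := by
  have h3 : ((0 : X), x) ∈ T.graph := (h.mem_graph_iff _ _).2 (by simpa using hx)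
  exact LinearPMap.graph_fst_eq_zero_snd _ h3 rfl

theorem dense_domain : Dense (T.domain : Set X) := by
  rw [Submodule.dense_iff_topologicalClosure_eq_top, Submodule.topologicalClosure_eq_top_iff,
    Submodule.eq_bot_iff]
  intro y hy
  refine h.eq_zero ?_
  have := hy (R (R y)) (LinearPMap.mem_domain_of_mem_graph (h.mem_graph _))
  rw [inner_left_of_isPositive h.isPositive] at this
  exact inner_self_eq_zero.1 this

theorem im_inner_eq_zero {x f : X} (hxf : (x, f) ∈ T.graph) : (⟪x, f⟫_ℂ).im = 0 := by
  have h1 := (h.mem_graph_iff _ _).1 hxf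
  have h2 : ⟪x, f⟫_ℂ = ⟪x, f + (β : ℂ) • x⟫_ℂ - (β : ℂ) * ⟪x, x⟫_ℂ := by
    rw [inner_add_right, inner_smul_right]; ring
  have h3 : (⟪x, f + (β : ℂ) • x⟫_ℂ).im = 0 := by
    have := im_inner_eq_zero_of_isPositive h.isPositive (f + (β : ℂ) • x)
    rwa [← inner_left_of_isPositive h.isPositive, h1] at this
  have h4 : (⟪x, x⟫_ℂ).im = 0 := inner_self_im (𝕜 := ℂ) x
  rw [h2, Complex.sub_im, h3, Complex.im_ofReal_mul, h4]; simp

theorem inner_eq {x f y g : X} (hx : (x, f) ∈ T.graph) (hy : (y, g) ∈ T.graph) :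
    ⟪f, y⟫_ℂ = ⟪x, g⟫_ℂ := by
  have h1 := (h.mem_graph_iff _ _).1 hx
  have h2 := (h.mem_graph_iff _ _).1 hy
  have h3 : ⟪f + (β : ℂ) • x, y⟫_ℂ = ⟪x, g + (β : ℂ) • y⟫_ℂ := by
    nth_rewrite 1 [← h2]
    rw [← inner_left_of_isPositive h.isPositive, h1]
  rw [inner_add_left, inner_add_right, inner_smul_left, inner_smul_right,
    Complex.conj_ofReal] at h3
  exact add_right_cancel h3

theorem adjoint_smul {c : ℂ} (hc : ‖c‖ = 1) : (c • T).adjoint = conj c • T := by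
  have hd : Dense ((c • T).domain : Set X) := h.dense_domain
  have hcc : conj c * c = 1 := by rw [Complex.conj_mul', hc]; simp
  have hcc' : c * conj c = 1 := by rw [mul_comm, hcc]
  refine LinearPMap.eq_of_eq_graph ?_
  rw [LinearPMap.adjoint_graph_eq_graph_adjoint hd]
  ext ⟨z, w⟩
  rw [Submodule.mem_adjoint_iff]
  constructor
  · intro H
    -- Every vector `R v` is in the domain, so the adjoint relation tested against all of them says
    -- exactly that `(z, c w)` satisfies the resolvent description of the graph.
    have hz : R (c • w + (β : ℂ) • z) = z := by
      refine ext_inner_left ℂ fun v => ?_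
      have h1 := H _ _ (mem_graph_smul c (h.mem_graph v))
      simp only [inner_smul_left, inner_sub_left, Complex.conj_ofReal,
        inner_left_of_isPositive h.isPositive] at h1
      rw [map_add, map_smul, map_smul, inner_add_right, inner_smul_right, inner_smul_right]
      linear_combination (-c) * h1 + (⟪v, z⟫_ℂ - (β : ℂ) * ⟪v, R z⟫_ℂ) * hcc
    have := mem_graph_smul (conj c) ((h.mem_graph_iff _ _).2 hz)
    rwa [smul_smul, hcc, one_smul] at this
  · intro H a b hab
    obtain ⟨f, hf, rfl⟩ := exists_of_mem_graph_smul H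
    obtain ⟨g, hg, rfl⟩ := exists_of_mem_graph_smul hab
    simp only [inner_smul_left, inner_smul_right, h.inner_eq hg hf, sub_self]

theorem isSelfAdjoint : IsSelfAdjoint T := by
  have := h.adjoint_smul (c := 1) (by simp)
  simpa [LinearPMap.isSelfAdjoint_def] using this

end IsPosResolvent

theorem conj_of_I {c : ℂ} (hc : c = Complex.I ∨ c = -Complex.I) : conj c = -c := by
  rcases hc with rfl | rfl <;> simp

theorem mul_self_of_I {c : ℂ} (hc : c = Complex.I ∨ c = -Complex.I) : c * c = -1 := by
  rcases hc with rfl | rfl <;> simp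

theorem isSkewAdjointFamily_smul {H : ℝ → X →ₗ.[ℂ] X} {c : ℂ}
    (hc : c = Complex.I ∨ c = -Complex.I) (hH : ∀ t, ∃ β R, IsPosResolvent (H t) β R) :
    IsSkewAdjointFamily fun t => c • H t := by
  have hcc := mul_self_of_I hc
  have hadj : ∀ t, (c • H t).adjoint = (-c) • H t := by
    intro t
    obtain ⟨β, R, h⟩ := hH t
    rw [h.adjoint_smul (IsSmoothResolvent.norm_of_I hc), conj_of_I hc]
  refine ⟨fun t x y z w hxy hzw => ?_, fun t x y hxy => ?_, fun t x y hxy => ?_⟩ <;>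
    obtain ⟨β, R, h⟩ := hH t
  · rw [hadj] at hzw
    obtain ⟨f, hf, rfl⟩ := exists_of_mem_graph_smul hxy
    obtain ⟨g, hg, rfl⟩ := exists_of_mem_graph_smul hzw
    rw [inner_smul_left, inner_smul_right, conj_of_I hc, h.inner_eq hf hg]
  · rw [hadj]
    obtain ⟨f, hf, rfl⟩ := exists_of_mem_graph_smul hxy
    rw [← neg_smul]
    exact mem_graph_smul _ hf
  · simp only [hadj] at hxy
    -- This is `A** = A`, used later as weak closedness: the relation is tested on the elements `R
    -- v` of the adjoint's domain.
    have hz : R ((-c) • y + (β : ℂ) • x) = x := by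
      refine ext_inner_right ℂ fun v => ?_
      have h1 := hxy _ _ (mem_graph_smul (-c) (h.mem_graph v))
      simp only [inner_smul_right, inner_sub_right] at h1
      rw [inner_left_of_isPositive h.isPositive, inner_add_left, inner_smul_left, inner_smul_left,
        Complex.conj_ofReal, map_neg, conj_of_I hc]
      linear_combination c * h1 - (⟪x, v⟫_ℂ - (β : ℂ) * ⟪x, R v⟫_ℂ) * hcc
    have := mem_graph_smul c ((h.mem_graph_iff _ _).2 hz)
    rwa [smul_smul, mul_neg, hcc, neg_neg, one_smul] at this

/-! ### Resolvents -/

theorem isResolvent_iff_graph {A : X →ₗ.[ℂ] X} {z : ℂ} {D : X →L[ℂ] X} :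
    IsResolvent A z D ↔ (∀ x, (D x, z • D x - x) ∈ A.graph) ∧
      ∀ u y, (u, y) ∈ A.graph → D (z • u - y) = u := by
  constructor
  · rintro ⟨h1, h2⟩
    refine ⟨fun x => ?_, fun u y huy => ?_⟩
    · obtain ⟨hx, e⟩ := h1 x
      have := A.mem_graph ⟨D x, hx⟩
      have e' : A ⟨D x, hx⟩ = z • D x - x := by
        rw [eq_sub_iff_add_eq, ← eq_sub_iff_add_eq']; exact e.symm
      rwa [e'] at this
    · obtain ⟨v, rfl, rfl⟩ := (LinearPMap.mem_graph_iff A).1 huy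
      exact h2 v
  · rintro ⟨h1, h2⟩
    refine ⟨fun x => ⟨LinearPMap.mem_domain_of_mem_graph (h1 x), ?_⟩, fun u =>
      h2 _ _ (A.mem_graph u)⟩
    have := A.mem_graph_snd_inj (h1 x)
      (A.mem_graph ⟨D x, LinearPMap.mem_domain_of_mem_graph (h1 x)⟩) rfl
    rw [← this]; abel

theorem IsPosResolvent.exists_isResolvent {T : X →ₗ.[ℂ] X} {β : ℝ} {R : X →L[ℂ] X}
    (h : IsPosResolvent T β R) {c : ℂ} (hc : c = Complex.I ∨ c = -Complex.I) {l : ℝ} (hl : 0 < l) :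
    ∃ D : X →L[ℂ] X, IsResolvent (c • T) (l : ℂ) D ∧ ‖D‖ ≤ l⁻¹ := by
  have hcc := mul_self_of_I hc
  -- Since `c² = -1`, one has `l - c T = -c (R⁻¹ + z)`, whose inverse is `c R (1 + z R)⁻¹`. The
  -- factor `1 + z R` is invertible because `-1/z` is not real while `R` is self-adjoint.
  set z : ℂ := c * l - β with hz
  have hzim : z.im ≠ 0 := by
    rcases hc with rfl | rfl <;> simp [hz, hl.ne']
  have hz0 : z ≠ 0 := fun h0 => hzim (by rw [h0]; rfl)
  have hN : IsUnit (1 + z • R) := by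
    have h1 : -z⁻¹ ∉ spectrum ℂ R := by
      intro hmem
      have := IsSelfAdjoint.mem_spectrum_eq_re h.isPositive.isSelfAdjoint hmem
      have him : (-z⁻¹).im = 0 := by rw [this]; simp
      rw [Complex.neg_im, Complex.inv_im, neg_div, neg_neg, div_eq_zero_iff] at him
      rcases him with h2 | h2
      · exact hzim h2
      · exact hz0 (Complex.normSq_eq_zero.1 h2)
    rw [spectrum.notMem_iff] at h1
    have h2 : 1 + z • R = (-z) • (algebraMap ℂ (X →L[ℂ] X) (-z⁻¹) - R) := by
      rw [Algebra.algebraMap_eq_smul_one, smul_sub, smul_smul, neg_mul_neg, mul_inv_cancel₀ hz0,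
        one_smul, neg_smul, sub_neg_eq_add]
    rw [h2]
    exact h1.smul (Units.mk0 (-z) (neg_ne_zero.2 hz0))
  set N := Ring.inverse (1 + z • R) with hNdef
  have hN1 : ∀ x, N x + z • R (N x) = x := fun x =>
    congrArg (fun S : X →L[ℂ] X => S x) (Ring.mul_inverse_cancel _ hN)
  have hN2 : ∀ x, N (x + z • R x) = x := fun x =>
    congrArg (fun S : X →L[ℂ] X => S x) (Ring.inverse_mul_cancel _ hN)
  set D : X →L[ℂ] X := c • (R * N) with hD
  have hDx : ∀ x, D x = c • R (N x) := fun x => rfl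
  have hg : ∀ x, (D x, (l : ℂ) • D x - x) ∈ (c • T).graph := by
    intro x
    have h1 : (D x, (-c) • ((l : ℂ) • D x - x)) ∈ T.graph := by
      rw [h.mem_graph_iff]
      have : (-c) • ((l : ℂ) • D x - x) + (β : ℂ) • D x = c • N x := by
        nth_rewrite 2 [← hN1 x]
        rw [hDx, hz]
        module
      rw [this, map_smul, hDx]
    have := mem_graph_smul c h1
    rwa [smul_smul, mul_neg, hcc, neg_neg, one_smul] at this
  have hres : IsResolvent (c • T) (l : ℂ) D := by
    refine isResolvent_iff_graph.2 ⟨hg, fun u y huy => ?_⟩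
    obtain ⟨f, hf, rfl⟩ := exists_of_mem_graph_smul huy
    have h1 := (h.mem_graph_iff _ _).1 hf
    have h2 : (l : ℂ) • u - c • f = (-c) • ((f + (β : ℂ) • u) + z • R (f + (β : ℂ) • u)) := by
      rw [h1, hz]
      have : (l : ℂ) • u = (-(c * c)) • (l : ℂ) • u := by rw [hcc, neg_neg, one_smul]
      rw [this]
      module
    rw [hDx, h2, map_smul, hN2, map_smul, h1, smul_smul, mul_neg, hcc, neg_neg, one_smul]
  refine ⟨D, hres, ContinuousLinearMap.opNorm_le_bound _ (by positivity) fun x => ?_⟩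
  obtain ⟨f, hf, e⟩ := exists_of_mem_graph_smul (hg x)
  have h1 : x = (l : ℂ) • D x - c • f := by rw [e]; abel
  have h2 : (⟪D x, x⟫_ℂ).re = l * ‖D x‖ ^ 2 := by
    have h3 : ⟪D x, x⟫_ℂ = (l : ℂ) * ⟪D x, D x⟫_ℂ - c * ⟪D x, f⟫_ℂ := by
      nth_rewrite 2 [h1]
      rw [inner_sub_right, inner_smul_right, inner_smul_right]
    rw [h3, Complex.sub_re, IsSmoothResolvent.re_I_mul_eq_zero hc (h.im_inner_eq_zero hf),
      Complex.re_ofReal_mul, sub_zero]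
    congr 1
    exact inner_self_eq_norm_sq (𝕜 := ℂ) _
  have h3 := (Complex.re_le_norm _).trans (norm_inner_le_norm (𝕜 := ℂ) (D x) x)
  rw [inv_mul_eq_div, le_div_iff₀ hl]
  rcases (norm_nonneg (D x)).eq_or_lt with h | h
  · rw [← h]; simp
  · refine le_of_mul_le_mul_right ?_ h
    nlinarith

/-- Each resolvent satisfies `‖D‖ ≤ 1/l`, so products obey the contraction estimate. The constant `w
= 1` rather than 0 is used because the stability condition is stated with `w > 0`. -/
theorem isKatoStable_smul {H : ℝ → X →ₗ.[ℂ] X} {c : ℂ}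
    (hc : c = Complex.I ∨ c = -Complex.I) (hH : ∀ t, ∃ β R, IsPosResolvent (H t) β R) :
    IsKatoStable (fun t => c • H t) 1 1 := by
  intro l hl
  have : ∀ t, ∃ D : X →L[ℂ] X, IsResolvent (c • H t) (l : ℂ) D ∧ ‖D‖ ≤ l⁻¹ := fun t => by
    obtain ⟨β, R, h⟩ := hH t
    exact h.exists_isResolvent hc (by linarith)
  choose D hD1 hD2 using this
  refine ⟨D, hD1, fun ts hts => ?_⟩
  clear hts
  have hle : l⁻¹ ≤ (l - 1)⁻¹ := inv_anti₀ (by linarith) (by linarith)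
  have hpos : 0 ≤ (l - 1)⁻¹ := inv_nonneg.2 (by linarith)
  rw [one_mul]
  induction ts with
  | nil =>
    rw [List.map_nil, List.prod_nil, List.length_nil, pow_zero, inv_one]
    exact ContinuousLinearMap.norm_id_le
  | cons t ts ih =>
    rw [List.map_cons, List.prod_cons, List.length_cons, pow_succ, mul_inv, mul_comm _ (l - 1)⁻¹]
    exact (norm_mul_le _ _).trans
      (mul_le_mul ((hD2 t).trans hle) (by simpa using ih) (norm_nonneg _) hpos)

/-- On every bounded interval the resolvents are strongly continuously differentiable. -/
def SmoothFamily (H : ℝ → X →ₗ.[ℂ] X) : Prop :=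
  ∀ r : ℝ, 0 < r → ∃ β C R R', IsSmoothResolvent H (Ioo (-r) r) β C R R'

theorem SmoothFamily.exists_isPosResolvent {H : ℝ → X →ₗ.[ℂ] X} (hH : SmoothFamily H) (t : ℝ) :
    ∃ β R, IsPosResolvent (H t) β R := by
  obtain ⟨β, C, R, R', h⟩ := hH (|t| + 1) (by positivity)
  exact ⟨β, R t, h.isPosResolvent (abs_lt.1 (by linarith))⟩

theorem SmoothFamily.const {T : X →ₗ.[ℂ] X} {β : ℝ} {R : X →L[ℂ] X}
    (h : IsPosResolvent T β R) : SmoothFamily fun _ => T := by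
  intro r _
  refine ⟨β, 1, fun _ => R, fun _ => 0, isOpen_Ioo, h.beta_pos, one_pos, fun _ _ => h.isPositive,
    fun _ _ => h.norm_sq_le, fun _ _ => h.mem_graph_iff, fun t _ x => hasDerivAt_const t (R x),
    fun x => continuousOn_const, fun t _ x y => ?_⟩
  simp only [zero_apply, inner_zero_right, norm_zero, one_mul]
  positivity

theorem SmoothFamily.comp_neg {H : ℝ → X →ₗ.[ℂ] X} (hH : SmoothFamily H) :
    SmoothFamily fun t => H (-t) := by
  intro r hr
  obtain ⟨β, C, R, R', h⟩ := hH r hr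
  have hm : ∀ t ∈ Ioo (-r) r, -t ∈ Ioo (-r) r := fun t ht =>
    ⟨by linarith [ht.2], by linarith [ht.1]⟩
  refine ⟨β, C, fun t => R (-t), fun t => -R' (-t), isOpen_Ioo, h.beta_pos, h.const_pos,
    fun t ht => h.isPositive _ (hm t ht), fun t ht => h.norm_sq_le _ (hm t ht),
    fun t ht => h.mem_graph_iff _ (hm t ht), fun t ht x => ?_,
    fun x => ((h.continuousOn_deriv x).comp continuous_neg.continuousOn hm).neg,
    fun t ht x y => ?_⟩
  · have := (h.hasDerivAt _ (hm t ht) x).scomp t (hasDerivAt_neg t)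
    rw [neg_one_smul] at this
    exact this
  · have := h.norm_inner_deriv_le _ (hm t ht) x y
    rwa [neg_apply, inner_neg_right, norm_neg]

/-- Fix `v` with `R t v = D t x`. Then `x` is the value at `τ = t` of `l R τ v - c (v - β R τ v)`, a
continuous curve that `D τ` maps exactly to `R τ v`; the uniform bound on `D τ` absorbs the
difference from `x`. -/
theorem SmoothFamily.continuous_resolvent {H : ℝ → X →ₗ.[ℂ] X} (hH : SmoothFamily H) {c : ℂ}
    {l : ℝ} {D : ℝ → X →L[ℂ] X} (hD : ∀ t, IsResolvent (c • H t) (l : ℂ) (D t))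
    (hDl : ∀ t, ‖D t‖ ≤ l⁻¹) (x : X) : Continuous fun t => D t x := by
  refine continuous_iff_continuousAt.2 fun t => ?_
  obtain ⟨β, C, R, R', h⟩ := hH (|t| + 1) (by positivity)
  have ht : t ∈ Ioo (-(|t| + 1)) (|t| + 1) := abs_lt.1 (by linarith)
  obtain ⟨f, hf, e⟩ := exists_of_mem_graph_smul ((isResolvent_iff_graph.1 (hD t)).1 x)
  have hu := (h.mem_graph_iff t ht _ _).1 hf
  set v := f + (β : ℂ) • D t x with hv
  have hx : x = (l : ℂ) • R t v - c • (v - (β : ℂ) • R t v) := by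
    rw [hu, hv, add_sub_cancel_right, e]; abel
  have hRv : ContinuousAt (fun τ => R τ v) t := (h.hasDerivAt t ht v).continuousAt
  have key : ∀ᶠ τ in 𝓝 t,
      D τ ((l : ℂ) • R τ v - c • (v - (β : ℂ) • R τ v)) = R τ v := by
    filter_upwards [h.isOpen.mem_nhds ht] with τ hτ
    exact (isResolvent_iff_graph.1 (hD τ)).2 _ _
      (mem_graph_smul c ((h.isPosResolvent hτ).mem_graph v))
  have hlim : Tendsto (fun τ => (l : ℂ) • R τ v - c • (v - (β : ℂ) • R τ v)) (𝓝 t) (𝓝 x) := by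
    have := (hRv.tendsto.const_smul (l : ℂ)).sub
      (((hRv.tendsto.const_smul (β : ℂ)).const_sub v).const_smul c)
    rwa [← hx] at this
  have h1 : Tendsto (fun τ => D τ (x - ((l : ℂ) • R τ v - c • (v - (β : ℂ) • R τ v))))
      (𝓝 t) (𝓝 0) := by
    refine squeeze_zero_norm (a := fun τ =>
      l⁻¹ * ‖x - ((l : ℂ) • R τ v - c • (v - (β : ℂ) • R τ v))‖)
      (fun τ => (D τ).le_of_opNorm_le (hDl τ) _) ?_
    simpa using ((hlim.const_sub x).norm).const_mul l⁻¹
  have h2 := h1.add hRv.tendsto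
  rw [zero_add, hu] at h2
  refine h2.congr' ?_
  filter_upwards [key] with τ hτ
  rw [map_sub, hτ, sub_add_cancel]

/-! ### Generators -/

/-- `u` is an integrated solution of `u' = A u`. -/
structure IsIntegratedSolution (A : X →ₗ.[ℂ] X) (u : ℝ → X) : Prop where
  continuous : Continuous u
  mem_graph : ∀ s t, (∫ τ in s..t, u τ, u t - u s) ∈ A.graph

section Generators

variable {A : X →ₗ.[ℂ] X} (hA : IsSkewAdjointFamily fun _ : ℝ => A)
include hA

theorem IsSkewAdjointFamily.integral_mem_graph {p q : ℝ → X} (hp : Continuous p) (hq : Continuous q)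
    (h : ∀ τ, (p τ, q τ) ∈ A.graph) (s t : ℝ) :
    (∫ τ in s..t, p τ, ∫ τ in s..t, q τ) ∈ A.graph := by
  refine hA.mem_of_inner 0 _ _ fun z w hzw => ?_
  have h1 := ((innerRealBilin X).flip z).intervalIntegral_comp_comm
    (hq.intervalIntegrable (μ := volume) s t)
  have h2 := ((innerRealBilin X).flip w).intervalIntegral_comp_comm
    (hp.intervalIntegrable (μ := volume) s t)
  simp only [ContinuousLinearMap.flip_apply, innerRealBilin_apply] at h1 h2
  rw [← h1, ← h2]
  refine intervalIntegral.integral_congr fun τ _ => ?_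
  exact hA.inner_eq 0 _ _ _ _ (h τ) hzw

theorem IsSkewAdjointFamily.mem_graph_of_tendsto {l : Filter ℝ} [l.NeBot] {p q : ℝ → X} {x y : X}
    (hp : Tendsto p l (𝓝 x)) (hq : Tendsto q l (𝓝 y)) (h : ∀ᶠ τ in l, (p τ, q τ) ∈ A.graph) :
    (x, y) ∈ A.graph := by
  refine hA.mem_of_inner 0 _ _ fun z w hzw => ?_
  refine tendsto_nhds_unique (hq.inner tendsto_const_nhds)
    ((hp.inner tendsto_const_nhds).congr' ?_)
  filter_upwards [h] with τ hτ
  exact (hA.inner_eq 0 _ _ _ _ hτ hzw).symm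

/-- The primitive `W` of the difference lies in the domain and solves `W' = A W` in the strict
sense, so its norm is constant and equal to `‖W 0‖ = 0`. -/
theorem IsSkewAdjointFamily.eq_of_isIntegratedSolution {u v : ℝ → X}
    (hu : IsIntegratedSolution A u) (hv : IsIntegratedSolution A v) (h0 : u 0 = v 0) : u = v := by
  set w : ℝ → X := fun t => u t - v t with hw
  have hwc : Continuous w := hu.continuous.sub hv.continuous
  have hw0 : w 0 = 0 := by simp [hw, h0]
  set W : ℝ → X := fun t => ∫ τ in 0..t, w τ with hW
  have hWd : ∀ t, HasDerivAt W (w t) t := fun t =>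
    intervalIntegral.integral_hasDerivAt_right (hwc.intervalIntegrable _ _)
      (hwc.stronglyMeasurableAtFilter _ _) hwc.continuousAt
  have hWg : ∀ t, (W t, w t) ∈ A.graph := by
    intro t
    have := A.graph.sub_mem (hu.mem_graph 0 t) (hv.mem_graph 0 t)
    rw [Prod.mk_sub_mk, ← intervalIntegral.integral_sub (hu.continuous.intervalIntegrable _ _)
      (hv.continuous.intervalIntegrable _ _)] at this
    have e : u t - u 0 - (v t - v 0) = w t := by rw [h0]; simp [hw]
    rwa [e] at this
  have hn : ∀ t, HasDerivAt (fun t => ‖W t‖ ^ 2) 0 t := by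
    intro t
    have := hasDerivAt_norm_sq (hWd t)
    rwa [hA.re_inner 0 _ _ (hWg t), mul_zero] at this
  have hW0 : ∀ t, W t = 0 := by
    intro t
    have := is_const_of_deriv_eq_zero (fun t => (hn t).differentiableAt) (fun t => (hn t).deriv) t 0
    have e : W 0 = 0 := intervalIntegral.integral_same
    simp only [e, norm_zero] at this
    simpa using this
  ext t
  have h1 := hWd t
  rw [show W = fun _ => 0 from funext hW0] at h1
  exact sub_eq_zero.1 (h1.unique (hasDerivAt_const t (0 : X)))

/-- Constant functions with value in `D(A*)` are admissible in the pairing identity, and weak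
closedness of `A` puts the integral of the orbit into its domain. -/
theorem IsMildPropagator.isIntegratedSolution {U : ℝ → ℝ → X →L[ℂ] X}
    (hU : IsMildPropagator (fun _ => A) U) (s : ℝ) (x : X) :
    IsIntegratedSolution A fun t => U t s x := by
  have hc := (hU.isMildSolution s x).continuous
  have key : ∀ a b, a ≤ b → (∫ τ in a..b, U τ s x, U b s x - U a s x) ∈ A.graph := by
    intro a b hab
    refine hA.mem_of_inner 0 _ _ fun z w hzw => ?_
    have hv : IsRegular (fun _ : ℝ => A.adjoint) (Icc a b) (fun _ => z) (fun _ => 0)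
        (fun _ => w) :=
      ⟨isW12_of_hasDerivAt continuousOn_const (fun t _ => hasDerivAt_const t z) continuousOn_const,
        Eventually.of_forall fun _ => hzw, memLp_of_continuousOn continuousOn_const _⟩
    have hm : IsMildOn (fun _ => A) a b fun t => U t s x :=
      (hU.isMildOn s x (|a| + |b|)).mono fun t ht =>
        ⟨by linarith [ht.1, neg_abs_le a, abs_nonneg b],
          by linarith [ht.2, le_abs_self b, abs_nonneg a]⟩
    have := hm.inner_sub_eq_integral hA hab hv
    have h2 := ((innerRealBilin X).flip w).intervalIntegral_comp_comm
      (hc.intervalIntegrable (μ := volume) a b)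
    simp only [ContinuousLinearMap.flip_apply, innerRealBilin_apply, zero_add] at h2 this
    rw [inner_sub_left, this, h2]
  refine ⟨hc, fun a b => ?_⟩
  rcases le_total a b with hab | hab
  · exact key a b hab
  · have := A.graph.neg_mem (key b a hab)
    rwa [Prod.neg_mk, ← intervalIntegral.integral_symm, neg_sub] at this

/-- The semigroup law is uniqueness combined with translation in time. If `(x, y)` is in the graph,
then `x + ∫ U τ 0 y` is also an integrated solution from `x`, so the orbit has derivative `y` at 0.
Conversely the averages `σ⁻¹ ∫₀^σ U τ 0 x` tend to `x`, while `A` maps them to difference quotients,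
and closedness applies. -/
theorem IsMildPropagator.isGenerator {U : ℝ → ℝ → X →L[ℂ] X}
    (hU : IsMildPropagator (fun _ => A) U) : IsGenerator A := by
  have hUu := hU.isUnitary
  have hint := hU.isIntegratedSolution hA
  refine ⟨fun σ => U σ 0, hUu.refl 0, fun σ τ _ _ => ?_, fun x => (hint 0 x).continuous.continuousOn,
    fun x y => ?_⟩
  · change U (σ + τ) 0 = U σ 0 * U τ 0
    rw [← hUu.comp (σ + τ) τ 0]
    congr 1
    ext x
    have h1 : IsIntegratedSolution A fun t => U (t + τ) τ x := by
      refine ⟨(hint τ x).continuous.comp (continuous_add_const τ), fun a b => ?_⟩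
      have := (hint τ x).mem_graph (a + τ) (b + τ)
      rwa [← intervalIntegral.integral_comp_add_right (fun t => U t τ x)] at this
    have := hA.eq_of_isIntegratedSolution h1 (hint 0 x)
      (by simp only [zero_add, hUu.refl_apply])
    exact congrFun this σ
  · have hI : ∀ v : X, HasDerivAt (fun t => ∫ τ in (0 : ℝ)..t, U τ 0 v) v 0 := fun v => by
      have hc := (hint 0 v).continuous
      have := intervalIntegral.integral_hasDerivAt_right (hc.intervalIntegrable (μ := volume) 0 0)
        (hc.stronglyMeasurableAtFilter _ _) hc.continuousAt
      rwa [hUu.refl_apply] at this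
    constructor
    · intro hxy
      set w : ℝ → X := fun t => x + ∫ τ in (0 : ℝ)..t, U τ 0 y with hw
      have hic : Continuous fun t => ∫ τ in (0 : ℝ)..t, U τ 0 y :=
        intervalIntegral.continuous_primitive
          (fun a b => (hint 0 y).continuous.intervalIntegrable a b) 0
      have hwc : Continuous w := hic.const_add x
      have h1 : IsIntegratedSolution A w := by
        refine ⟨hwc, fun a b => ?_⟩
        have hp : ∀ τ, (w τ, U τ 0 y) ∈ A.graph := by
          intro τ
          have := A.graph.add_mem hxy ((hint 0 y).mem_graph 0 τ)
          rwa [Prod.mk_add_mk, hUu.refl_apply, add_sub_cancel] at this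
        have := hA.integral_mem_graph hwc (hint 0 y).continuous hp a b
        rwa [← intervalIntegral.integral_interval_sub_left
          ((hint 0 y).continuous.intervalIntegrable 0 b)
          ((hint 0 y).continuous.intervalIntegrable 0 a),
          ← add_sub_add_left_eq_sub _ _ x] at this
      have h2 := hA.eq_of_isIntegratedSolution h1 (hint 0 x) (by simp [hw, hUu.refl_apply])
      have h3 : HasDerivAt (fun t => U t 0 x) y 0 := by
        rw [← h2]; exact (hI y).const_add x
      have := h3.tendsto_slope_zero_right
      simpa only [zero_add, hUu.refl_apply] using this
    · intro hlim
      have h1 := (hI x).tendsto_slope_zero_right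
      simp only [zero_add, intervalIntegral.integral_same, sub_zero] at h1
      refine hA.mem_graph_of_tendsto h1 hlim (Eventually.of_forall fun σ => ?_)
      have := A.graph.smul_mem ((σ⁻¹ : ℝ) : ℂ) ((hint 0 x).mem_graph 0 σ)
      rwa [Prod.smul_mk, Complex.coe_smul, Complex.coe_smul, hUu.refl_apply] at this

end Generators

theorem SmoothFamily.isSkewAdjointFamily {H : ℝ → X →ₗ.[ℂ] X} (hH : SmoothFamily H) {c : ℂ}
    (hc : c = Complex.I ∨ c = -Complex.I) : IsSkewAdjointFamily fun t => c • H t :=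
  isSkewAdjointFamily_smul hc hH.exists_isPosResolvent

theorem SmoothFamily.exists_isMildPropagator {H : ℝ → X →ₗ.[ℂ] X} (hH : SmoothFamily H) {c : ℂ}
    (hc : c = Complex.I ∨ c = -Complex.I) : ∃ U, IsMildPropagator (fun t => c • H t) U := by
  have hA := hH.isSkewAdjointFamily hc
  refine RollnikSchroedinger.exists_isMildPropagator hA fun d s x hs => ?_
  have hd : 0 ≤ d := by linarith [hs.1, hs.2]
  obtain ⟨β, C, R, R', h⟩ := hH (d + 1) (by linarith)
  exact h.exists_mild hc hA.re_inner (fun t ht => ⟨by linarith [ht.1], by linarith [ht.2]⟩) hs x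

/-- The operator frozen at time `t` is a constant smooth family, so the existence theory for the
nonautonomous equation yields its group. -/
theorem SmoothFamily.isGenerator {H : ℝ → X →ₗ.[ℂ] X} (hH : SmoothFamily H) {c : ℂ}
    (hc : c = Complex.I ∨ c = -Complex.I) (t : ℝ) : IsGenerator (c • H t) := by
  obtain ⟨β, R, h⟩ := hH.exists_isPosResolvent t
  have h0 := SmoothFamily.const h
  obtain ⟨U, hU⟩ := h0.exists_isMildPropagator hc
  exact hU.isGenerator (h0.isSkewAdjointFamily hc)

end RollnikSchroedinger

/-! ### Density of `F₂` and of the range of `w' - G₀`. -/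

namespace RollnikSchroedinger

variable {X : Type*} [NormedAddCommGroup X] [InnerProductSpace ℂ X] [CompleteSpace X]

theorem exists_pos_mul_ofReal_le {K ε : ℝ≥0∞} (hK : K ≠ ∞) (hε : 0 < ε) :
    ∃ δ : ℝ, 0 < δ ∧ K * ENNReal.ofReal δ ≤ ε := by
  have h1 : Tendsto (fun δ : ℝ => K * ENNReal.ofReal δ) (𝓝[>] 0) (𝓝 0) := by
    have : Tendsto (fun δ : ℝ => K * ENNReal.ofReal δ) (𝓝 0) (𝓝 (K * ENNReal.ofReal 0)) :=
      ENNReal.Tendsto.const_mul (ENNReal.continuous_ofReal.tendsto 0) (Or.inr hK)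
    rw [ENNReal.ofReal_zero, mul_zero] at this
    exact this.mono_left nhdsWithin_le_nhds
  obtain ⟨δ, h2, h3⟩ := (eventually_mem_nhdsWithin.and (h1.eventually (gt_mem_nhds hε))).exists
  exact ⟨δ, h2, h3.le⟩

theorem eq_indicator_of_eq_zero {E : Type*} [Zero E] {F : ℝ → E} {d : ℝ}
    (h0 : ∀ t, d ≤ |t| → F t = 0) : F = (Icc (-d) d).indicator F := by
  ext t
  by_cases ht : t ∈ Icc (-d) d
  · rw [indicator_of_mem ht]
  · rw [indicator_of_notMem ht, h0 t]
    by_contra hlt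
    exact ht (abs_le.1 (not_le.1 hlt).le)

/-- The `L^p` norm of the indicator function of `[-d, d]`. -/
noncomputable def intervalNorm (d : ℝ) (p : ℝ≥0∞) : ℝ≥0∞ :=
  (volume.restrict (Icc (-d) d) univ) ^ p.toReal⁻¹

theorem intervalNorm_ne_top (d : ℝ) (p : ℝ≥0∞) : intervalNorm d p ≠ ∞ :=
  ENNReal.rpow_ne_top_of_nonneg (by positivity) (by simp)

theorem eLpNorm_le_intervalNorm_mul {E : Type*} [NormedAddCommGroup E] {F : ℝ → E} {d C : ℝ}
    (h0 : ∀ t, d ≤ |t| → F t = 0) (hC : ∀ t, ‖F t‖ ≤ C) (p : ℝ≥0∞) :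
    eLpNorm F p volume ≤ intervalNorm d p * ENNReal.ofReal C := by
  rw [eq_indicator_of_eq_zero h0, eLpNorm_indicator_eq_eLpNorm_restrict measurableSet_Icc]
  exact eLpNorm_le_of_ae_bound (Eventually.of_forall hC)

theorem exists_bound_of_eq_zero {E : Type*} [NormedAddCommGroup E] {F : ℝ → E} (hF : Continuous F)
    {d : ℝ} (h0 : ∀ t, d ≤ |t| → F t = 0) : ∃ M, 0 ≤ M ∧ ∀ t, ‖F t‖ ≤ M := by
  obtain ⟨M, hM⟩ := (isCompact_Icc (a := -d) (b := d)).exists_bound_of_continuousOn hF.continuousOn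
  refine ⟨max M 0, le_max_right _ _, fun t => ?_⟩
  by_cases ht : t ∈ Icc (-d) d
  · exact (hM t ht).trans (le_max_left _ _)
  · rw [h0 t, norm_zero]
    · exact le_max_right _ _
    · by_contra hlt
      exact ht (abs_le.1 (not_le.1 hlt).le)

/-- The function `ψ` lies in the closure of the range of `κ - μ (-d/dt + A(·))`. -/
def IsApprox (A : ℝ → X →ₗ.[ℂ] X) (p : ℝ≥0∞) (κ μ : ℝ) (ψ : ℝ → X) : Prop :=
  ∀ ε : ℝ≥0∞, 0 < ε → ∃ f g h : ℝ → X, IsRegular A univ f g h ∧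
    eLpNorm (fun t => ψ t - (κ • f t - μ • (-g t + h t))) p volume ≤ ε

section Approx

variable {A : ℝ → X →ₗ.[ℂ] X} {p : ℝ≥0∞} {κ μ : ℝ} {ψ φ : ℝ → X}

theorem IsRegular.aestronglyMeasurable_comb {f g h : ℝ → X} (hr : IsRegular A univ f g h)
    (κ μ : ℝ) : AEStronglyMeasurable (fun t => κ • f t - μ • (-g t + h t)) volume := by
  have h1 := hr.isW12.memLp.aestronglyMeasurable
  have h2 := hr.isW12.memLp_deriv.aestronglyMeasurable
  have h3 := hr.memLp_apply.aestronglyMeasurable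
  rw [Measure.restrict_univ] at h1 h2 h3
  exact (h1.const_smul κ).sub ((h2.neg.add h3).const_smul μ)

theorem IsRegular.zero : IsRegular A univ (fun _ => 0) (fun _ => 0) (fun _ => 0) :=
  ⟨⟨MemLp.zero', MemLp.zero', fun _ _ _ _ => by simp⟩,
    Eventually.of_forall fun t => (A t).graph.zero_mem, MemLp.zero'⟩

theorem IsRegular.add {f g h f' g' h' : ℝ → X} (hr : IsRegular A univ f g h)
    (hr' : IsRegular A univ f' g' h') :
    IsRegular A univ (fun t => f t + f' t) (fun t => g t + g' t) (fun t => h t + h' t) := by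
  refine ⟨⟨hr.isW12.memLp.add hr'.isW12.memLp, hr.isW12.memLp_deriv.add hr'.isW12.memLp_deriv,
    fun s hs t ht => ?_⟩, ?_, hr.memLp_apply.add hr'.memLp_apply⟩
  · have h1 := hr.isW12.memLp_deriv
    have h2 := hr'.isW12.memLp_deriv
    rw [Measure.restrict_univ] at h1 h2
    rw [intervalIntegral.integral_add (intervalIntegrable_of_memLp_univ h1 s t)
      (intervalIntegrable_of_memLp_univ h2 s t), ← hr.isW12.sub_eq_integral s hs t ht,
      ← hr'.isW12.sub_eq_integral s hs t ht, add_sub_add_comm]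
  · filter_upwards [hr.mem_graph, hr'.mem_graph] with t h1 h2
    exact (A t).graph.add_mem h1 h2

theorem IsApprox.of_near (hp : 1 ≤ p) (hψ : AEStronglyMeasurable ψ volume)
    (H : ∀ ε : ℝ≥0∞, 0 < ε → ∃ φ : ℝ → X, AEStronglyMeasurable φ volume ∧ IsApprox A p κ μ φ ∧
      eLpNorm (fun t => ψ t - φ t) p volume ≤ ε) : IsApprox A p κ μ ψ := by
  intro ε hε
  obtain ⟨φ, hφ, h1, h2⟩ := H (ε / 2) (ENNReal.half_pos hε.ne')
  obtain ⟨f, g, h, hr, h3⟩ := h1 (ε / 2) (ENNReal.half_pos hε.ne')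
  refine ⟨f, g, h, hr, ?_⟩
  have e : (fun t => ψ t - (κ • f t - μ • (-g t + h t))) =
      (fun t => ψ t - φ t) + fun t => φ t - (κ • f t - μ • (-g t + h t)) := by
    ext t; simp
  rw [e]
  refine (eLpNorm_add_le (hψ.sub hφ) (hφ.sub (hr.aestronglyMeasurable_comb κ μ)) hp).trans ?_
  exact (add_le_add h2 h3).trans_eq (ENNReal.add_halves ε)

theorem IsApprox.zero : IsApprox A p κ μ fun _ => 0 := fun ε _ =>
  ⟨_, _, _, IsRegular.zero, by simp⟩

theorem IsApprox.add (hp : 1 ≤ p) (hψ : AEStronglyMeasurable ψ volume)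
    (hφ : AEStronglyMeasurable φ volume) (h1 : IsApprox A p κ μ ψ) (h2 : IsApprox A p κ μ φ) :
    IsApprox A p κ μ fun t => ψ t + φ t := by
  intro ε hε
  obtain ⟨f, g, h, hr, h3⟩ := h1 (ε / 2) (ENNReal.half_pos hε.ne')
  obtain ⟨f', g', h', hr', h3'⟩ := h2 (ε / 2) (ENNReal.half_pos hε.ne')
  refine ⟨_, _, _, hr.add hr', ?_⟩
  have e : (fun t => ψ t + φ t - (κ • (f t + f' t) - μ • (-(g t + g' t) + (h t + h' t)))) =
      (fun t => ψ t - (κ • f t - μ • (-g t + h t))) +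
        fun t => φ t - (κ • f' t - μ • (-g' t + h' t)) := by
    ext t
    simp only [Pi.add_apply]
    module
  rw [e]
  refine (eLpNorm_add_le (hψ.sub (hr.aestronglyMeasurable_comb κ μ))
    (hφ.sub (hr'.aestronglyMeasurable_comb κ μ)) hp).trans ?_
  exact (add_le_add h3 h3').trans_eq (ENNReal.add_halves ε)

theorem IsApprox.sum (hp : 1 ≤ p) {ι : Type*} (s : Finset ι) {ψ : ι → ℝ → X}
    (hψ : ∀ i, AEStronglyMeasurable (ψ i) volume) (h : ∀ i, IsApprox A p κ μ (ψ i)) :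
    IsApprox A p κ μ fun t => ∑ i ∈ s, ψ i t := by
  classical
  induction s using Finset.induction_on with
  | empty => simpa using IsApprox.zero
  | insert i s hi ih =>
    simp only [Finset.sum_insert hi]
    exact (h i).add hp (hψ i) (s.aestronglyMeasurable_fun_sum fun j _ => hψ j) ih

variable {U : ℝ → ℝ → X →L[ℂ] X}

/-- Apply `κ - μ(-d/dt + A)` to `θ f` with `f` close to the orbit: the result is `(κ θ + μ θ') f - μ
θ (-g + k)`. The defect `-g + k` is small only in `L²`, hence the alternative `p = 2` or `μ = 0`. -/
theorem IsMildPropagator.isApprox_smul (hU : IsMildPropagator A U) {d : ℝ} {θ θ' : ℝ → ℝ}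
    (hθ : IsCutoff d θ θ') (x : X) (hp1 : 1 ≤ p) (hp : p = 2 ∨ μ = 0) :
    IsApprox A p κ μ fun t => (κ * θ t + μ * θ' t) • U t 0 x := by
  intro ε hε
  have hu : Continuous fun t => U t 0 x := (hU.isMildSolution 0 x).continuous
  set η : ℝ → ℝ := fun t => κ * θ t + μ * θ' t with hη
  have hηc : Continuous η := (hθ.continuous.const_mul κ).add (hθ.continuous_deriv.const_mul μ)
  have hη0 : ∀ t, d ≤ |t| → η t = 0 := fun t ht => by
    simp [hη, hθ.eq_zero t ht, hθ.deriv_eq_zero t ht]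
  obtain ⟨C, hC0, hC⟩ := exists_bound_of_eq_zero hηc hη0
  obtain ⟨C', hC'0, hC'⟩ := exists_bound_of_eq_zero hθ.continuous hθ.eq_zero
  set K : ℝ≥0∞ := intervalNorm d p * ENNReal.ofReal C + ENNReal.ofReal (|μ| * C') with hK
  have hKt : K ≠ ∞ := by
    rw [hK, ENNReal.add_ne_top]
    exact ⟨ENNReal.mul_ne_top (intervalNorm_ne_top d p) ENNReal.ofReal_ne_top,
      ENNReal.ofReal_ne_top⟩
  obtain ⟨δ, hδ, hδε⟩ := exists_pos_mul_ofReal_le hKt hε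
  obtain ⟨f, g, k, hr, h1, h2⟩ := (hU.isMildOn 0 x d).2 δ hδ
  refine ⟨_, _, _, hr.cutoff hθ, le_trans ?_ hδε⟩
  have e : (fun t => η t • U t 0 x - (κ • θ t • f t -
      μ • (-(θ' t • f t + θ t • g t) + θ t • k t))) =
      (Icc (-d) d).indicator ((fun t => η t • (U t 0 x - f t)) +
        fun t => (μ * θ t) • (-g t + k t)) := by
    rw [← eq_indicator_of_eq_zero]
    · ext t
      simp only [Pi.add_apply, hη]
      module
    · intro t ht
      simp [hη0 t ht, hθ.eq_zero t ht]
  rw [e, eLpNorm_indicator_eq_eLpNorm_restrict measurableSet_Icc, hK, add_mul]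
  have hm1 := hr.isW12.memLp.aestronglyMeasurable
  have hm2 := hr.isW12.memLp_deriv.aestronglyMeasurable.neg.add
    hr.memLp_apply.aestronglyMeasurable
  refine (eLpNorm_add_le (hηc.aestronglyMeasurable.smul (hu.aestronglyMeasurable.sub hm1))
    ((hθ.continuous.const_mul μ).aestronglyMeasurable.smul hm2) hp1).trans (add_le_add ?_ ?_)
  · rw [mul_assoc, ← ENNReal.ofReal_mul hC0]
    refine eLpNorm_le_of_ae_bound (ae_restrict_of_forall_mem measurableSet_Icc fun t ht => ?_)
    change ‖η t • (U t 0 x - f t)‖ ≤ _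
    rw [norm_smul]
    have := h1 t ht
    rw [norm_sub_rev] at this
    exact mul_le_mul (hC t) this (norm_nonneg _) hC0
  · rcases hp with rfl | rfl
    · refine (eLpNorm_le_mul_eLpNorm_of_ae_le_mul (c := |μ| * C')
        (Eventually.of_forall fun t => ?_) 2).trans (mul_le_mul_right h2 _)
      change ‖(μ * θ t) • (-g t + k t)‖ ≤ _
      rw [norm_smul, norm_mul]
      exact mul_le_mul_of_nonneg_right (mul_le_mul_of_nonneg_left (hC' t) (abs_nonneg μ))
        (norm_nonneg _)
    · change eLpNorm (fun t => ((0 : ℝ) * θ t) • (-g t + k t)) p _ ≤ _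
      simp

theorem exists_smooth_cutoff (T : ℝ) : ∃ χ χ' : ℝ → ℝ, (∀ t, HasDerivAt χ (χ' t) t) ∧
    Continuous χ' ∧ (∀ t, 0 ≤ χ t ∧ χ t ≤ 1) ∧ (∀ t, t ≤ T → χ t = 1) ∧ (∀ t, T + 1 ≤ t → χ t = 0) ∧
    (∀ t, t < T ∨ T + 1 < t → χ' t = 0) ∧
    ∀ t, χ' t = -deriv Real.smoothTransition (T + 1 - t) := by
  have hs : ContDiff ℝ 1 Real.smoothTransition := Real.smoothTransition.contDiff (n := 1)
  have hd : ∀ t, HasDerivAt (fun t => Real.smoothTransition (T + 1 - t))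
      (-deriv Real.smoothTransition (T + 1 - t)) t := by
    intro t
    have h1 := ((hs.differentiable one_ne_zero).differentiableAt (x := T + 1 - t)).hasDerivAt
    have := h1.scomp t ((hasDerivAt_id t).const_sub (T + 1))
    rw [neg_one_smul] at this
    exact this
  refine ⟨fun t => Real.smoothTransition (T + 1 - t), _, hd,
    ((hs.continuous_deriv le_rfl).comp (continuous_const.sub continuous_id)).neg,
    fun t => ⟨Real.smoothTransition.nonneg _, Real.smoothTransition.le_one _⟩,
    fun t ht => Real.smoothTransition.one_of_one_le (by linarith),
    fun t ht => Real.smoothTransition.zero_of_nonpos (by linarith), fun t ht => ?_, fun _ => rfl⟩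
  rcases ht with ht | ht
  · refine (hd t).unique ((hasDerivAt_const t (1 : ℝ)).congr_of_eventuallyEq ?_)
    filter_upwards [gt_mem_nhds ht] with s hs
    exact Real.smoothTransition.one_of_one_le (by linarith)
  · refine (hd t).unique ((hasDerivAt_const t (0 : ℝ)).congr_of_eventuallyEq ?_)
    filter_upwards [lt_mem_nhds ht] with s hs
    exact Real.smoothTransition.zero_of_nonpos (by linarith)

/-- Along an orbit the range problem is the scalar ODE `Θ' + κ Θ = θ`. Its solution from `-∞`
vanishes before `-d` and decays like `exp(-κ t)` after `d`, by `κ > 0`; cutting it off at a late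
time `T` costs only `χ' Θ`. -/
theorem IsMildPropagator.isApprox_smul_of_continuous (hU : IsMildPropagator A U) {d : ℝ}
    {θ : ℝ → ℝ} (hd : 0 ≤ d) (hθ : Continuous θ) (hθ0 : ∀ t, d ≤ |t| → θ t = 0) (x : X)
    (hκ : 0 < κ) : IsApprox A 2 κ 1 fun t => θ t • U t 0 x := by
  have hu : Continuous fun t => U t 0 x := (hU.isMildSolution 0 x).continuous
  refine IsApprox.of_near one_le_two (hθ.smul hu).aestronglyMeasurable fun ε hε => ?_
  set P : ℝ → ℝ := fun t => ∫ s in (-d)..t, Real.exp (κ * s) * θ s with hP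
  have hPi : Continuous fun s => Real.exp (κ * s) * θ s := by fun_prop
  have hPd : ∀ t, HasDerivAt P (Real.exp (κ * t) * θ t) t := fun t =>
    intervalIntegral.integral_hasDerivAt_right (hPi.intervalIntegrable _ _)
      (hPi.stronglyMeasurableAtFilter _ _) hPi.continuousAt
  have hPc : Continuous P := continuous_iff_continuousAt.2 fun t => (hPd t).continuousAt
  have hP0 : ∀ t, t ≤ -d → P t = 0 := by
    intro t ht
    refine intervalIntegral.integral_zero_ae (Eventually.of_forall fun τ hτ => ?_)
    rw [uIoc_of_ge ht] at hτ
    rw [hθ0 τ, mul_zero]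
    rw [abs_of_nonpos (by linarith [hτ.2])]; linarith [hτ.2]
  have hP1 : ∀ t, d ≤ t → P t = P d := by
    intro t ht
    have e := intervalIntegral.integral_add_adjacent_intervals
      (hPi.intervalIntegrable (μ := volume) (-d) d) (hPi.intervalIntegrable d t)
    have : ∫ s in d..t, Real.exp (κ * s) * θ s = 0 := by
      refine intervalIntegral.integral_zero_ae (Eventually.of_forall fun τ hτ => ?_)
      rw [uIoc_of_le ht] at hτ
      rw [hθ0 τ (hτ.1.le.trans (le_abs_self _)), mul_zero]
    rw [this, add_zero] at e
    exact e.symm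
  set Θ : ℝ → ℝ := fun t => Real.exp (-(κ * t)) * P t with hΘ
  have hΘd : ∀ t, HasDerivAt Θ (θ t - κ * Θ t) t := by
    intro t
    have h1 : HasDerivAt (fun t => Real.exp (-(κ * t))) (Real.exp (-(κ * t)) * -(κ * 1)) t :=
      (((hasDerivAt_id t).const_mul κ).neg).exp
    have h2 : HasDerivAt Θ _ t := h1.mul (hPd t)
    refine h2.congr_deriv ?_
    have : Real.exp (-(κ * t)) * Real.exp (κ * t) = 1 := by rw [← Real.exp_add]; simp
    change _ = θ t - κ * (Real.exp (-(κ * t)) * P t)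
    linear_combination (θ t) * this
  have hΘc : Continuous Θ := continuous_iff_continuousAt.2 fun t => (hΘd t).continuousAt
  obtain ⟨B, hB⟩ := (isCompact_Icc (a := (0 : ℝ)) (b := 1)).exists_bound_of_continuousOn
    ((Real.smoothTransition.contDiff (n := 1)).continuous_deriv le_rfl).continuousOn
  have hB0 : 0 ≤ B := (norm_nonneg _).trans (hB 0 (by simp))
  -- choose the cut-off time
  obtain ⟨δ, hδ, hδε⟩ := exists_pos_mul_ofReal_le (K := intervalNorm (1 / 2) 2)
    (intervalNorm_ne_top _ _) hε
  have hlim : Tendsto (fun T : ℝ => B * (Real.exp (-(κ * T)) * |P d|) * ‖x‖) atTop (𝓝 0) := by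
    have h1 : Tendsto (fun T : ℝ => Real.exp (-(κ * T))) atTop (𝓝 0) :=
      Real.tendsto_exp_neg_atTop_nhds_zero.comp (tendsto_id.const_mul_atTop hκ)
    simpa using ((h1.mul_const |P d|).const_mul B).mul_const ‖x‖
  obtain ⟨T, hT1, hT2⟩ := ((eventually_ge_atTop d).and (hlim.eventually (gt_mem_nhds hδ))).exists
  obtain ⟨χ, χ', hχd, hχc', hχ01, hχ1, hχ0, hχ'0, hχ'⟩ := exists_smooth_cutoff T
  have hχc : Continuous χ := continuous_iff_continuousAt.2 fun t => (hχd t).continuousAt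
  have hcut : IsCutoff (T + 2) (fun t => χ t * Θ t) (fun t => χ' t * Θ t + χ t * (θ t - κ * Θ t)) := by
    refine isCutoff_of_eq_zero (a := T + 1) (by linarith) (by linarith)
      (fun t => (hχd t).mul (hΘd t))
      ((hχc'.mul hΘc).add (hχc.mul (hθ.sub (hΘc.const_mul κ)))) fun t ht => ?_
    rcases le_abs.1 ht with h | h
    · rw [hχ0 t h, zero_mul]
    · simp only [hΘ]
      rw [hP0 t (by linarith), mul_zero, mul_zero]
  have hη : ∀ t, κ * (χ t * Θ t) + 1 * (χ' t * Θ t + χ t * (θ t - κ * Θ t)) =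
      θ t + χ' t * Θ t := by
    intro t
    have : χ t * θ t = θ t := by
      rcases le_total t T with h | h
      · rw [hχ1 t h, one_mul]
      · rw [hθ0 t ((hT1.trans h).trans (le_abs_self t)), mul_zero]
    linear_combination this
  have happ := hU.isApprox_smul (κ := κ) (μ := 1) hcut x one_le_two (Or.inl rfl)
  simp only [hη] at happ
  refine ⟨fun t => (θ t + χ' t * Θ t) • U t 0 x, ((hθ.add (hχc'.mul hΘc)).smul hu).aestronglyMeasurable, happ, ?_⟩
  -- The error lives on `[T, T + 1]`. Translating it to `[-1/2, 1/2]` makes the interval constant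
  -- independent of `T`, so `δ` could be chosen before `T`.
  set Q : ℝ → X := fun s => -(χ' (s + (T + 1 / 2)) * Θ (s + (T + 1 / 2))) •
    U (s + (T + 1 / 2)) 0 x with hQ
  have e : (fun t => θ t • U t 0 x - (θ t + χ' t * Θ t) • U t 0 x) =
      fun t => Q (t - (T + 1 / 2)) := by
    ext t
    simp only [hQ, sub_add_cancel]
    module
  have hsh : ∀ F : ℝ → X, Continuous F → eLpNorm (fun t => F (t - (T + 1 / 2))) 2 volume =
      eLpNorm F 2 volume := fun F hF =>
    eLpNorm_comp_measurePreserving hF.aestronglyMeasurable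
      (measurePreserving_sub_right volume (T + 1 / 2))
  rw [e, hsh Q]
  · refine le_trans (eLpNorm_le_intervalNorm_mul (d := 1 / 2) (C := δ) ?_ ?_ 2) hδε
    · intro t ht
      have : χ' (t + (T + 1 / 2)) = 0 := by
        by_contra hne
        have hclos : closure (Iio T ∪ Ioi (T + 1)) ⊆ {t | χ' t = 0} :=
          closure_minimal (fun s hs => hχ'0 s hs) (isClosed_eq hχc' continuous_const)
        refine hne (hclos ?_)
        rw [closure_union, closure_Iio, closure_Ioi]
        rcases le_abs.1 ht with h | h
        · right; simp only [mem_Ici]; linarith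
        · left; simp only [mem_Iic]; linarith
      simp only [hQ, this, zero_mul, neg_zero, zero_smul]
    · intro t
      simp only [hQ]
      set s := t + (T + 1 / 2)
      rw [norm_smul, hU.isUnitary.norm_map, norm_neg, norm_mul]
      refine le_trans ?_ hT2.le
      refine mul_le_mul_of_nonneg_right ?_ (norm_nonneg x)
      by_cases hs : s < T ∨ T + 1 < s
      · rw [hχ'0 s hs]; simp only [norm_zero, zero_mul]; positivity
      · push Not at hs
        have h1 : ‖χ' s‖ ≤ B := by
          rw [hχ', norm_neg]
          exact hB _ ⟨by linarith [hs.2], by linarith [hs.1]⟩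
        have h2 : ‖Θ s‖ ≤ Real.exp (-(κ * T)) * |P d| := by
          simp only [hΘ]
          rw [hP1 s (hT1.trans hs.1), norm_mul, Real.norm_eq_abs, Real.norm_eq_abs,
            abs_of_pos (Real.exp_pos _)]
          refine mul_le_mul_of_nonneg_right (Real.exp_le_exp.2 ?_) (abs_nonneg _)
          nlinarith [hs.1]
        exact mul_le_mul h1 h2 (norm_nonneg _) hB0
  · have h1 : Continuous fun s : ℝ => s + (T + 1 / 2) := continuous_add_const _
    exact ((hχc'.comp h1).mul (hΘc.comp h1)).neg.smul (hu.comp h1)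

/-- Continuous vector functions with compact support are uniform limits of finite sums of smooth
scalar functions times fixed vectors. -/
theorem exists_sum_smul_near {φ : ℝ → X} (hφ : Continuous φ) {a : ℝ}
    (h0 : ∀ t, a ≤ |t| → φ t = 0) {ω : ℝ} (hω : 0 < ω) :
    ∃ (n : ℕ) (θ θ' : ℕ → ℝ → ℝ) (d : ℝ) (x : ℕ → X), (∀ i, IsCutoff d (θ i) (θ' i)) ∧
      (∀ t, a + 1 ≤ |t| → ∑ i ∈ Finset.range n, θ i t • x i = 0) ∧
      ∀ t, ‖φ t - ∑ i ∈ Finset.range n, θ i t • x i‖ ≤ ω := by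
  have huc : UniformContinuous φ := by
    refine HasCompactSupport.uniformContinuous_of_continuous
      (HasCompactSupport.intro (isCompact_Icc (a := -a) (b := a)) fun t ht => h0 t ?_) hφ
    by_contra hlt
    exact ht (abs_le.1 (not_le.1 hlt).le)
  obtain ⟨δ₀, hδ₀, hφδ⟩ := Metric.uniformContinuous_iff.1 huc ω hω
  obtain ⟨N, hN⟩ := exists_nat_gt (a / min (δ₀ / 2) 1)
  set δ := min (δ₀ / 2) 1 with hδ
  have hδ0 : 0 < δ := by positivity
  have hδ1 : δ ≤ 1 := min_le_right _ _
  have hδ2 : δ < δ₀ := (min_le_left _ _).trans_lt (by linarith)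
  have hNa : a ≤ N * δ := by rw [div_lt_iff₀ hδ0] at hN; exact hN.le
  set σ := Real.smoothTransition with hσ
  have hσs : ContDiff ℝ 1 σ := Real.smoothTransition.contDiff (n := 1)
  -- Differences of consecutive translates of a smooth step telescope, giving a partition of unity
  -- on `[-a, a]`; the `i`-th function is supported within `δ` of the node `(i - N) δ`.
  set θ : ℕ → ℝ → ℝ := fun i t => σ (t / δ + N + 1 - i) - σ (t / δ + N + 1 - (i + 1 : ℕ)) with hθ
  have hθs : ∀ i, ContDiff ℝ 1 (θ i) := fun i =>
    (hσs.comp (by fun_prop)).sub (hσs.comp (by fun_prop))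
  set y : ℕ → ℝ := fun i => (i - N) * δ with hy
  have hθ0 : ∀ i t, 0 ≤ θ i t := by
    intro i t
    refine sub_nonneg.2 (Real.smoothTransition.monotone ?_)
    push_cast; linarith
  have hθsupp : ∀ i t, δ ≤ |t - y i| → θ i t = 0 := by
    intro i t hti
    have e : (t - y i) / δ = t / δ + N - i := by simp only [hy]; field_simp; ring
    simp only [hθ]
    push_cast
    rcases le_abs.1 hti with h | h
    · have : 1 ≤ (t - y i) / δ := by rwa [le_div_iff₀ hδ0, one_mul]
      rw [e] at this
      rw [hσ, Real.smoothTransition.one_of_one_le (by linarith),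
        Real.smoothTransition.one_of_one_le (by linarith), sub_self]
    · have : (t - y i) / δ ≤ -1 := by rw [div_le_iff₀ hδ0]; linarith
      rw [e] at this
      rw [hσ, Real.smoothTransition.zero_of_nonpos (by linarith),
        Real.smoothTransition.zero_of_nonpos (by linarith), sub_self]
  have hsum : ∀ t, ∑ i ∈ Finset.range (2 * N + 1), θ i t =
      σ (t / δ + N + 1) - σ (t / δ - N) := by
    intro t
    have := Finset.sum_range_sub' (fun i : ℕ => σ (t / δ + N + 1 - i)) (2 * N + 1)
    simp only [hθ]
    rw [this]
    push_cast
    congr 2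
    · ring
    · ring
  have hsum1 : ∀ t, |t| ≤ a → ∑ i ∈ Finset.range (2 * N + 1), θ i t = 1 := by
    intro t ht
    have h1 : t / δ ≤ N := by rw [div_le_iff₀ hδ0]; linarith [le_abs_self t]
    have h2 : -(N : ℝ) ≤ t / δ := by rw [le_div_iff₀ hδ0]; linarith [neg_abs_le t]
    rw [hsum, hσ, Real.smoothTransition.one_of_one_le (by linarith),
      Real.smoothTransition.zero_of_nonpos (by linarith), sub_zero]
  have hsumle : ∀ t, ∑ i ∈ Finset.range (2 * N + 1), θ i t ≤ 1 := by
    intro t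
    rw [hsum]
    linarith [Real.smoothTransition.le_one (t / δ + N + 1),
      Real.smoothTransition.nonneg (t / δ - N)]
  -- The common support bound is demanded for every natural index, so the functions outside the sum
  -- are replaced by 0.
  refine ⟨2 * N + 1, fun i => if i < 2 * N + 1 then θ i else 0,
    fun i => if i < 2 * N + 1 then deriv (θ i) else 0, N * δ + δ + δ + 1, fun i => φ (y i), fun i => ?_,
    ?_⟩
  · by_cases hi : i < 2 * N + 1
    · simp only [hi, if_true]
      refine isCutoff_of_eq_zero (a := N * δ + δ + δ) (by positivity) (by linarith)
        (fun t => (((hθs i).differentiable one_ne_zero) t).hasDerivAt)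
        ((hθs i).continuous_deriv le_rfl) fun t ht => hθsupp i t ?_
      have h1 : |y i| ≤ N * δ := by
        have hi' : (i : ℝ) ≤ 2 * N := by exact_mod_cast Nat.lt_succ_iff.1 hi
        simp only [hy]
        rw [abs_mul, abs_of_pos hδ0]
        refine mul_le_mul_of_nonneg_right (abs_le.2 ⟨?_, ?_⟩) hδ0.le
        · have : (0 : ℝ) ≤ i := Nat.cast_nonneg i
          linarith
        · linarith
      have := abs_sub_abs_le_abs_sub t (y i)
      linarith
    · simp only [hi, if_false]
      exact ⟨by positivity, fun t => hasDerivAt_const t 0, continuous_const, fun _ _ => rfl,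
        fun _ _ => rfl⟩
  · have hcongr : ∀ t, ∑ i ∈ Finset.range (2 * N + 1),
        (if i < 2 * N + 1 then θ i else 0) t • φ (y i) =
          ∑ i ∈ Finset.range (2 * N + 1), θ i t • φ (y i) := fun t =>
      Finset.sum_congr rfl fun i hi => by rw [if_pos (Finset.mem_range.1 hi)]
    simp only [hcongr]
    refine ⟨fun t ht => Finset.sum_eq_zero fun i _ => ?_, fun t => ?_⟩
    · by_cases hyi : a ≤ |y i|
      · rw [h0 _ hyi, smul_zero]
      · rw [hθsupp i t, zero_smul]
        have := abs_sub_abs_le_abs_sub t (y i)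
        linarith
    · have e : φ t = ∑ i ∈ Finset.range (2 * N + 1), θ i t • φ t := by
        rw [← Finset.sum_smul]
        rcases le_total a |t| with h | h
        · rw [h0 t h, smul_zero]
        · rw [hsum1 t h, one_smul]
      nth_rewrite 1 [e]
      rw [← Finset.sum_sub_distrib]
      refine (norm_sum_le_of_le _ (f := fun i => θ i t • φ t - θ i t • φ (y i))
        (n := fun i => θ i t * ω) fun i _ => ?_).trans ?_
      · rw [← smul_sub, norm_smul, Real.norm_of_nonneg (hθ0 i t)]
        by_cases hti : δ ≤ |t - y i|
        · rw [hθsupp i t hti]; simp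
        · refine mul_le_mul_of_nonneg_left ?_ (hθ0 i t)
          rw [← dist_eq_norm]
          refine (hφδ ?_).le
          rw [Real.dist_eq]
          linarith
      · rw [← Finset.sum_mul]
        exact mul_le_of_le_one_left hω.le (hsumle t)

/-- Pull `φ` back to `φ₀(t) = U(0,t) φ(t)`, approximate `φ₀` uniformly by sums `∑ θᵢ(t) xᵢ` with
fixed vectors, and push forward. The isometries `U(t,0)` preserve the error and turn the sums into
combinations of orbits. -/
theorem IsMildPropagator.isApprox_of_continuous (hU : IsMildPropagator A U) (hp : 1 ≤ p)
    (hbase : ∀ (d : ℝ) (θ θ' : ℝ → ℝ), IsCutoff d θ θ' → ∀ x,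
      IsApprox A p κ μ fun t => θ t • U t 0 x) {φ : ℝ → X} (hφ : Continuous φ) {a : ℝ}
    (h0 : ∀ t, a ≤ |t| → φ t = 0) : IsApprox A p κ μ φ := by
  have hUc : Continuous fun q : ℝ × ℝ × X => U q.1 q.2.1 q.2.2 := by
    refine continuous_iff_continuousAt.2 fun q => ?_
    refine tendsto_clm_apply (D := fun q : ℝ × ℝ × X => U q.1 q.2.1) (M := 1)
      (Eventually.of_forall fun q => ContinuousLinearMap.opNorm_le_bound _ zero_le_one fun x => ?_)
      ?_ (continuous_snd.snd.tendsto q)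
    · rw [hU.isUnitary.norm_map, one_mul]
    · exact ((hU.isUnitary.continuous q.2.2).comp
        (continuous_fst.prodMk continuous_snd.fst)).tendsto q
  set φ₀ : ℝ → X := fun t => U 0 t (φ t) with hφ₀
  have hφ₀c : Continuous φ₀ := hUc.comp (continuous_const.prodMk (continuous_id.prodMk hφ))
  set b := max a 1 with hb
  have hφ₀0 : ∀ t, b ≤ |t| → φ₀ t = 0 := fun t ht => by
    simp [hφ₀, h0 t ((le_max_left _ _).trans ht)]
  refine IsApprox.of_near hp hφ.aestronglyMeasurable fun ε hε => ?_
  obtain ⟨δ, hδ, hδε⟩ := exists_pos_mul_ofReal_le (K := intervalNorm (b + 1) p)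
    (intervalNorm_ne_top _ _) hε
  obtain ⟨n, θ, θ', d, x, hθ, hs, hn⟩ := exists_sum_smul_near hφ₀c hφ₀0 hδ
  have hc : ∀ i, Continuous fun t => θ i t • U t 0 (x i) := fun i =>
    (hθ i).continuous.smul (hU.isMildSolution 0 (x i)).continuous
  refine ⟨fun t => ∑ i ∈ Finset.range n, θ i t • U t 0 (x i),
    (continuous_finsetSum _ fun i _ => hc i).aestronglyMeasurable,
    IsApprox.sum hp _ (fun i => (hc i).aestronglyMeasurable) fun i => hbase d _ _ (hθ i) (x i), ?_⟩
  have e : ∀ t, φ t - ∑ i ∈ Finset.range n, θ i t • U t 0 (x i) =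
      U t 0 (φ₀ t - ∑ i ∈ Finset.range n, θ i t • x i) := by
    intro t
    rw [map_sub, map_sum, hφ₀, hU.isUnitary.apply_apply, hU.isUnitary.refl_apply]
    congr 1
    refine Finset.sum_congr rfl fun i _ => ?_
    rw [← Complex.coe_smul, ← Complex.coe_smul, map_smul]
  simp only [e]
  refine (eLpNorm_le_intervalNorm_mul (d := b + 1) (C := δ) (fun t ht => ?_) (fun t => ?_) p).trans
    hδε
  · rw [hs t ht, hφ₀0 t (by linarith), sub_zero, map_zero]
  · rw [hU.isUnitary.norm_map]; exact hn t

theorem IsApprox.of_memLp (h : ∀ (φ : ℝ → X), Continuous φ → ∀ a : ℝ, (∀ t, a ≤ |t| → φ t = 0) →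
    IsApprox A 2 κ μ φ) {φ : ℝ → X} (hφ : MemLp φ 2 volume) : IsApprox A 2 κ μ φ := by
  refine IsApprox.of_near one_le_two hφ.aestronglyMeasurable fun ε hε => ?_
  obtain ⟨g, hg1, hg2, hg3, -⟩ := hφ.exists_hasCompactSupport_eLpNorm_sub_le (by simp) hε.ne'
  refine ⟨g, hg3.aestronglyMeasurable, ?_, hg2⟩
  obtain ⟨r, hr⟩ := hg1.isCompact.isBounded.subset_closedBall 0
  refine h g hg3 (r + 1) fun t ht => image_eq_zero_of_notMem_tsupport fun hmem => ?_
  have := hr hmem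
  rw [mem_closedBall_zero_iff, Real.norm_eq_abs] at this
  linarith

theorem IsRegular.continuous {f g h : ℝ → X} (hr : IsRegular A univ f g h) : Continuous f := by
  refine continuous_iff_continuousAt.2 fun t => ?_
  have h1 : ContinuousOn f (Icc (t - 1) (t + 1)) :=
    (hr.isW12.mono (subset_univ _)).continuousOn (by linarith)
  exact h1.continuousAt (Icc_mem_nhds (by linarith) (by linarith))

/-- After truncation the compactly supported case with `p = ∞` gives a bound almost everywhere; both
functions are continuous, so it holds at every time. -/
theorem exists_regular_near_zeroAtInfty (h : ∀ (φ : ℝ → X), Continuous φ → ∀ a : ℝ,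
    (∀ t, a ≤ |t| → φ t = 0) → IsApprox A ∞ 1 0 φ) (φ : C₀(ℝ, X)) {ε : ℝ} (hε : 0 < ε) :
    ∃ f g h : ℝ → X, IsRegular A univ f g h ∧ ∀ t, ‖φ t - f t‖ ≤ ε := by
  have hz := φ.zero_at_infty'
  obtain ⟨K, hK, hφK⟩ := mem_cocompact.1 (hz (Metric.closedBall_mem_nhds 0 (half_pos hε)))
  obtain ⟨r, hr⟩ := hK.isBounded.subset_closedBall 0
  have hsm : ∀ t, r < |t| → ‖φ t‖ ≤ ε / 2 := by
    intro t ht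
    have h1 : t ∈ Kᶜ := fun hmem => by
      have := hr hmem
      rw [mem_closedBall_zero_iff, Real.norm_eq_abs] at this
      linarith
    exact mem_closedBall_zero_iff.1 (hφK h1)
  obtain ⟨χ, χ', hχd, -, hχ01, hχ1, hχ0, -, -⟩ := exists_smooth_cutoff r
  have hχc : Continuous χ := continuous_iff_continuousAt.2 fun t => (hχd t).continuousAt
  have hψc : Continuous fun t => χ |t| • φ t :=
    (hχc.comp continuous_abs).smul (map_continuous φ)
  obtain ⟨f, g, k, hreg, hf⟩ := h (fun t => χ |t| • φ t) hψc (r + 1)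
    (fun t ht => by simp only [hχ0 _ ht, zero_smul]) (ENNReal.ofReal (ε / 2)) (by simpa using hε)
  refine ⟨f, g, k, hreg, ?_⟩
  have hfc := hreg.continuous
  have hae : ∀ᵐ t, ‖χ |t| • φ t - f t‖ ≤ ε / 2 := by
    rw [eLpNorm_exponent_top] at hf
    filter_upwards [ae_le_eLpNormEssSup (μ := (volume : Measure ℝ))
      (f := fun t => χ |t| • φ t - ((1 : ℝ) • f t - (0 : ℝ) • (-g t + k t)))] with t ht
    have := ht.trans hf
    simp only [one_smul, zero_smul, sub_zero] at this
    rwa [← ofReal_norm, ENNReal.ofReal_le_ofReal_iff (by positivity)] at this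
  have hall : ∀ t, ‖χ |t| • φ t - f t‖ ≤ ε / 2 := by
    have hd := Measure.dense_of_ae hae
    have hcl : IsClosed {t | ‖χ |t| • φ t - f t‖ ≤ ε / 2} :=
      isClosed_le (hψc.sub hfc).norm continuous_const
    have := hd.closure_eq
    rw [hcl.closure_eq] at this
    exact fun t => by have := this ▸ mem_univ t; exact this
  intro t
  have h2 : ‖φ t - χ |t| • φ t‖ ≤ ε / 2 := by
    rcases le_or_gt |t| r with h | h
    · rw [hχ1 _ h, one_smul, sub_self, norm_zero]; positivity
    · have : φ t - χ |t| • φ t = (1 - χ |t|) • φ t := by module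
      rw [this, norm_smul, Real.norm_of_nonneg (by linarith [(hχ01 |t|).2])]
      exact (mul_le_of_le_one_left (norm_nonneg _) (by linarith [(hχ01 |t|).1])).trans (hsm t h)
  have := norm_sub_le_norm_sub_add_norm_sub (φ t) (χ |t| • φ t) (f t)
  linarith [hall t]

end Approx

/-- The parameters `(κ, μ) = (2, 1)` express density of `(w' - G₀) F₂` for `w' = 2`, and `(1, 0)`
density of `F₂` itself, with `p = 2` for `L²` and `p = ∞` for `C₀`. -/
theorem SmoothFamily.evolutionConditions {H : ℝ → X →ₗ.[ℂ] X} (hH : SmoothFamily H) {c : ℂ}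
    (hc : c = Complex.I ∨ c = -Complex.I) : EvolutionConditions fun t => c • H t := by
  obtain ⟨U, hU⟩ := hH.exists_isMildPropagator hc
  have h2 : ∀ φ : ℝ → X, MemLp φ 2 volume → IsApprox (fun t => c • H t) 2 2 1 φ := fun φ hφ =>
    IsApprox.of_memLp (fun φ hφ a h0 => hU.isApprox_of_continuous one_le_two
      (fun d θ θ' hθ x => hU.isApprox_smul_of_continuous hθ.nonneg hθ.continuous hθ.eq_zero x
        two_pos) hφ h0) hφ
  have hbase : ∀ p : ℝ≥0∞, 1 ≤ p → ∀ φ : ℝ → X, Continuous φ → ∀ a : ℝ,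
      (∀ t, a ≤ |t| → φ t = 0) → IsApprox (fun t => c • H t) p 1 0 φ := fun p hp φ hφ a h0 =>
    hU.isApprox_of_continuous hp (fun d θ θ' hθ x => by
      simpa using hU.isApprox_smul (κ := 1) (μ := 0) hθ x hp (Or.inr rfl)) hφ h0
  have hres : ∀ t, ∃ D : X →L[ℂ] X, IsResolvent (c • H t) ((2 : ℝ) : ℂ) D ∧ ‖D‖ ≤ (2 : ℝ)⁻¹ :=
    fun t => by
      obtain ⟨β, R, h⟩ := hH.exists_isPosResolvent t
      exact h.exists_isResolvent hc two_pos
  choose D hD hDl using hres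
  refine ⟨hH.isGenerator hc, 1, 1, one_pos, one_pos, isKatoStable_smul hc hH.exists_isPosResolvent,
    ⟨2, one_lt_two, ⟨D, hD, hH.continuous_resolvent hD hDl⟩, fun φ hφ ε hε => ?_⟩,
    fun φ hφ ε hε => ?_, fun φ ε hε => exists_regular_near_zeroAtInfty (hbase ∞ le_top) φ hε⟩
  · simpa using h2 φ hφ ε hε
  · simpa using IsApprox.of_memLp (hbase 2 one_le_two) hφ ε hε

theorem SmoothFamily.adjoint_smul {H : ℝ → X →ₗ.[ℂ] X} (hH : SmoothFamily H) (t : ℝ) :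
    ((-Complex.I) • H t).adjoint = Complex.I • H t := by
  obtain ⟨β, R, h⟩ := hH.exists_isPosResolvent t
  rw [h.adjoint_smul (by simp)]
  simp

/-- The abstract theorem on the Schrödinger equation for a smooth family of operators. -/
theorem SmoothFamily.main {H : ℝ → X →ₗ.[ℂ] X} (hH : SmoothFamily H) :
    EvolutionConditions (fun t => (-Complex.I) • H t) ∧
    EvolutionConditions (fun t => ((-Complex.I) • H t).adjoint) ∧
    BackwardEvolutionConditions (fun t => ((-Complex.I) • H t).adjoint) ∧
    ∃ U : ℝ → ℝ → X →L[ℂ] X, IsUnitaryPropagator U ∧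
      ∀ (s : ℝ) (x : X),
        (IsMildSolution (fun t => (-Complex.I) • H t) s x (fun t => U t s x) ∧
          ∀ u : ℝ → X, IsMildSolution (fun t => (-Complex.I) • H t) s x u →
            u = fun t => U t s x) ∧
        (IsWeakSolution (fun t => (-Complex.I) • H t) s x (fun t => U t s x) ∧
          ∀ u : ℝ → X, IsWeakSolution (fun t => (-Complex.I) • H t) s x u →
            u = fun t => U t s x) := by
  have hA := hH.isSkewAdjointFamily (c := -Complex.I) (Or.inr rfl)
  obtain ⟨U, hU⟩ := hH.exists_isMildPropagator (c := -Complex.I) (Or.inr rfl)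
  refine ⟨hH.evolutionConditions (Or.inr rfl), ?_, ?_, U, hU.isUnitary, fun s x =>
    ⟨⟨hU.isMildSolution s x, fun u hu => hU.eq_of_isMildSolution hA hu⟩,
      hU.isWeakSolution hA s x, fun u hu => hU.eq_of_isWeakSolution hA hu⟩⟩
  · simp only [hH.adjoint_smul]
    exact hH.evolutionConditions (Or.inl rfl)
  · simp only [hH.adjoint_smul]
    exact hH.comp_neg.evolutionConditions (Or.inl rfl)

end RollnikSchroedinger

/-! ### Sohr's hypotheses. -/

namespace RollnikSchroedinger

variable {X : Type*} [NormedAddCommGroup X] [InnerProductSpace ℂ X] [CompleteSpace X]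

theorem mem_neg_graph {T : X →ₗ.[ℂ] X} {u y : X} : (u, y) ∈ (-T).graph ↔ (u, -y) ∈ T.graph := by
  rw [LinearPMap.neg_graph]
  constructor
  · rintro ⟨⟨p, q⟩, hp, e⟩
    have e1 : p = u := congrArg Prod.fst e
    have e2 : -q = y := congrArg Prod.snd e
    rw [← e1, ← e2, neg_neg]
    exact hp
  · intro h
    exact ⟨(u, -y), h, by ext <;> simp⟩

theorem IsPosResolvent.isResolvent_neg {T : X →ₗ.[ℂ] X} {β : ℝ} {R : X →L[ℂ] X}
    (h : IsPosResolvent T β R) : IsResolvent (-T) (β : ℂ) R := by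
  refine isResolvent_iff_graph.2 ⟨fun x => ?_, fun u y huy => ?_⟩
  · rw [mem_neg_graph, neg_sub]
    exact h.mem_graph x
  · have := (h.mem_graph_iff _ _).1 (mem_neg_graph.1 huy)
    rwa [neg_add_eq_sub] at this

theorem IsPosResolvent.le_re_inner {T : X →ₗ.[ℂ] X} {β : ℝ} {R : X →L[ℂ] X}
    (h : IsPosResolvent T β R) (u : T.domain) :
    (1 - β) * ‖(u : X)‖ ^ 2 ≤ (⟪(u : X), T u⟫_ℂ).re := by
  have h1 := (h.mem_graph_iff _ _).1 (T.mem_graph u)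
  have h2 := h.norm_sq_le (T u + (β : ℂ) • (u : X))
  rw [h1, inner_add_left, inner_smul_left, Complex.add_re, Complex.conj_ofReal,
    Complex.re_ofReal_mul, ← inner_conj_symm, Complex.conj_re] at h2
  have h3 : (⟪(u : X), (u : X)⟫_ℂ).re = ‖(u : X)‖ ^ 2 := inner_self_eq_norm_sq (𝕜 := ℂ) _
  rw [h3] at h2
  linarith

/-- The form bound with `x = y` reads `|⟨x, R'x⟩| ≤ C ⟨x, R x⟩`, so `k = C` is enough. Working on
the radius `r + 1` puts the closed interval inside an open one where two-sided derivatives exist. -/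
theorem SmoothFamily.sohrHypotheses {H : ℝ → X →ₗ.[ℂ] X} (hH : SmoothFamily H) :
    SohrHypotheses H := by
  refine ⟨fun t => ?_, fun r hr => ?_⟩
  · obtain ⟨β, R, h⟩ := hH.exists_isPosResolvent t
    exact h.isSelfAdjoint
  obtain ⟨β, C, R, R', h⟩ := hH (r + 1) (by linarith)
  have hsub : Icc (-r) r ⊆ Ioo (-(r + 1)) (r + 1) := fun t ht =>
    ⟨by linarith [ht.1], by linarith [ht.2]⟩
  have hd : ∀ x y : X, ∀ t ∈ Ioo (-(r + 1)) (r + 1),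
      HasDerivAt (fun τ => ⟪x, R τ y⟫_ℂ) ⟪x, R' t y⟫_ℂ t := fun x y t ht => by
    simpa using (hasDerivAt_const t x).inner ℂ (h.hasDerivAt t ht y)
  refine ⟨β, C, h.beta_pos, h.const_pos,
    fun t ht u => (h.isPosResolvent (hsub ht)).le_re_inner u, R,
    fun t ht => (h.isPosResolvent (hsub ht)).isResolvent_neg, fun x y => ?_, fun x t ht => ?_⟩
  · refine ContDiffOn.mono ?_ hsub
    rw [show (1 : WithTop ℕ∞) = 0 + 1 by simp, contDiffOn_succ_iff_deriv_of_isOpen isOpen_Ioo]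
    refine ⟨fun t ht => (hd x y t ht).differentiableAt.differentiableWithinAt, by simp, ?_⟩
    rw [contDiffOn_zero]
    exact (continuousOn_const.inner (h.continuousOn_deriv y)).congr fun t ht => (hd x y t ht).deriv
  · have h1 : HasDerivAt (fun τ => (⟪x, R τ x⟫_ℂ).re) (⟪x, R' t x⟫_ℂ).re t :=
      (Complex.reCLM.hasFDerivAt.comp_hasDerivAt t (hd x x t (hsub ht)))
    rw [h1.hasDerivWithinAt.derivWithin (uniqueDiffOn_Icc (by linarith) t ht)]
    have h2 := h.norm_inner_deriv_le t (hsub ht) x x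
    have h0 := re_inner_nonneg_of_isPositive (h.isPositive t (hsub ht)) x
    rw [Real.mul_self_sqrt h0] at h2
    have h3 := (abs_le.1 ((Complex.abs_re_le_norm _).trans h2)).1
    nlinarith [mul_nonneg h.const_pos.le h0]

end RollnikSchroedinger

/-! ### From forms with a fixed domain to smooth resolvent families. -/

namespace RollnikSchroedinger

variable {X Q Y : Type*} [NormedAddCommGroup X] [InnerProductSpace ℂ X] [CompleteSpace X]
  [NormedAddCommGroup Q] [InnerProductSpace ℂ Q] [CompleteSpace Q]
  [NormedAddCommGroup Y] [InnerProductSpace ℂ Y] [CompleteSpace Y]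

/-- The operator `1 + (β - 1) J* J + S* M S` representing a form on the form domain `Q`. -/
noncomputable def formOp (J : Q →L[ℂ] X) (S : Q →L[ℂ] Y) (M : Y →L[ℂ] Y) (β : ℝ) : Q →L[ℂ] Q :=
  1 + ((β - 1 : ℝ) : ℂ) • (J.adjoint ∘L J) + S.adjoint ∘L M ∘L S

section FormOp

variable {J : Q →L[ℂ] X} {S : Q →L[ℂ] Y} {M : Y →L[ℂ] Y} {b : ℝ}

theorem formOp_apply (β : ℝ) (q : Q) : formOp J S M β q =
    q + ((β - 1 : ℝ) : ℂ) • J.adjoint (J q) + S.adjoint (M (S q)) := rfl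

theorem inner_formOp (β : ℝ) (w q : Q) : ⟪w, formOp J S M β q⟫_ℂ =
    ⟪w, q⟫_ℂ + ((β - 1 : ℝ) : ℂ) * ⟪J w, J q⟫_ℂ + ⟪S w, M (S q)⟫_ℂ := by
  rw [formOp_apply, inner_add_right, inner_add_right, inner_smul_right,
    ContinuousLinearMap.adjoint_inner_right, ContinuousLinearMap.adjoint_inner_right]

theorem formOp_symm (hM : ∀ y z, ⟪M y, z⟫_ℂ = ⟪y, M z⟫_ℂ) (β : ℝ) (w q : Q) :
    ⟪formOp J S M β w, q⟫_ℂ = ⟪w, formOp J S M β q⟫_ℂ := by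
  rw [← inner_conj_symm, inner_formOp, inner_formOp]
  simp only [map_add, map_mul, inner_conj_symm, Complex.conj_ofReal]
  rw [hM]

/-- The norm of `Q` contains `‖J q‖²`, which is why the form of `β + H` has coefficient `β - 1`. For
`β = b + 2` the bound on `S` uses up half of `‖q‖²` and `b ‖J q‖²`, leaving coefficient exactly 1 at
`‖J q‖²`; this is `β + H ≥ 1`. -/
theorem le_re_inner_formOp (hM : ‖M‖ ≤ 1)
    (hS : ∀ q, ‖S q‖ ^ 2 ≤ 1 / 2 * ‖q‖ ^ 2 + b * ‖J q‖ ^ 2) (q : Q) :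
    1 / 2 * ‖q‖ ^ 2 + ‖J q‖ ^ 2 ≤ (⟪q, formOp J S M (b + 2) q⟫_ℂ).re := by
  rw [inner_formOp, Complex.add_re, Complex.add_re, Complex.re_ofReal_mul]
  have h1 : (⟪q, q⟫_ℂ).re = ‖q‖ ^ 2 := inner_self_eq_norm_sq (𝕜 := ℂ) _
  have h2 : (⟪J q, J q⟫_ℂ).re = ‖J q‖ ^ 2 := inner_self_eq_norm_sq (𝕜 := ℂ) _
  have h3 : |(⟪S q, M (S q)⟫_ℂ).re| ≤ ‖S q‖ ^ 2 := by
    refine (Complex.abs_re_le_norm _).trans ((norm_inner_le_norm _ _).trans ?_)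
    have := M.le_of_opNorm_le hM (S q)
    nlinarith [norm_nonneg (S q)]
  rw [h1, h2]
  have := (abs_le.1 h3).1
  have := hS q
  linarith

variable (hM : ‖M‖ ≤ 1) (hS : ∀ q, ‖S q‖ ^ 2 ≤ 1 / 2 * ‖q‖ ^ 2 + b * ‖J q‖ ^ 2)
include hM hS

theorem isUnit_formOp : IsUnit (formOp J S M (b + 2)) := by
  have h0 : (0 : ℝ) < 1 / 2 := by norm_num
  refine ContinuousLinearMap.isUnit_of_forall_le_norm_inner_map _ (c := ⟨1 / 2, h0.le⟩) h0
    fun q => ?_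
  have h1 := le_re_inner_formOp hM hS q
  have h2 := Complex.re_le_norm (⟪q, formOp J S M (b + 2) q⟫_ℂ)
  rw [norm_inner_symm]
  change ‖q‖ ^ 2 * (1 / 2) ≤ _
  nlinarith [sq_nonneg ‖J q‖]

theorem formOp_inverse_apply (q : Q) :
    formOp J S M (b + 2) (Ring.inverse (formOp J S M (b + 2)) q) = q :=
  congrArg (fun T : Q →L[ℂ] Q => T q) (Ring.mul_inverse_cancel _ (isUnit_formOp hM hS))

theorem inverse_formOp_apply (q : Q) :
    Ring.inverse (formOp J S M (b + 2)) (formOp J S M (b + 2) q) = q :=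
  congrArg (fun T : Q →L[ℂ] Q => T q) (Ring.inverse_mul_cancel _ (isUnit_formOp hM hS))

theorem norm_inverse_formOp_le : ‖Ring.inverse (formOp J S M (b + 2))‖ ≤ 2 := by
  refine ContinuousLinearMap.opNorm_le_bound _ zero_le_two fun q => ?_
  set w := Ring.inverse (formOp J S M (b + 2)) q with hw
  have h1 := le_re_inner_formOp hM hS w
  rw [hw, formOp_inverse_apply hM hS, ← hw] at h1
  have h2 := (Complex.re_le_norm _).trans (norm_inner_le_norm (𝕜 := ℂ) w q)
  rcases (norm_nonneg w).eq_or_lt with h | h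
  · rw [← h]; positivity
  · refine le_of_mul_le_mul_right ?_ h
    nlinarith [sq_nonneg ‖J w‖]

end FormOp

/-- The resolvent factors as `J D J*` with `D = B⁻¹` bounded on the form domain, so it is
differentiable as soon as the form is, however `D(H t)` moves. Its derivative `-J D S* M' S D J*` is
sandwiched between two factors `S D J*`, each controlled by the energy `⟨x, R x⟩`. -/
theorem isSmoothResolvent_of_form {H : ℝ → X →ₗ.[ℂ] X} {I : Set ℝ} (hI : IsOpen I)
    {J : Q →L[ℂ] X} {S : Q →L[ℂ] Y} {M M' : ℝ → Y →L[ℂ] Y} {b : ℝ} (hb : 0 ≤ b)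
    (hM : ∀ t ∈ I, ‖M t‖ ≤ 1) (hM' : ∀ t ∈ I, ‖M' t‖ ≤ 1)
    (hsymm : ∀ t ∈ I, ∀ y z, ⟪M t y, z⟫_ℂ = ⟪y, M t z⟫_ℂ)
    (hderiv : ∀ t ∈ I, ∀ y, HasDerivAt (fun τ => M τ y) (M' t y) t)
    (hcont : ∀ y, ContinuousOn (fun τ => M' τ y) I)
    (hS : ∀ q, ‖S q‖ ^ 2 ≤ 1 / 2 * ‖q‖ ^ 2 + b * ‖J q‖ ^ 2)
    (hgraph : ∀ t ∈ I, ∀ u f, (u, f) ∈ (H t).graph ↔ ∃ q, J q = u ∧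
      ∀ w, ⟪w, q⟫_ℂ - ⟪J w, J q⟫_ℂ + ⟪S w, M t (S q)⟫_ℂ = ⟪J w, f⟫_ℂ) :
    ∃ β C R R', IsSmoothResolvent H I β C R R' := by
  set B : ℝ → Q →L[ℂ] Q := fun t => formOp J S (M t) (b + 2) with hB
  set D : ℝ → Q →L[ℂ] Q := fun t => Ring.inverse (B t) with hD
  set P : ℝ → Q →L[ℂ] Q := fun t => S.adjoint ∘L M' t ∘L S with hP
  have hBD : ∀ t ∈ I, ∀ q, B t (D t q) = q := fun t ht => formOp_inverse_apply (hM t ht) hS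
  have hDB : ∀ t ∈ I, ∀ q, D t (B t q) = q := fun t ht => inverse_formOp_apply (hM t ht) hS
  have hDn : ∀ t ∈ I, ‖D t‖ ≤ 2 := fun t ht => norm_inverse_formOp_le (hM t ht) hS
  have hBs : ∀ t ∈ I, ∀ w q, ⟪B t w, q⟫_ℂ = ⟪w, B t q⟫_ℂ := fun t ht => formOp_symm (hsymm t ht) _
  have hR : ∀ t ∈ I, ∀ x y, ⟪x, J (D t (J.adjoint y))⟫_ℂ =
      ⟪D t (J.adjoint x), B t (D t (J.adjoint y))⟫_ℂ := fun t ht x y => by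
    rw [← hBs t ht, hBD t ht, ContinuousLinearMap.adjoint_inner_left]
  have hDs : ∀ t ∈ I, ∀ w q, ⟪D t w, q⟫_ℂ = ⟪w, D t q⟫_ℂ := fun t ht w q => by
    rw [← hBD t ht q, ← hBs t ht, hBD t ht, hBD t ht]
  have hlow : ∀ t ∈ I, ∀ q, 1 / 2 * ‖q‖ ^ 2 + ‖J q‖ ^ 2 ≤ (⟪q, B t q⟫_ℂ).re := fun t ht =>
    le_re_inner_formOp (hM t ht) hS
  have hBd : ∀ t ∈ I, ∀ q, HasDerivAt (fun τ => B τ q) (P t q) t := fun t ht q =>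
    ((S.adjoint.restrictScalars ℝ).hasFDerivAt.comp_hasDerivAt t
      (hderiv t ht (S q))).const_add _
  have hDd : ∀ t ∈ I, ∀ q, HasDerivAt (fun τ => D τ q) (-D t (P t (D t q))) t := fun t ht q => by
    have hIt : ∀ᶠ τ in 𝓝 t, τ ∈ I := hI.mem_nhds ht
    exact hasDerivAt_strong_inverse (B' := fun q => P t q) (hIt.mono hDn) (hBd t ht)
      (hIt.mono hDB) (hBD t ht) q
  have hDc : ∀ q, ContinuousOn (fun τ => D τ q) I := fun q t ht =>
    (hDd t ht q).continuousAt.continuousWithinAt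
  -- For `q = D J* x` the energy `⟨x, R x⟩` equals `⟨q, B q⟩`, which dominates `‖q‖²/2 + ‖J q‖²`.
  -- Two factors `√(1 + b)` yield the constant `C = 1 + b`.
  have hSq : ∀ t ∈ I, ∀ x, ‖S (D t (J.adjoint x))‖ ≤
      √(1 + b) * √(⟪x, J (D t (J.adjoint x))⟫_ℂ).re := fun t ht x => by
    rw [← Real.sqrt_mul (by positivity)]
    refine Real.le_sqrt_of_sq_le ((hS _).trans ?_)
    have := hlow t ht (D t (J.adjoint x))
    rw [← hR t ht] at this
    nlinarith [sq_nonneg ‖D t (J.adjoint x)‖, sq_nonneg ‖J (D t (J.adjoint x))‖,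
      mul_nonneg hb (sq_nonneg ‖D t (J.adjoint x)‖)]
  refine ⟨b + 2, 1 + b, fun t => J ∘L D t ∘L J.adjoint,
    fun t => -(J ∘L D t ∘L P t ∘L D t ∘L J.adjoint), hI, by positivity, by positivity,
    fun t ht => ?_, fun t ht x => ?_, fun t ht u f => ?_, fun t ht x => ?_, fun x => ?_,
    fun t ht x y => ?_⟩
  · refine (ContinuousLinearMap.isPositive_def).2 ⟨fun x y => ?_, fun x => ?_⟩
    · change ⟪J (D t (J.adjoint x)), y⟫_ℂ = ⟪x, J (D t (J.adjoint y))⟫_ℂ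
      rw [← ContinuousLinearMap.adjoint_inner_right, hDs t ht,
        ContinuousLinearMap.adjoint_inner_left]
    · change 0 ≤ (⟪J (D t (J.adjoint x)), x⟫_ℂ).re
      rw [← inner_conj_symm, Complex.conj_re, hR t ht]
      exact le_trans (by positivity) (hlow t ht _)
  · change ‖J (D t (J.adjoint x))‖ ^ 2 ≤ (⟪x, J (D t (J.adjoint x))⟫_ℂ).re
    rw [hR t ht]
    refine le_trans ?_ (hlow t ht _)
    have : 0 ≤ 1 / 2 * ‖D t (J.adjoint x)‖ ^ 2 := by positivity
    linarith
  · rw [hgraph t ht]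
    change _ ↔ J (D t (J.adjoint (f + ((b + 2 : ℝ) : ℂ) • u))) = u
    have key : ∀ q, J q = u → ((∀ w, ⟪w, q⟫_ℂ - ⟪J w, J q⟫_ℂ + ⟪S w, M t (S q)⟫_ℂ = ⟪J w, f⟫_ℂ) ↔
        B t q = J.adjoint (f + ((b + 2 : ℝ) : ℂ) • u)) := by
      intro q hq
      rw [← hq]
      constructor
      · intro h
        refine ext_inner_left ℂ fun w => ?_
        rw [hB, inner_formOp, ContinuousLinearMap.adjoint_inner_right, inner_add_right,
          inner_smul_right, ← h w]
        push_cast; ring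
      · intro h w
        have := congrArg (fun v => ⟪w, v⟫_ℂ) h
        simp only [hB] at this
        rw [inner_formOp, ContinuousLinearMap.adjoint_inner_right, inner_add_right,
          inner_smul_right] at this
        push_cast at this
        linear_combination this
    constructor
    · rintro ⟨q, hq, h⟩
      rw [← (key q hq).1 h, hDB t ht, hq]
    · intro h
      exact ⟨_, h, (key _ h).2 (hBD t ht _)⟩
  · have := (J.restrictScalars ℝ).hasFDerivAt.comp_hasDerivAt t (hDd t ht (J.adjoint x))
    refine this.congr_deriv ?_
    exact map_neg J _
  · have h1 : ContinuousOn (fun t => P t (D t (J.adjoint x))) I := by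
      refine S.adjoint.continuous.comp_continuousOn (ContinuousOn.strong_clm_apply hM' hcont ?_)
      exact S.continuous.comp_continuousOn (hDc _)
    exact (J.continuous.comp_continuousOn (ContinuousOn.strong_clm_apply hDn hDc h1)).neg
  · change ‖⟪x, -(J (D t (P t (D t (J.adjoint y)))))⟫_ℂ‖ ≤ _
    rw [inner_neg_right, norm_neg, ← ContinuousLinearMap.adjoint_inner_left, ← hDs t ht]
    change ‖⟪D t (J.adjoint x), S.adjoint (M' t (S (D t (J.adjoint y))))⟫_ℂ‖ ≤
      (1 + b) * (√(⟪x, J (D t (J.adjoint x))⟫_ℂ).re * √(⟪y, J (D t (J.adjoint y))⟫_ℂ).re)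
    rw [ContinuousLinearMap.adjoint_inner_right]
    refine (norm_inner_le_norm _ _).trans ?_
    have h1 := (M' t).le_of_opNorm_le (hM' t ht) (S (D t (J.adjoint y)))
    rw [one_mul] at h1
    calc _ ≤ (√(1 + b) * √(⟪x, J (D t (J.adjoint x))⟫_ℂ).re) *
          (√(1 + b) * √(⟪y, J (D t (J.adjoint y))⟫_ℂ).re) :=
          mul_le_mul (hSq t ht x) (h1.trans (hSq t ht y)) (norm_nonneg _) (by positivity)
      _ = (√(1 + b) * √(1 + b)) * (√(⟪x, J (D t (J.adjoint x))⟫_ℂ).re *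
          √(⟪y, J (D t (J.adjoint y))⟫_ℂ).re) := by ring
      _ = _ := by rw [Real.mul_self_sqrt (by positivity)]

end RollnikSchroedinger

/-! ### Fourier transform of `L²` functions and the Gaussian form of the Coulomb energy. -/

namespace RollnikSchroedinger

section Fourier

open scoped FourierTransform

theorem ae_eq_of_forall_schwartz {f f' : R3 → ℂ} (hf : LocallyIntegrable f volume)
    (hf' : LocallyIntegrable f' volume)
    (h : ∀ φ : 𝓢(R3, ℂ), ∫ x, φ x • f x = ∫ x, φ x • f' x) : f =ᵐ[volume] f' := by
  refine ae_eq_of_integral_contDiff_smul_eq hf hf' fun g g_smooth g_cpt => ?_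
  have hg₁ : HasCompactSupport (Complex.ofRealCLM ∘ g) := g_cpt.comp_left rfl
  have hg₂ : ContDiff ℝ ((⊤ : ℕ∞) : WithTop ℕ∞) (Complex.ofRealCLM ∘ g) :=
    Complex.ofRealCLM.contDiff.comp g_smooth
  simpa using h (hg₁.toSchwartzMap hg₂)

theorem fourier_toTemperedDistribution_apply (f : L2) (φ : 𝓢(R3, ℂ)) :
    ∫ x, φ x • (𝓕 f : L2) x = ∫ x, (𝓕 φ) x • f x := by
  have h := congrArg (fun T : 𝓢'(R3, ℂ) => T φ) (Lp.fourier_toTemperedDistribution_eq f)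
  simp only [TemperedDistribution.fourier_apply, Lp.toTemperedDistribution_apply] at h
  exact h.symm

/-- For square integrable functions that are integrable, the Fourier transform on `L²` is given by
the Fourier integral. -/
theorem fourier_coeFn_ae (f : L2) (hf : Integrable f volume) :
    (𝓕 f : L2) =ᵐ[volume] 𝓕 (f : R3 → ℂ) := by
  have hc : Continuous (𝓕 (f : R3 → ℂ)) :=
    VectorFourier.fourierIntegral_continuous Real.continuous_fourierChar
      (by exact continuous_inner) hf
  refine ae_eq_of_forall_schwartz ((Lp.memLp _).locallyIntegrable one_le_two)
    hc.locallyIntegrable fun φ => ?_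
  rw [fourier_toTemperedDistribution_apply]
  have := VectorFourier.integral_fourierIntegral_smul_eq_flip (L := innerₗ R3)
    Real.continuous_fourierChar continuous_inner φ.integrable hf (μ := volume) (ν := volume)
  rw [flip_innerₗ] at this
  exact this

theorem fourier_weakGradient_ae {u : L2} {g : Fin 3 → L2} (h : HasWeakGradient u g) (i : Fin 3) :
    (𝓕 (g i) : L2) =ᵐ[volume]
      fun ξ => (2 * Real.pi * Complex.I * (ξ i : ℂ)) * (𝓕 u : L2) ξ := by
  have hloc : LocallyIntegrable (𝓕 u : L2) volume := (Lp.memLp _).locallyIntegrable one_le_two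
  refine ae_eq_of_forall_schwartz ((Lp.memLp _).locallyIntegrable one_le_two) ?_ fun φ => ?_
  · have := hloc.continuous_smul (g := fun ξ : R3 => 2 * Real.pi * Complex.I * (ξ i : ℂ)) (by fun_prop)
    exact this
  · have h1 := congrArg (fun T : 𝓢'(R3, ℂ) => (𝓕 T) φ) (h i)
    simp only [TemperedDistribution.fourier_lineDerivOp_eq,
      Lp.fourier_toTemperedDistribution_eq] at h1
    have h2 : (2 * Real.pi * Complex.I) * ∫ ξ, (SchwartzMap.smulLeftCLM ℂ (fun ξ : R3 =>
        ((inner ℝ ξ (EuclideanSpace.single i (1 : ℝ)) : ℝ) : ℂ)) φ) ξ • (𝓕 u : L2) ξ =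
          ∫ ξ, φ ξ • (𝓕 (g i) : L2) ξ := by
      rw [← Lp.toTemperedDistribution_apply, ← Lp.toTemperedDistribution_apply]
      exact h1
    rw [← h2, ← integral_const_mul]
    refine integral_congr_ae (Eventually.of_forall fun ξ => ?_)
    simp only
    rw [SchwartzMap.smulLeftCLM_apply_apply (by fun_prop)]
    simp only [smul_eq_mul, EuclideanSpace.inner_single_right, conj_trivial, one_mul]
    ring

open Real in
/-- The heat kernel on `ℝ³`. -/
noncomputable def heatKernel (s : ℝ) (z : R3) : ℝ :=
  (4 * π * s) ^ (-(3 / 2) : ℝ) * exp (-‖z‖ ^ 2 / (4 * s))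

theorem heatKernel_nonneg {s : ℝ} (hs : 0 ≤ s) (z : R3) : 0 ≤ heatKernel s z := by
  unfold heatKernel; positivity

open Real in
theorem fourier_gaussian_eq_heatKernel {s : ℝ} (hs : 0 < s) (x y : R3) :
    𝓕 (fun ξ : R3 => Complex.exp (-((4 * π ^ 2 * s : ℝ) : ℂ) * ‖ξ‖ ^ 2 +
      2 * π * Complex.I * (inner ℝ x ξ : ℝ))) y = (heatKernel s (x - y) : ℂ) := by
  have hb : 0 < 4 * π ^ 2 * s := by positivity
  rw [fourier_gaussian_innerProductSpace' (by rwa [Complex.ofReal_re])]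
  have h1 : ((π : ℂ) / ((4 * π ^ 2 * s : ℝ) : ℂ)) ^ ((Module.finrank ℝ R3 : ℂ) / 2) =
      (((4 * π * s) ^ (-(3 / 2) : ℝ) : ℝ) : ℂ) := by
    rw [finrank_euclideanSpace_fin, ← Complex.ofReal_div,
      show ((3 : ℕ) : ℂ) / 2 = ((3 / 2 : ℝ) : ℂ) by push_cast; ring,
      ← Complex.ofReal_cpow (by positivity), Real.rpow_neg (by positivity),
      ← Real.inv_rpow (by positivity)]
    congr 3
    field_simp
  have h2 : Complex.exp (-(π : ℂ) ^ 2 * ‖x - y‖ ^ 2 / ((4 * π ^ 2 * s : ℝ) : ℂ)) =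
      ((exp (-‖x - y‖ ^ 2 / (4 * s)) : ℝ) : ℂ) := by
    rw [Complex.ofReal_exp]
    congr 1
    push_cast
    have : (π : ℂ) ≠ 0 := by exact_mod_cast pi_ne_zero
    have hs' : (s : ℂ) ≠ 0 := by exact_mod_cast hs.ne'
    field_simp
  rw [h1, h2, heatKernel, Complex.ofReal_mul]

theorem enorm_ofReal_complex (r : ℝ) : ‖(r : ℂ)‖ₑ = ‖r‖ₑ := by
  rw [← ofReal_norm, ← ofReal_norm, Complex.norm_real]

/-- Move one Fourier transform across the integral, twice. The Gaussian weight becomes the heat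
kernel, and the left side turns into `∬ h(x) conj h(y) heatKernel s (x - y)`, to which the triangle
inequality is applied. -/
theorem enorm_integral_gaussian_le {h : R3 → ℂ} (hh : Integrable h volume) {s : ℝ} (hs : 0 < s) :
    ∫⁻ ξ, ‖𝓕 h ξ‖ₑ ^ 2 * ENNReal.ofReal (Real.exp (-(4 * Real.pi ^ 2 * s) * ‖ξ‖ ^ 2)) ≤
      ∫⁻ x, ∫⁻ y, ‖h x‖ₑ * ‖h y‖ₑ * ENNReal.ofReal (heatKernel s (x - y)) := by
  have hb : 0 < 4 * Real.pi ^ 2 * s := by positivity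
  set e : R3 → ℝ := fun ξ => Real.exp (-(4 * Real.pi ^ 2 * s) * ‖ξ‖ ^ 2) with he
  have hec : Continuous e := by fun_prop
  have hei : Integrable (fun ξ => (e ξ : ℂ)) volume := by
    have := GaussianFourier.integrable_cexp_neg_mul_sq_norm_add (V := R3)
      (b := ((4 * Real.pi ^ 2 * s : ℝ) : ℂ)) (by rwa [Complex.ofReal_re]) 0 0
    refine this.congr (Eventually.of_forall fun ξ => ?_)
    simp [he]
  have hFc : Continuous (𝓕 h) :=
    VectorFourier.fourierIntegral_continuous Real.continuous_fourierChar
      (by exact continuous_inner) hh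
  have hFb : ∀ ξ, ‖𝓕 h ξ‖ ≤ ∫ x, ‖h x‖ := fun ξ =>
    VectorFourier.norm_fourierIntegral_le_integral_norm _ _ _ _ _
  have hGi : Integrable (fun ξ => conj (𝓕 h ξ) * (e ξ : ℂ)) volume :=
    hei.bdd_mul (Complex.continuous_conj.comp hFc).aestronglyMeasurable
      (Eventually.of_forall fun ξ => by simpa using hFb ξ)
  have hFG : ∀ x, ‖𝓕 (fun ξ => conj (𝓕 h ξ) * (e ξ : ℂ)) x‖ₑ ≤
      ∫⁻ y, ‖h y‖ₑ * ENNReal.ofReal (heatKernel s (x - y)) := by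
    intro x
    have hE : Integrable (fun ξ : R3 => Complex.exp (-((4 * Real.pi ^ 2 * s : ℝ) : ℂ) * ‖ξ‖ ^ 2 +
        2 * Real.pi * Complex.I * (inner ℝ x ξ : ℝ))) volume :=
      GaussianFourier.integrable_cexp_neg_mul_sq_norm_add (V := R3)
        (b := ((4 * Real.pi ^ 2 * s : ℝ) : ℂ)) (by rwa [Complex.ofReal_re]) _ x
    have h1 : 𝓕 (fun ξ => conj (𝓕 h ξ) * (e ξ : ℂ)) x =
        conj (∫ ξ, 𝓕 h ξ • Complex.exp (-((4 * Real.pi ^ 2 * s : ℝ) : ℂ) * ‖ξ‖ ^ 2 +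
        2 * Real.pi * Complex.I * (inner ℝ x ξ : ℝ))) := by
      rw [Real.fourier_eq', ← integral_conj]
      refine integral_congr_ae (Eventually.of_forall fun ξ => ?_)
      simp only [smul_eq_mul, map_mul, ← Complex.exp_conj, map_add, he, Complex.ofReal_exp]
      rw [mul_left_comm, ← Complex.exp_add]
      congr 2
      rw [real_inner_comm]
      simp only [map_neg, map_pow, Complex.conj_ofReal, Complex.conj_I, map_ofNat]
      push_cast
      ring
    have h2 := VectorFourier.integral_fourierIntegral_smul_eq_flip (L := innerₗ R3)
      Real.continuous_fourierChar continuous_inner hh hE (μ := volume) (ν := volume)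
    rw [flip_innerₗ] at h2
    have h3 : (∫ ξ, 𝓕 h ξ • Complex.exp (-((4 * Real.pi ^ 2 * s : ℝ) : ℂ) * ‖ξ‖ ^ 2 +
        2 * Real.pi * Complex.I * (inner ℝ x ξ : ℝ))) = ∫ y, h y • (heatKernel s (x - y) : ℂ) := by
      refine h2.trans (integral_congr_ae (Eventually.of_forall fun y => ?_))
      exact congrArg (h y • ·) (fourier_gaussian_eq_heatKernel hs x y)
    rw [h1, h3, RCLike.enorm_conj]
    refine (enorm_integral_le_lintegral_enorm _).trans (lintegral_mono fun y => ?_)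
    rw [enorm_smul, enorm_ofReal_complex, Real.enorm_of_nonneg (heatKernel_nonneg hs.le _)]
  have hflip := VectorFourier.integral_fourierIntegral_smul_eq_flip (L := innerₗ R3)
      Real.continuous_fourierChar continuous_inner hh hGi (μ := volume) (ν := volume)
  rw [flip_innerₗ] at hflip
  have hflip' : ∫ ξ, 𝓕 h ξ • (conj (𝓕 h ξ) * (e ξ : ℂ)) =
      ∫ x, h x • 𝓕 (fun ξ => conj (𝓕 h ξ) * (e ξ : ℂ)) x := hflip
  have hpt : ∀ ξ, 𝓕 h ξ • (conj (𝓕 h ξ) * (e ξ : ℂ)) = ((‖𝓕 h ξ‖ ^ 2 * e ξ : ℝ) : ℂ) := fun ξ => by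
    rw [smul_eq_mul, ← mul_assoc, Complex.mul_conj, Complex.normSq_eq_norm_sq]
    push_cast
    rfl
  have hint : Integrable (fun ξ => ‖𝓕 h ξ‖ ^ 2 * e ξ) volume := by
    have := (hGi.bdd_mul hFc.aestronglyMeasurable (Eventually.of_forall hFb)).re
    refine this.congr (Eventually.of_forall fun ξ => ?_)
    have := congrArg Complex.re (hpt ξ)
    rwa [Complex.ofReal_re] at this
  calc ∫⁻ ξ, ‖𝓕 h ξ‖ₑ ^ 2 * ENNReal.ofReal (e ξ)
      = ∫⁻ ξ, ENNReal.ofReal (‖𝓕 h ξ‖ ^ 2 * e ξ) := by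
        refine lintegral_congr fun ξ => ?_
        rw [ENNReal.ofReal_mul (by positivity), ENNReal.ofReal_pow (norm_nonneg _), ofReal_norm]
    _ = ENNReal.ofReal (∫ ξ, ‖𝓕 h ξ‖ ^ 2 * e ξ) :=
        (ofReal_integral_eq_lintegral_ofReal hint
          (Eventually.of_forall fun ξ => by simp only [he, Pi.zero_apply]; positivity)).symm
    _ ≤ ‖∫ ξ, 𝓕 h ξ • (conj (𝓕 h ξ) * (e ξ : ℂ))‖ₑ := by
        simp_rw [hpt]
        rw [integral_complex_ofReal, enorm_ofReal_complex]
        exact Real.ofReal_le_enorm _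
    _ ≤ ∫⁻ x, ‖h x • 𝓕 (fun ξ => conj (𝓕 h ξ) * (e ξ : ℂ)) x‖ₑ := by
        rw [hflip']
        exact enorm_integral_le_lintegral_enorm _
    _ ≤ ∫⁻ x, ∫⁻ y, ‖h x‖ₑ * ‖h y‖ₑ * ENNReal.ofReal (heatKernel s (x - y)) := by
        refine lintegral_mono fun x => ?_
        rw [enorm_smul]
        refine (mul_le_mul_right (hFG x) _).trans ?_
        rw [← lintegral_const_mul' _ _ enorm_ne_top]
        simp only [mul_assoc, le_refl]

end Fourier

end RollnikSchroedinger

/-! ### The Rollnik form bound. -/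

namespace RollnikSchroedinger

open scoped FourierTransform

theorem lintegral_exp_neg_mul_Ioi {a : ℝ} (ha : 0 < a) :
    ∫⁻ s in Ioi (0 : ℝ), ENNReal.ofReal (Real.exp (-a * s)) = ENNReal.ofReal (1 / a) := by
  rw [← ofReal_integral_eq_lintegral_ofReal (integrableOn_exp_mul_Ioi (neg_neg_of_pos ha) 0)
    (Eventually.of_forall fun s => (Real.exp_pos _).le), integral_exp_mul_Ioi (neg_neg_of_pos ha)]
  congr 1
  simp
  
theorem four_pi_mul_rpow_le {s : ℝ} (hs : 0 < s) :
    (4 * Real.pi * s) ^ (-(3 / 2) : ℝ) ≤ s ^ (-(3 / 2) : ℝ) := by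
  refine Real.rpow_le_rpow_of_nonpos hs ?_ (by norm_num)
  nlinarith [Real.pi_gt_three]

/-- The time integral of the heat kernel is dominated by the Newtonian potential. -/
theorem lintegral_heatKernel_le {z : R3} (hz : z ≠ 0) :
    ∫⁻ s in Ioi (0 : ℝ), ENNReal.ofReal (heatKernel s z) ≤ ENNReal.ofReal (24 / ‖z‖) := by
  have hr : 0 < ‖z‖ := norm_pos_iff.2 hz
  set r := ‖z‖ with hrdef
  have hr2 : 0 < r ^ 2 := by positivity
  -- The exact value is `1/(4π|z|)`; a cruder constant is enough. For `s ≤ r²` use `exp(-x) ≤ 2/x²`,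
  -- for `s > r²` drop the exponential. The two pieces `64/3` and `2` add up to less than 24.
  rw [← Ioc_union_Ioi_eq_Ioi hr2.le, lintegral_union measurableSet_Ioi (Ioc_disjoint_Ioi le_rfl)]
  have h1 : ∫⁻ s in Ioc 0 (r ^ 2), ENNReal.ofReal (heatKernel s z) ≤
      ENNReal.ofReal (64 / 3 / r) := by
    have hle : ∀ s ∈ Ioc 0 (r ^ 2), ENNReal.ofReal (heatKernel s z) ≤
        ENNReal.ofReal (32 / r ^ 4 * s ^ (1 / 2 : ℝ)) := by
      intro s hs
      refine ENNReal.ofReal_le_ofReal ?_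
      have hs0 : 0 < s := hs.1
      have hexp : Real.exp (-r ^ 2 / (4 * s)) ≤ 32 * s ^ 2 / r ^ 4 := by
        have h := Real.quadratic_le_exp_of_nonneg (x := r ^ 2 / (4 * s)) (by positivity)
        rw [neg_div, Real.exp_neg, inv_le_comm₀ (Real.exp_pos _) (by positivity)]
        have h' : (32 * s ^ 2 / r ^ 4)⁻¹ = (r ^ 2 / (4 * s)) ^ 2 / 2 := by
          field_simp; norm_num
        have : 0 ≤ r ^ 2 / (4 * s) := by positivity
        linarith
      calc heatKernel s z ≤ s ^ (-(3 / 2) : ℝ) * (32 * s ^ 2 / r ^ 4) :=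
            mul_le_mul (four_pi_mul_rpow_le hs0) hexp (Real.exp_pos _).le (by positivity)
        _ = 32 / r ^ 4 * (s ^ (-(3 / 2) : ℝ) * s ^ (2 : ℝ)) := by
            rw [Real.rpow_two]; ring
        _ = 32 / r ^ 4 * s ^ (1 / 2 : ℝ) := by
            rw [← Real.rpow_add hs0]; norm_num
    have hint : IntervalIntegrable (fun s : ℝ => s ^ (1 / 2 : ℝ)) volume 0 (r ^ 2) :=
      intervalIntegral.intervalIntegrable_rpow' (by norm_num)
    have hint' : IntegrableOn (fun s : ℝ => 32 / r ^ 4 * s ^ (1 / 2 : ℝ)) (Ioc 0 (r ^ 2)) volume :=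
      ((intervalIntegrable_iff_integrableOn_Ioc_of_le hr2.le).1 hint).const_mul _
    refine (setLIntegral_mono' measurableSet_Ioc hle).trans ?_
    rw [← ofReal_integral_eq_lintegral_ofReal hint' ((ae_restrict_iff' measurableSet_Ioc).2
      (Eventually.of_forall fun s hs => by have := hs.1; simp only [Pi.zero_apply]; positivity)),
      integral_const_mul, ← intervalIntegral.integral_of_le hr2.le,
      integral_rpow (Or.inl (by norm_num))]
    refine ENNReal.ofReal_le_ofReal (le_of_eq ?_)
    have : (r ^ 2) ^ (1 / 2 + 1 : ℝ) = r ^ 3 := by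
      rw [← Real.rpow_natCast r 2, ← Real.rpow_natCast r 3, ← Real.rpow_mul hr.le]
      norm_num
    rw [this, Real.zero_rpow (by norm_num)]
    field_simp
    norm_num
    ring
  have h2 : ∫⁻ s in Ioi (r ^ 2), ENNReal.ofReal (heatKernel s z) ≤ ENNReal.ofReal (2 / r) := by
    have hle : ∀ s ∈ Ioi (r ^ 2), ENNReal.ofReal (heatKernel s z) ≤
        ENNReal.ofReal (s ^ (-(3 / 2) : ℝ)) := by
      intro s hs
      have hs0 : 0 < s := hr2.trans hs
      refine ENNReal.ofReal_le_ofReal ?_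
      have : Real.exp (-r ^ 2 / (4 * s)) ≤ 1 := by
        rw [Real.exp_le_one_iff, neg_div]
        have : 0 ≤ r ^ 2 / (4 * s) := by positivity
        linarith
      calc heatKernel s z ≤ s ^ (-(3 / 2) : ℝ) * 1 :=
            mul_le_mul (four_pi_mul_rpow_le hs0) this (Real.exp_pos _).le (by positivity)
        _ = _ := mul_one _
    refine (setLIntegral_mono' measurableSet_Ioi hle).trans ?_
    rw [← ofReal_integral_eq_lintegral_ofReal (integrableOn_Ioi_rpow_of_lt (by norm_num) hr2)
      ((ae_restrict_iff' measurableSet_Ioi).2 (Eventually.of_forall fun s hs => by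
        have : 0 < s := hr2.trans hs
        simp only [Pi.zero_apply]; positivity)), integral_Ioi_rpow_of_lt (by norm_num) hr2]
    refine ENNReal.ofReal_le_ofReal (le_of_eq ?_)
    have : (r ^ 2) ^ (-(3 / 2) + 1 : ℝ) = r⁻¹ := by
      rw [← Real.rpow_natCast r 2, ← Real.rpow_mul hr.le, ← Real.rpow_neg_one]
      norm_num
    rw [this]
    field_simp
    norm_num
  refine (add_le_add h1 h2).trans ?_
  rw [← ENNReal.ofReal_add (by positivity) (by positivity)]
  refine ENNReal.ofReal_le_ofReal ?_
  rw [← add_div]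
  gcongr
  norm_num

theorem measurable_heatKernel : Measurable fun p : ℝ × R3 => heatKernel p.1 p.2 := by
  unfold heatKernel
  fun_prop

/-- The energy of a charge density in momentum space is dominated by its Coulomb energy. -/
theorem lintegral_fourier_div_le {h : R3 → ℂ} (hm : Measurable h) (hh : Integrable h volume) :
    ∫⁻ ξ, ‖𝓕 h ξ‖ₑ ^ 2 * ENNReal.ofReal (1 / (4 * Real.pi ^ 2 * ‖ξ‖ ^ 2)) ≤
      ∫⁻ x, ∫⁻ y, ‖h x‖ₑ * ‖h y‖ₑ * ENNReal.ofReal (24 / ‖x - y‖) := by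
  have hFc : Continuous (𝓕 h) :=
    VectorFourier.fourierIntegral_continuous Real.continuous_fourierChar
      (by exact continuous_inner) hh
  calc ∫⁻ ξ, ‖𝓕 h ξ‖ₑ ^ 2 * ENNReal.ofReal (1 / (4 * Real.pi ^ 2 * ‖ξ‖ ^ 2))
      ≤ ∫⁻ ξ, ∫⁻ s in Ioi (0 : ℝ), ‖𝓕 h ξ‖ₑ ^ 2 *
          ENNReal.ofReal (Real.exp (-(4 * Real.pi ^ 2 * s) * ‖ξ‖ ^ 2)) := by
        refine lintegral_mono fun ξ => ?_
        rw [lintegral_const_mul _ (by fun_prop)]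
        refine mul_le_mul_right ?_ _
        -- At `ξ = 0` the quotient `1/0` is 0 by convention while the time integral is infinite, so
        -- only an inequality holds pointwise.
        rcases eq_or_ne ξ 0 with rfl | hξ
        · simp
        · have : 0 < ‖ξ‖ := norm_pos_iff.2 hξ
          rw [← lintegral_exp_neg_mul_Ioi (by positivity)]
          refine le_of_eq (lintegral_congr fun s => ?_)
          congr 2
          ring
    _ = ∫⁻ s in Ioi (0 : ℝ), ∫⁻ ξ, ‖𝓕 h ξ‖ₑ ^ 2 *
          ENNReal.ofReal (Real.exp (-(4 * Real.pi ^ 2 * s) * ‖ξ‖ ^ 2)) := by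
        refine lintegral_lintegral_swap (Measurable.aemeasurable ?_)
        have := hFc.measurable
        simp only [Function.uncurry_def]
        fun_prop
    _ ≤ ∫⁻ s in Ioi (0 : ℝ), ∫⁻ x, ∫⁻ y,
          ‖h x‖ₑ * ‖h y‖ₑ * ENNReal.ofReal (heatKernel s (x - y)) :=
        setLIntegral_mono' measurableSet_Ioi fun s hs => enorm_integral_gaussian_le hh hs
    _ = ∫⁻ x, ∫⁻ y, ∫⁻ s in Ioi (0 : ℝ),
          ‖h x‖ₑ * ‖h y‖ₑ * ENNReal.ofReal (heatKernel s (x - y)) := by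
        have hk : Measurable fun p : (ℝ × R3) × R3 => heatKernel p.1.1 (p.1.2 - p.2) :=
          measurable_heatKernel.comp (by fun_prop : Measurable fun p : (ℝ × R3) × R3 =>
            (p.1.1, p.1.2 - p.2))
        have hk' : Measurable fun p : (ℝ × R3) × R3 =>
            ‖h p.1.2‖ₑ * ‖h p.2‖ₑ * ENNReal.ofReal (heatKernel p.1.1 (p.1.2 - p.2)) := by
          fun_prop
        rw [lintegral_lintegral_swap (Measurable.aemeasurable hk'.lintegral_prod_right')]
        refine lintegral_congr fun x => lintegral_lintegral_swap (Measurable.aemeasurable ?_)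
        exact hk'.comp (by fun_prop : Measurable fun p : ℝ × R3 => ((p.1, x), p.2))
    _ ≤ _ := by
        refine lintegral_mono fun x => lintegral_mono_ae ?_
        -- On the diagonal `24 / ‖x - y‖` is 0 by convention and the bound on the heat kernel fails;
        -- the diagonal is a null set.
        filter_upwards [volume.ae_ne x] with y hy
        rw [lintegral_const_mul' _ _ (ENNReal.mul_ne_top enorm_ne_top enorm_ne_top)]
        exact mul_le_mul_right (lintegral_heatKernel_le (sub_ne_zero.2 hy.symm)) _

theorem sq_lintegral_mul_le {α : Type*} [MeasurableSpace α] (μ : Measure α) {f g : α → ℝ≥0∞}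
    (hf : AEMeasurable f μ) (hg : AEMeasurable g μ) :
    (∫⁻ a, f a * g a ∂μ) ^ 2 ≤ (∫⁻ a, f a ^ 2 ∂μ) * ∫⁻ a, g a ^ 2 ∂μ := by
  have h := ENNReal.lintegral_mul_le_Lp_mul_Lq μ Real.HolderConjugate.two_two hf hg
  simp only [Pi.mul_apply, ENNReal.rpow_two] at h
  refine (pow_le_pow_left₀ zero_le h 2).trans (le_of_eq ?_)
  rw [mul_pow, ← ENNReal.rpow_two, ← ENNReal.rpow_two, ← ENNReal.rpow_mul, ← ENNReal.rpow_mul]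
  norm_num

theorem lintegral_enorm_sq (f : L2) : ∫⁻ x, ‖f x‖ₑ ^ 2 = ‖f‖ₑ ^ 2 := by
  rw [Lp.enorm_def, eLpNorm_eq_lintegral_rpow_enorm_toReal two_ne_zero ENNReal.ofNat_ne_top]
  simp only [ENNReal.toReal_ofNat, ENNReal.rpow_two]
  rw [← ENNReal.rpow_two, ← ENNReal.rpow_mul]
  norm_num

theorem lintegral_fourier_mul_le {u : L2} {g : Fin 3 → L2} (hg : HasWeakGradient u g) :
    ∫⁻ ξ, (‖(𝓕 u : L2) ξ‖ₑ * ENNReal.ofReal (2 * Real.pi * ‖ξ‖)) ^ 2 = ∑ i, ‖g i‖ₑ ^ 2 := by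
  have h1 : ∀ i, ‖g i‖ₑ ^ 2 = ∫⁻ ξ, ‖(𝓕 (g i) : L2) ξ‖ₑ ^ 2 := fun i => by
    rw [lintegral_enorm_sq, ← ofReal_norm, ← ofReal_norm, Lp.norm_fourier_eq]
  simp_rw [h1]
  rw [← lintegral_finsetSum' _ fun i _ => by
    exact ((Lp.aestronglyMeasurable (𝓕 (g i) : L2)).enorm.pow_const 2)]
  refine lintegral_congr_ae ?_
  filter_upwards [ae_all_iff.2 (fourier_weakGradient_ae hg)] with ξ hξ
  simp only [hξ, enorm_mul, mul_pow]
  rw [← Finset.sum_mul, mul_comm]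
  congr 1
  have : ∀ i : Fin 3, (‖(2 : ℂ)‖ₑ ^ 2 * ‖(Real.pi : ℂ)‖ₑ ^ 2 * ‖Complex.I‖ₑ ^ 2 *
      ‖((ξ i : ℝ) : ℂ)‖ₑ ^ 2) = ENNReal.ofReal ((2 * Real.pi) ^ 2 * (ξ i) ^ 2) := fun i => by
    simp only [← ofReal_norm, Complex.norm_real, Complex.norm_I]
    rw [← ENNReal.ofReal_pow (by positivity), ← ENNReal.ofReal_pow (by positivity),
      ← ENNReal.ofReal_pow (by positivity), ← ENNReal.ofReal_pow (by positivity),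
      ← ENNReal.ofReal_mul (by positivity), ← ENNReal.ofReal_mul (by positivity),
      ← ENNReal.ofReal_mul (by positivity)]
    congr 1
    simp
    left
    ring
  simp_rw [this]
  rw [← ENNReal.ofReal_sum_of_nonneg (fun i _ => by positivity), ← Finset.mul_sum,
    ← ENNReal.ofReal_pow (by positivity), mul_pow _ ‖ξ‖, EuclideanSpace.norm_sq_eq]
  simp

/-- The form bound for bounded potentials of bounded support. -/
theorem sq_lintegral_mul_le_of_bounded {w : R3 → ℝ} (hw : Measurable w) (hw0 : ∀ x, 0 ≤ w x)
    {m : ℝ} (hwm : ∀ x, w x ≤ m) (hsupp : ∀ x, m < ‖x‖ → w x = 0) {u : L2} {g : Fin 3 → L2}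
    (hg : HasWeakGradient u g) :
    (∫⁻ x, ENNReal.ofReal (w x) * ‖u x‖ₑ ^ 2) ^ 2 ≤
      576 * (∫⁻ x, ∫⁻ y, ENNReal.ofReal (w x * w y / ‖x - y‖ ^ 2)) * (∑ i, ‖g i‖ₑ ^ 2) ^ 2 := by
  set T := ∫⁻ x, ENNReal.ofReal (w x) * ‖u x‖ₑ ^ 2 with hT
  set D := ∑ i, ‖g i‖ₑ ^ 2 with hD
  set S := ∫⁻ x, ∫⁻ y, ENNReal.ofReal (w x * w y / ‖x - y‖ ^ 2) with hS
  have hum : Measurable u := (Lp.stronglyMeasurable u).measurable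
  set h : R3 → ℂ := fun x => (w x : ℂ) * u x with hdef
  have hmeas : Measurable h := by fun_prop
  have hwc : Measurable fun x => (w x : ℂ) := by fun_prop
  have hwbd : ∀ x, ‖(w x : ℂ)‖ ≤ m := fun x => by
    rw [Complex.norm_real, Real.norm_of_nonneg (hw0 x)]; exact hwm x
  have hhL : MemLp h 2 volume :=
    (Lp.memLp u).of_le_mul (c := m) hmeas.aestronglyMeasurable (Eventually.of_forall fun x => by
      rw [hdef, norm_mul]; gcongr; exact hwbd x)
  have hwL : MemLp (fun x => (w x : ℂ)) 2 volume := by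
    have h1 : MemLp (fun x => (w x : ℂ)) 2 (volume.restrict (Metric.closedBall (0 : R3) m)) := by
      have : IsFiniteMeasure (volume.restrict (Metric.closedBall (0 : R3) m)) :=
        ⟨by
          rw [Measure.restrict_apply_univ]
          exact measure_closedBall_lt_top⟩
      exact MemLp.of_bound hwc.aestronglyMeasurable m (Eventually.of_forall hwbd)
    have h2 : (Metric.closedBall (0 : R3) m).indicator (fun x => (w x : ℂ)) =
        fun x => (w x : ℂ) := by
      rw [indicator_eq_self]
      intro x hx
      rw [mem_closedBall_zero_iff]
      by_contra hc
      exact hx (by simp [hsupp x (not_le.1 hc)])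
    rw [← h2]
    exact (memLp_indicator_iff_restrict measurableSet_closedBall).2 h1
  have hhi : Integrable h volume := hwL.integrable_mul (Lp.memLp u)
  set hL : L2 := hhL.toLp h with hLdef
  have hLe : hL =ᵐ[volume] h := hhL.coeFn_toLp
  have hF : (𝓕 hL : L2) =ᵐ[volume] 𝓕 h := by
    have h1 := fourier_coeFn_ae hL (hhi.congr hLe.symm)
    have h2 : 𝓕 (hL : R3 → ℂ) = 𝓕 h := by
      ext ξ
      rw [Real.fourier_eq', Real.fourier_eq']
      refine integral_congr_ae ?_
      filter_upwards [hLe] with x hx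
      rw [hx]
    rwa [h2] at h1
  have hTinner : T = ‖⟪hL, u⟫_ℂ‖ₑ := by
    have hint : Integrable (fun x => w x * ‖u x‖ ^ 2) volume := by
      have := (L2.integrable_inner (𝕜 := ℂ) hL u).re
      refine this.congr ?_
      filter_upwards [hLe] with x hx
      rw [hx, hdef]
      simp only [RCLike.inner_apply, map_mul, Complex.conj_ofReal]
      rw [mul_left_comm, Complex.mul_conj, Complex.normSq_eq_norm_sq, ← Complex.ofReal_mul]
      rfl
    have h1 : ⟪hL, u⟫_ℂ = ((∫ x, w x * ‖u x‖ ^ 2 : ℝ) : ℂ) := by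
      rw [L2.inner_def, ← integral_complex_ofReal]
      refine integral_congr_ae ?_
      filter_upwards [hLe] with x hx
      rw [hx, hdef]
      simp only [RCLike.inner_apply, map_mul, Complex.conj_ofReal]
      rw [mul_left_comm, Complex.mul_conj, Complex.normSq_eq_norm_sq, ← Complex.ofReal_mul]
    rw [h1, enorm_ofReal_complex, Real.enorm_of_nonneg
      (integral_nonneg fun x => mul_nonneg (hw0 x) (by positivity)),
      ofReal_integral_eq_lintegral_ofReal hint
        (Eventually.of_forall fun x => mul_nonneg (hw0 x) (by positivity)), hT]
    refine lintegral_congr fun x => ?_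
    rw [ENNReal.ofReal_mul (hw0 x), ENNReal.ofReal_pow (norm_nonneg _), ofReal_norm]
  have hTtop : T ≠ ∞ := by rw [hTinner]; exact enorm_ne_top
  have hFc : Continuous (𝓕 h) :=
    VectorFourier.fourierIntegral_continuous Real.continuous_fourierChar
      (by exact continuous_inner) hhi
  set I := ∫⁻ ξ, ‖𝓕 h ξ‖ₑ ^ 2 * ENNReal.ofReal (1 / (4 * Real.pi ^ 2 * ‖ξ‖ ^ 2)) with hI
  -- `T = ⟨w u, u⟩` is moved to momentum space; Cauchy–Schwarz with the weights `1/(2π|ξ|)` and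
  -- `2π|ξ|` separates the Coulomb energy `I` of `w u` from the Dirichlet energy `D`.
  have hTI : T ^ 2 ≤ I * D := by
    have hFm := hFc.measurable
    have hFum : Measurable (𝓕 u : L2) := (Lp.stronglyMeasurable _).measurable
    have h1 : T ≤ ∫⁻ ξ, (‖𝓕 h ξ‖ₑ * ENNReal.ofReal (1 / (2 * Real.pi * ‖ξ‖))) *
        (‖(𝓕 u : L2) ξ‖ₑ * ENNReal.ofReal (2 * Real.pi * ‖ξ‖)) := by
      rw [hTinner, ← Lp.inner_fourier_eq, L2.inner_def]
      refine (enorm_integral_le_lintegral_enorm _).trans (lintegral_mono_ae ?_)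
      filter_upwards [hF, volume.ae_ne (0 : R3)] with ξ hξ hξ0
      have : 0 < ‖ξ‖ := norm_pos_iff.2 hξ0
      rw [hξ, mul_mul_mul_comm, ← ENNReal.ofReal_mul (by positivity),
        one_div_mul_cancel (by positivity), ENNReal.ofReal_one, mul_one, RCLike.inner_apply,
        enorm_mul, RCLike.enorm_conj, mul_comm]
    refine (pow_le_pow_left₀ zero_le h1 2).trans ((sq_lintegral_mul_le _ (by fun_prop)
      (by fun_prop)).trans (le_of_eq ?_))
    rw [lintegral_fourier_mul_le hg]
    congr 1
    refine lintegral_congr fun ξ => ?_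
    rw [mul_pow, ← ENNReal.ofReal_pow (by positivity)]
    congr 2
    rw [div_pow]
    ring
  -- Split the integrand over pairs `(x, y)` as `√(w w)/|x - y|` times `√(w w) |u||u|`: the square
  -- integral of the first factor is the Rollnik integral, that of the second is `T²`. Here `576 =
  -- 24²`.
  have hIS : I ^ 2 ≤ 576 * S * T ^ 2 := by
    have h1 : I ≤ ∫⁻ p : R3 × R3, ENNReal.ofReal (24 * √(w p.1 * w p.2) / ‖p.1 - p.2‖) *
        (ENNReal.ofReal √(w p.1 * w p.2) * ‖u p.1‖ₑ * ‖u p.2‖ₑ) := by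
      refine (lintegral_fourier_div_le hmeas hhi).trans (le_of_eq ?_)
      rw [Measure.volume_eq_prod, lintegral_prod _ (Measurable.aemeasurable (by fun_prop))]
      refine lintegral_congr fun x => lintegral_congr fun y => ?_
      simp only [hdef, enorm_mul, enorm_ofReal_complex, Real.enorm_of_nonneg (hw0 _)]
      have h2 : ENNReal.ofReal (24 * √(w x * w y) / ‖x - y‖) * ENNReal.ofReal √(w x * w y) =
          ENNReal.ofReal (w x) * ENNReal.ofReal (w y) * ENNReal.ofReal (24 / ‖x - y‖) := by
        rw [← ENNReal.ofReal_mul (by positivity), ← ENNReal.ofReal_mul (hw0 x),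
          ← ENNReal.ofReal_mul (mul_nonneg (hw0 x) (hw0 y))]
        congr 1
        have := Real.mul_self_sqrt (mul_nonneg (hw0 x) (hw0 y))
        calc _ = 24 / ‖x - y‖ * (√(w x * w y) * √(w x * w y)) := by ring
          _ = _ := by rw [this]; ring
      rw [← mul_assoc, ← mul_assoc, ← mul_assoc, h2]
      ring
    refine (pow_le_pow_left₀ zero_le h1 2).trans ((sq_lintegral_mul_le _
      (Measurable.aemeasurable (by fun_prop)) (Measurable.aemeasurable (by fun_prop))).trans
      (le_of_eq ?_))
    congr 1
    · rw [hS, Measure.volume_eq_prod, lintegral_prod _ (Measurable.aemeasurable (by fun_prop)),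
        ← lintegral_const_mul' _ _ (by norm_num)]
      refine lintegral_congr fun x => ?_
      rw [← lintegral_const_mul' _ _ (by norm_num)]
      refine lintegral_congr fun y => ?_
      rw [← ENNReal.ofReal_pow (by positivity), show (576 : ℝ≥0∞) = ENNReal.ofReal 576 by simp,
        ← ENNReal.ofReal_mul (by positivity), div_pow, mul_pow,
        Real.sq_sqrt (mul_nonneg (hw0 x) (hw0 y))]
      congr 1
      ring
    · rw [Measure.volume_eq_prod, lintegral_prod _ (Measurable.aemeasurable (by fun_prop)), sq T]
      nth_rewrite 1 [hT]
      rw [← lintegral_mul_const' _ _ hTtop]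
      refine lintegral_congr fun x => ?_
      rw [hT, ← lintegral_const_mul' _ _ (ENNReal.mul_ne_top ENNReal.ofReal_ne_top
        (ENNReal.pow_ne_top enorm_ne_top))]
      refine lintegral_congr fun y => ?_
      rw [mul_pow, mul_pow, ← ENNReal.ofReal_pow (by positivity),
        Real.sq_sqrt (mul_nonneg (hw0 x) (hw0 y)), ENNReal.ofReal_mul (hw0 x)]
      ring
  rcases eq_or_ne T 0 with h0 | h0
  · rw [h0]; simp
  -- The estimates bound `T` in terms of itself, and one factor `T²` is cancelled. This needs `T`
  -- finite, which is why `w` is first taken bounded.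
  have hfin : T ^ 2 * T ^ 2 ≤ T ^ 2 * (576 * S * D ^ 2) := by
    calc T ^ 2 * T ^ 2 ≤ (I * D) * (I * D) := mul_le_mul' hTI hTI
      _ = I ^ 2 * D ^ 2 := by ring
      _ ≤ 576 * S * T ^ 2 * D ^ 2 := mul_le_mul_left hIS _
      _ = _ := by ring
  exact (ENNReal.mul_le_mul_iff_right (pow_ne_zero 2 h0) (ENNReal.pow_ne_top hTtop)).1 hfin

/-- The form bound for nonnegative potentials. -/
theorem sq_lintegral_mul_le_rollnik {w : R3 → ℝ} (hw : Measurable w) (hw0 : ∀ x, 0 ≤ w x)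
    {u : L2} {g : Fin 3 → L2} (hg : HasWeakGradient u g) :
    (∫⁻ x, ENNReal.ofReal (w x) * ‖u x‖ₑ ^ 2) ^ 2 ≤
      576 * (∫⁻ x, ∫⁻ y, ENNReal.ofReal (w x * w y / ‖x - y‖ ^ 2)) * (∑ i, ‖g i‖ₑ ^ 2) ^ 2 := by
  have hum : Measurable u := (Lp.stronglyMeasurable u).measurable
  -- Truncation in height and in space; monotone convergence recovers `w`, as the constant does not
  -- depend on `n`.
  set A : ℕ → Set R3 := fun n => {x | w x ≤ n ∧ ‖x‖ ≤ n} with hA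
  have hAm : ∀ n, MeasurableSet (A n) := fun n =>
    (measurableSet_le hw measurable_const).inter (measurableSet_le measurable_norm measurable_const)
  have hAmono : ∀ x, ∀ n k : ℕ, n ≤ k → x ∈ A n → x ∈ A k := fun x n k hnk hx =>
    ⟨hx.1.trans (by exact_mod_cast hnk), hx.2.trans (by exact_mod_cast hnk)⟩
  set v : ℕ → R3 → ℝ := fun n => (A n).indicator w with hv
  have hv0 : ∀ n x, 0 ≤ v n x := fun n x => indicator_nonneg (fun x _ => hw0 x) x
  have hvw : ∀ n x, v n x ≤ w x := fun n x => indicator_le_self' (fun x _ => hw0 x) x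
  have hvm : ∀ n, Measurable (v n) := fun n => hw.indicator (hAm n)
  have hlim : Tendsto (fun n => ∫⁻ x, ENNReal.ofReal (v n x) * ‖u x‖ₑ ^ 2) atTop
      (𝓝 (∫⁻ x, ENNReal.ofReal (w x) * ‖u x‖ₑ ^ 2)) := by
    refine lintegral_tendsto_of_tendsto_of_monotone
      (fun n => by have := hvm n; exact Measurable.aemeasurable (by fun_prop))
      (Eventually.of_forall fun x n k hnk => ?_) (Eventually.of_forall fun x => ?_)
    · refine mul_le_mul_left (ENNReal.ofReal_le_ofReal ?_) _
      exact indicator_le_indicator_of_subset (fun x hx => hAmono x n k hnk hx) (fun x => hw0 x) x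
    · refine tendsto_const_nhds.congr' ?_
      obtain ⟨n0, hn0⟩ := exists_nat_ge (max (w x) ‖x‖)
      filter_upwards [eventually_ge_atTop n0] with n hn
      have : x ∈ A n := hAmono x n0 n hn
        ⟨(le_max_left _ _).trans hn0, (le_max_right _ _).trans hn0⟩
      simp only [hv, indicator_of_mem this]
  refine le_of_tendsto' (ENNReal.Tendsto.pow hlim) fun n => ?_
  refine (sq_lintegral_mul_le_of_bounded (hvm n) (hv0 n) (m := n) (fun x => ?_) (fun x hx => ?_)
    hg).trans ?_
  · exact indicator_le' (fun x hx => hx.1) (fun x _ => Nat.cast_nonneg n) x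
  · exact indicator_of_notMem (fun hx' => absurd hx'.2 (not_le.2 hx)) _
  · gcongr with x y
    · exact hv0 n y
    · exact hw0 x
    · exact hvw n x
    · exact hvw n y

/-- Functions in the Rollnik class are form bounded relative to the Laplacian with relative
bound zero. -/
theorem MemRollnik.formBound {W : R3 → ℝ} (hW : MemRollnik fun x => (W x : ℂ)) {ε : ℝ}
    (hε : 0 < ε) : ∃ b : ℝ, 0 ≤ b ∧ ∀ (u : L2) (g : Fin 3 → L2), HasWeakGradient u g →
      ∫⁻ x, ENNReal.ofReal |W x| * ‖u x‖ₑ ^ 2 ≤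
        ENNReal.ofReal (ε * ∑ i, ‖g i‖ ^ 2 + b * ‖u‖ ^ 2) := by
  obtain ⟨hWm, hfin⟩ := hW
  set w : R3 → ℝ := fun x => ‖hWm.mk _ x‖ with hwdef
  have hw : Measurable w := hWm.measurable_mk.norm
  have hw0 : ∀ x, 0 ≤ w x := fun x => norm_nonneg _
  have hWw : ∀ᵐ x, |W x| = w x := by
    filter_upwards [hWm.ae_eq_mk] with x hx
    rw [hwdef]
    simp only
    rw [← hx, Complex.norm_real, Real.norm_eq_abs]
  have hfin' : ∫⁻ p : R3 × R3, ENNReal.ofReal (w p.1 * w p.2 / ‖p.1 - p.2‖ ^ 2) ≠ ∞ := by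
    rw [Measure.volume_eq_prod, lintegral_prod _ (Measurable.aemeasurable (by fun_prop))]
    refine ne_of_lt (lt_of_le_of_lt (le_of_eq ?_) hfin)
    refine lintegral_congr_ae ?_
    filter_upwards [hWw] with x hx
    refine lintegral_congr_ae ?_
    filter_upwards [hWw] with y hy
    rw [← hx, ← hy, norm_mul, Complex.norm_real, Complex.norm_real, Real.norm_eq_abs,
      Real.norm_eq_abs]
  -- The part of `w` above height `n` has Rollnik integral tending to 0 by dominated convergence and
  -- supplies the small coefficient of the gradient term; the part below is bounded by `n` and
  -- supplies `b = n`. The threshold `ε²/576` cancels the constant of the form bound.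
  set v : ℕ → R3 → ℝ := fun n => {x | (n : ℝ) < w x}.indicator w with hv
  have hAm : ∀ n : ℕ, MeasurableSet {x | (n : ℝ) < w x} := fun n =>
    measurableSet_lt measurable_const hw
  have hv0 : ∀ n x, 0 ≤ v n x := fun n x => indicator_nonneg (fun x _ => hw0 x) x
  have hvw : ∀ n x, v n x ≤ w x := fun n x => indicator_le_self' (fun x _ => hw0 x) x
  have hvm : ∀ n, Measurable (v n) := fun n => hw.indicator (hAm n)
  have hlim : Tendsto (fun n => ∫⁻ p : R3 × R3,
      ENNReal.ofReal (v n p.1 * v n p.2 / ‖p.1 - p.2‖ ^ 2)) atTop (𝓝 0) := by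
    rw [← lintegral_zero (μ := (volume : Measure (R3 × R3)))]
    refine tendsto_lintegral_of_dominated_convergence
      (fun p : R3 × R3 => ENNReal.ofReal (w p.1 * w p.2 / ‖p.1 - p.2‖ ^ 2))
      (fun n => by have := hvm n; fun_prop)
      (fun n => Eventually.of_forall fun p => ?_) hfin' (Eventually.of_forall fun p => ?_)
    · refine ENNReal.ofReal_le_ofReal ?_
      gcongr
      · exact hv0 n p.2
      · exact hvw n p.1
      · exact hvw n p.2
    · refine tendsto_const_nhds.congr' ?_
      obtain ⟨n0, hn0⟩ := exists_nat_ge (w p.1)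
      filter_upwards [eventually_ge_atTop n0] with n hn
      have : v n p.1 = 0 := by
        refine indicator_of_notMem (s := {x | (n : ℝ) < w x})
          (fun h : (n : ℝ) < w p.1 => absurd h (not_lt.2 ?_)) w
        exact hn0.trans (by exact_mod_cast hn)
      simp [this]
  have hev := hlim.eventually_lt_const (u := ENNReal.ofReal (ε ^ 2 / 576))
    (ENNReal.ofReal_pos.2 (by positivity))
  obtain ⟨n, hn⟩ := hev.exists
  refine ⟨n, Nat.cast_nonneg n, fun u g hg => ?_⟩
  have hum : Measurable u := (Lp.stronglyMeasurable u).measurable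
  set D := ∑ i, ‖g i‖ₑ ^ 2 with hD
  have hDr : D = ENNReal.ofReal (∑ i, ‖g i‖ ^ 2) := by
    rw [ENNReal.ofReal_sum_of_nonneg fun i _ => by positivity]
    refine Finset.sum_congr rfl fun i _ => ?_
    rw [ENNReal.ofReal_pow (norm_nonneg _), ofReal_norm]
  have hsmall : ∫⁻ x, ENNReal.ofReal (v n x) * ‖u x‖ₑ ^ 2 ≤ ENNReal.ofReal ε * D := by
    have h1 := sq_lintegral_mul_le_rollnik (hvm n) (hv0 n) hg
    have h2 : ∫⁻ x, ∫⁻ y, ENNReal.ofReal (v n x * v n y / ‖x - y‖ ^ 2) ≤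
        ENNReal.ofReal (ε ^ 2 / 576) := by
      refine le_trans (le_of_eq ?_) hn.le
      have := hvm n
      rw [Measure.volume_eq_prod, lintegral_prod _ (Measurable.aemeasurable (by fun_prop))]
    have h3 : (∫⁻ x, ENNReal.ofReal (v n x) * ‖u x‖ₑ ^ 2) ^ 2 ≤ (ENNReal.ofReal ε * D) ^ 2 := by
      refine h1.trans ((mul_le_mul_left (mul_le_mul_right h2 _) _).trans (le_of_eq ?_))
      rw [mul_pow, show (576 : ℝ≥0∞) = ENNReal.ofReal 576 by simp,
        ← ENNReal.ofReal_mul (by norm_num), ← ENNReal.ofReal_pow hε.le]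
      congr 2
      ring
    exact le_of_not_gt fun hlt => absurd h3 (not_le.2 (ENNReal.pow_lt_pow_left two_ne_zero hlt))
  calc ∫⁻ x, ENNReal.ofReal |W x| * ‖u x‖ₑ ^ 2
      = ∫⁻ x, ENNReal.ofReal (w x) * ‖u x‖ₑ ^ 2 := by
        refine lintegral_congr_ae ?_
        filter_upwards [hWw] with x hx
        rw [hx]
    _ ≤ ∫⁻ x, (ENNReal.ofReal (v n x) * ‖u x‖ₑ ^ 2 + (n : ℝ≥0∞) * ‖u x‖ₑ ^ 2) := by
        refine lintegral_mono fun x => ?_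
        rw [← add_mul]
        refine mul_le_mul_left ?_ _
        by_cases hx : (n : ℝ) < w x
        · simp only [hv]
          rw [indicator_of_mem (by exact hx)]
          exact le_self_add
        · refine le_add_left ?_
          rw [← ENNReal.ofReal_natCast]
          exact ENNReal.ofReal_le_ofReal (not_lt.1 hx)
    _ = (∫⁻ x, ENNReal.ofReal (v n x) * ‖u x‖ₑ ^ 2) + n * ‖u‖ₑ ^ 2 := by
        have := hvm n
        rw [lintegral_add_left (by fun_prop), lintegral_const_mul' _ _ (ENNReal.natCast_ne_top n),
          lintegral_enorm_sq]
    _ ≤ ENNReal.ofReal ε * D + n * ‖u‖ₑ ^ 2 := add_le_add hsmall le_rfl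
    _ = ENNReal.ofReal (ε * ∑ i, ‖g i‖ ^ 2 + n * ‖u‖ ^ 2) := by
        rw [ENNReal.ofReal_add (by positivity) (by positivity), ENNReal.ofReal_mul hε.le, hDr,
          ENNReal.ofReal_mul (Nat.cast_nonneg n), ENNReal.ofReal_natCast,
          ENNReal.ofReal_pow (norm_nonneg _), ofReal_norm]

end RollnikSchroedinger

namespace RollnikSchroedinger

/-! ### Multiplication operators -/

theorem memLp_ofReal_mul {m : R3 → ℝ} (hm : AEStronglyMeasurable m volume)
    (hb : ∀ᵐ x, |m x| ≤ 1) (u : L2) : MemLp (fun x => (m x : ℂ) * u x) 2 volume := by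
  refine (Lp.memLp u).of_le_mul (c := 1)
    ((Complex.continuous_ofReal.comp_aestronglyMeasurable hm).mul (Lp.aestronglyMeasurable u)) ?_
  filter_upwards [hb] with x hx
  rw [norm_mul, Complex.norm_real, Real.norm_eq_abs]
  gcongr

open Classical in
/-- Multiplication by a measurable function bounded by `1` (and `0` for other functions). -/
noncomputable def mulOp (m : R3 → ℝ) : L2 →L[ℂ] L2 :=
  if h : AEStronglyMeasurable m volume ∧ ∀ᵐ x, |m x| ≤ 1 then
    LinearMap.mkContinuous
      { toFun := fun u => (memLp_ofReal_mul h.1 h.2 u).toLp _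
        map_add' := fun u v => by
          refine Lp.ext ?_
          filter_upwards [(memLp_ofReal_mul h.1 h.2 (u + v)).coeFn_toLp,
            (memLp_ofReal_mul h.1 h.2 u).coeFn_toLp, (memLp_ofReal_mul h.1 h.2 v).coeFn_toLp,
            Lp.coeFn_add ((memLp_ofReal_mul h.1 h.2 u).toLp _)
              ((memLp_ofReal_mul h.1 h.2 v).toLp _), Lp.coeFn_add u v] with x h1 h2 h3 h4 h5
          rw [h1, h4, Pi.add_apply, h2, h3, h5, Pi.add_apply, mul_add]
        map_smul' := fun c u => by
          refine Lp.ext ?_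
          filter_upwards [(memLp_ofReal_mul h.1 h.2 (c • u)).coeFn_toLp,
            (memLp_ofReal_mul h.1 h.2 u).coeFn_toLp,
            Lp.coeFn_smul c ((memLp_ofReal_mul h.1 h.2 u).toLp _),
            Lp.coeFn_smul c u] with x h1 h2 h3 h4
          rw [h1, RingHom.id_apply, h3, Pi.smul_apply, h2, h4, Pi.smul_apply, smul_eq_mul,
            smul_eq_mul, mul_left_comm] }
      1 (fun u => by
        rw [one_mul]
        refine Lp.norm_le_norm_of_ae_le ?_
        filter_upwards [(memLp_ofReal_mul h.1 h.2 u).coeFn_toLp, h.2] with x h1 h2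
        simp only [LinearMap.coe_mk, AddHom.coe_mk]
        rw [h1, norm_mul, Complex.norm_real, Real.norm_eq_abs]
        exact mul_le_of_le_one_left (norm_nonneg _) h2)
  else 0

theorem coeFn_mulOp {m : R3 → ℝ} (hm : AEStronglyMeasurable m volume) (hb : ∀ᵐ x, |m x| ≤ 1)
    (u : L2) : mulOp m u =ᵐ[volume] fun x => (m x : ℂ) * u x := by
  rw [mulOp, dif_pos ⟨hm, hb⟩]
  exact (memLp_ofReal_mul hm hb u).coeFn_toLp

theorem norm_mulOp_le (m : R3 → ℝ) : ‖mulOp m‖ ≤ 1 := by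
  rw [mulOp]
  split_ifs
  · exact LinearMap.mkContinuous_norm_le _ zero_le_one _
  · simp

theorem inner_mulOp_left {m : R3 → ℝ} (hm : AEStronglyMeasurable m volume)
    (hb : ∀ᵐ x, |m x| ≤ 1) (u v : L2) : ⟪mulOp m u, v⟫_ℂ = ⟪u, mulOp m v⟫_ℂ := by
  rw [L2.inner_def, L2.inner_def]
  refine integral_congr_ae ?_
  filter_upwards [coeFn_mulOp hm hb u, coeFn_mulOp hm hb v] with x h1 h2
  rw [h1, h2]
  simp only [RCLike.inner_apply, map_mul, Complex.conj_ofReal]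
  ring

/-- Dominated convergence in `L²`. -/
theorem tendsto_L2_of_dominated {ι : Type*} {l : Filter ι} [l.IsCountablyGenerated] {F : ι → L2}
    {G y : L2} {a : ι → R3 → ℂ} {C : ℝ} (ha : ∀ᶠ n in l, ((F n - G : L2) : R3 → ℂ) =ᵐ[volume] a n)
    (hb : ∀ᶠ n in l, ∀ᵐ x, ‖a n x‖ ≤ C * ‖y x‖)
    (hlim : ∀ᵐ x, Tendsto (fun n => a n x) l (𝓝 0)) : Tendsto F l (𝓝 G) := by
  have hC : ∫⁻ x, (ENNReal.ofReal C * ‖y x‖ₑ) ^ 2 ≠ ∞ := by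
    simp_rw [mul_pow]
    rw [lintegral_const_mul' _ _ (ENNReal.pow_ne_top ENNReal.ofReal_ne_top), lintegral_enorm_sq]
    exact ENNReal.mul_ne_top (ENNReal.pow_ne_top ENNReal.ofReal_ne_top)
      (ENNReal.pow_ne_top enorm_ne_top)
  have h0 : Tendsto (fun n => ∫⁻ x, ‖(F n - G : L2) x‖ₑ ^ 2) l (𝓝 0) := by
    have h1 : Tendsto (fun n => ∫⁻ x, ‖a n x‖ₑ ^ 2) l (𝓝 0) := by
      rw [← lintegral_zero (μ := (volume : Measure R3))]
      refine tendsto_lintegral_filter_of_dominated_convergence' _ ?_ ?_ hC ?_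
      · filter_upwards [ha] with n hn
        exact ((Lp.aestronglyMeasurable _).congr hn).enorm.pow_const 2
      · filter_upwards [hb] with n hn
        filter_upwards [hn] with x hx
        refine pow_le_pow_left₀ zero_le ?_ 2
        rw [← ofReal_norm, ← ofReal_norm, ← ENNReal.ofReal_mul' (norm_nonneg _)]
        exact ENNReal.ofReal_le_ofReal hx
      · filter_upwards [hlim] with x hx
        have := ENNReal.Tendsto.pow (n := 2) ((continuous_enorm.tendsto _).comp hx)
        simpa using this
    refine h1.congr' ?_
    filter_upwards [ha] with n hn
    refine lintegral_congr_ae ?_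
    filter_upwards [hn] with x hx
    rw [hx]
  rw [tendsto_iff_norm_sub_tendsto_zero]
  simp_rw [lintegral_enorm_sq] at h0
  have h2 : Tendsto (fun n => ‖F n - G‖ ^ 2) l (𝓝 0) := by
    have := (ENNReal.tendsto_toReal ENNReal.zero_ne_top).comp h0
    refine (this.congr fun n => ?_).trans (by simp)
    simp
  simpa using h2.sqrt

section Family

variable {a b : ℝ} {f : ℝ → R3 → ℝ}

theorem hasDerivAt_mulOp (hf : ∀ t, AEStronglyMeasurable (f t) volume)
    (hf' : ∀ t, AEStronglyMeasurable (fun x => deriv (fun τ => f τ x) t) volume)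
    (hC1 : ∀ᵐ x, ContDiff ℝ 1 fun t => f t x)
    (hb : ∀ᵐ x, ∀ t ∈ Ioo a b, |f t x| ≤ 1 ∧ |deriv (fun τ => f τ x) t| ≤ 1)
    {t : ℝ} (ht : t ∈ Ioo a b) (y : L2) :
    HasDerivAt (fun τ => mulOp (f τ) y) (mulOp (fun x => deriv (fun τ => f τ x) t) y) t := by
  have hb1 : ∀ t ∈ Ioo a b, ∀ᵐ x, |f t x| ≤ 1 := fun t ht => hb.mono fun x hx => (hx t ht).1
  have hb2 : ∀ t ∈ Ioo a b, ∀ᵐ x, |deriv (fun τ => f τ x) t| ≤ 1 :=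
    fun t ht => hb.mono fun x hx => (hx t ht).2
  have hnear : ∀ᶠ τ in 𝓝[≠] t, τ ∈ Ioo a b ∧ τ ≠ t :=
    (eventually_nhdsWithin_of_eventually_nhds (Ioo_mem_nhds ht.1 ht.2)).and
      self_mem_nhdsWithin
  rw [hasDerivAt_iff_tendsto_slope]
  -- By the mean value inequality the difference quotients of `f` are bounded by 1, as is the
  -- derivative, so `2 |y|` dominates.
  refine tendsto_L2_of_dominated (y := y) (C := 2) (a := fun τ x =>
    (((slope (fun τ => f τ x) t τ - deriv (fun τ => f τ x) t : ℝ) : ℂ)) * y x) ?_ ?_ ?_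
  · filter_upwards [hnear] with τ hτ
    rw [slope_def_module]
    set c : ℝ := (τ - t)⁻¹ with hc
    have hcs : c • (mulOp (f τ) y - mulOp (f t) y) = (c : ℂ) • (mulOp (f τ) y - mulOp (f t) y) :=
      (Complex.coe_smul c _).symm
    rw [hcs]
    filter_upwards [Lp.coeFn_sub ((c : ℂ) • (mulOp (f τ) y - mulOp (f t) y))
      (mulOp (fun x => deriv (fun τ => f τ x) t) y),
      Lp.coeFn_smul (c : ℂ) (mulOp (f τ) y - mulOp (f t) y),
      Lp.coeFn_sub (mulOp (f τ) y) (mulOp (f t) y), coeFn_mulOp (hf τ) (hb1 τ hτ.1) y,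
      coeFn_mulOp (hf t) (hb1 t ht) y, coeFn_mulOp (hf' t) (hb2 t ht) y] with x h1 h2 h3 h4 h5 h6
    rw [h1, Pi.sub_apply, h2, Pi.smul_apply, h3, Pi.sub_apply, h4, h5, h6, slope_def_module]
    simp only [smul_eq_mul, ← hc]
    push_cast
    ring
  · filter_upwards [hnear] with τ hτ
    filter_upwards [hb, hC1] with x hx hxc
    rw [norm_mul, Complex.norm_real]
    gcongr
    have hd : ‖f τ x - f t x‖ ≤ 1 * ‖τ - t‖ :=
      (convex_Ioo a b).norm_image_sub_le_of_norm_deriv_le (f := fun τ => f τ x)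
        (fun s _ => (hxc.differentiable one_ne_zero).differentiableAt)
        (fun s hs => (hx s hs).2) ht hτ.1
    have hs : ‖slope (fun τ => f τ x) t τ‖ ≤ 1 := by
      rw [slope_def_field, norm_div]
      exact div_le_one_of_le₀ (by rwa [one_mul] at hd) (norm_nonneg _)
    calc _ ≤ ‖slope (fun τ => f τ x) t τ‖ + ‖deriv (fun τ => f τ x) t‖ := norm_sub_le _ _
      _ ≤ 1 + 1 := add_le_add hs (hx t ht).2
      _ = 2 := by norm_num
  · filter_upwards [hC1] with x hxc
    have h1 : Tendsto (fun τ => slope (fun τ => f τ x) t τ - deriv (fun τ => f τ x) t) (𝓝[≠] t)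
        (𝓝 0) := by
      have := hasDerivAt_iff_tendsto_slope.1
        ((hxc.differentiable one_ne_zero).differentiableAt (x := t)).hasDerivAt
      simpa using this.sub_const (deriv (fun τ => f τ x) t)
    have h2 := ((Complex.continuous_ofReal.tendsto _).comp h1).mul_const (y x)
    simpa using h2

theorem continuousOn_mulOp (hf : ∀ t, AEStronglyMeasurable (f t) volume)
    (hc : ∀ᵐ x, Continuous fun t => f t x) {I : Set ℝ}
    (hb : ∀ᵐ x, ∀ t ∈ I, |f t x| ≤ 1) (y : L2) :
    ContinuousOn (fun τ => mulOp (f τ) y) I := by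
  have hb1 : ∀ t ∈ I, ∀ᵐ x, |f t x| ≤ 1 := fun t ht => hb.mono fun x hx => hx t ht
  intro t ht
  refine tendsto_L2_of_dominated (y := y) (C := 2) (a := fun τ x =>
    ((f τ x - f t x : ℝ) : ℂ) * y x) ?_ ?_ ?_
  · filter_upwards [self_mem_nhdsWithin] with τ hτ
    filter_upwards [Lp.coeFn_sub (mulOp (f τ) y) (mulOp (f t) y),
      coeFn_mulOp (hf τ) (hb1 τ hτ) y, coeFn_mulOp (hf t) (hb1 t ht) y] with x h1 h2 h3
    rw [h1, Pi.sub_apply, h2, h3]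
    push_cast
    ring
  · filter_upwards [self_mem_nhdsWithin] with τ hτ
    filter_upwards [hb] with x hx
    rw [norm_mul, Complex.norm_real]
    gcongr
    calc _ ≤ ‖f τ x‖ + ‖f t x‖ := norm_sub_le _ _
      _ ≤ 1 + 1 := add_le_add (hx τ hτ) (hx t ht)
      _ = 2 := by norm_num
  · filter_upwards [hc] with x hx
    have h1 : Tendsto (fun τ => f τ x - f t x) (𝓝[I] t) (𝓝 0) := by
      simpa using ((hx.tendsto t).mono_left nhdsWithin_le_nhds).sub_const (f t x)
    have h2 := ((Complex.continuous_ofReal.tendsto _).comp h1).mul_const (y x)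
    simpa using h2

end Family

/-! ### Measurability of the time slices -/

/-- Measurability in `(t, x)` gives measurable slices only for almost every `t`. Such times are
dense, and continuity in `t` makes every other slice an almost everywhere limit of them. -/
theorem aemeasurable_slice {V : ℝ → R3 → ℝ}
    (hV : AEMeasurable (fun p : ℝ × R3 => V p.1 p.2) volume)
    (hc : ∀ᵐ x : R3, Continuous fun t => V t x) (t : ℝ) : AEMeasurable (V t) volume := by
  have hae : ∀ᵐ t : ℝ, AEMeasurable (V t) volume := by
    obtain ⟨f, hf, hfe⟩ := hV
    rw [Measure.volume_eq_prod] at hfe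
    filter_upwards [Measure.ae_ae_of_ae_prod hfe] with t ht
    exact ⟨fun x => f (t, x), hf.comp measurable_prodMk_left, ht⟩
  obtain ⟨s, hs, hlim⟩ := mem_closure_iff_seq_limit.1
    ((Measure.dense_of_ae hae) t)
  refine aemeasurable_of_tendsto_metrizable_ae atTop (f := fun n => V (s n)) hs ?_
  filter_upwards [hc] with x hx
  exact (hx.tendsto t).comp hlim

theorem aemeasurable_deriv_slice {V : ℝ → R3 → ℝ} (hm : ∀ t, AEMeasurable (V t) volume)
    (hd : ∀ᵐ x : R3, Differentiable ℝ fun t => V t x) (t : ℝ) :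
    AEMeasurable (fun x => deriv (fun τ => V τ x) t) volume := by
  have hnt : (𝓝[≠] t).NeBot := inferInstance
  refine aemeasurable_of_tendsto_metrizable_ae (𝓝[≠] t)
    (f := fun τ x => slope (fun τ => V τ x) t τ) (fun τ => ?_) ?_
  · simp only [slope_def_field]
    exact ((hm τ).sub (hm t)).div_const _
  · filter_upwards [hd] with x hx
    exact hasDerivAt_iff_tendsto_slope.1 (hx t).hasDerivAt

end RollnikSchroedinger

namespace RollnikSchroedinger

/-! ### The Sobolev space -/

/-- The Hilbert space of all pairs of square integrable functions and vector fields. -/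
abbrev FieldPair : Type := WithLp 2 (L2 × PiLp 2 fun _ : Fin 3 => L2)

/-- The defect of the second component of `p` from being the weak gradient of the first. -/
noncomputable def gradientDefect (i : Fin 3) : FieldPair →L[ℂ] 𝓢'(R3, ℂ) :=
  (LineDeriv.lineDerivOpCLM ℂ 𝓢'(R3, ℂ) (EuclideanSpace.single i (1 : ℝ) : R3)) ∘L
      (Lp.toTemperedDistributionCLM ℂ volume 2) ∘L WithLp.fstL 2 ℂ _ _ -
    (Lp.toTemperedDistributionCLM ℂ volume 2) ∘L (PiLp.proj 2 _ i) ∘L WithLp.sndL 2 ℂ _ _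

/-- The Sobolev space `H¹(ℝ³)`, realized as the graph of the weak gradient. -/
noncomputable def sobolevGraph : Submodule ℂ FieldPair :=
  ⨅ i, LinearMap.ker (gradientDefect i : FieldPair →ₗ[ℂ] 𝓢'(R3, ℂ))

theorem mem_sobolevGraph {p : FieldPair} :
    p ∈ sobolevGraph ↔ HasWeakGradient p.fst fun i => p.snd i := by
  simp only [sobolevGraph, Submodule.mem_iInf, LinearMap.mem_ker]
  refine forall_congr' fun i => ?_
  exact sub_eq_zero

theorem isClosed_sobolevGraph : IsClosed (sobolevGraph : Set FieldPair) := by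
  have : (sobolevGraph : Set FieldPair) = ⋂ i, {p | gradientDefect i p = 0} := by
    ext p
    simp [sobolevGraph]
  rw [this]
  exact isClosed_iInter fun i => isClosed_eq (gradientDefect i).continuous continuous_const

noncomputable instance : CompleteSpace sobolevGraph := isClosed_sobolevGraph.completeSpace_coe

/-- The embedding of the Sobolev space into `L²`. -/
noncomputable def sobolevEmbedding : sobolevGraph →L[ℂ] L2 :=
  WithLp.fstL 2 ℂ _ _ ∘L sobolevGraph.subtypeL

theorem hasWeakGradient_coe (q : sobolevGraph) :
    HasWeakGradient (sobolevEmbedding q) fun i => (q : FieldPair).snd i :=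
  mem_sobolevGraph.1 q.2

theorem inner_sobolev (w q : sobolevGraph) :
    ⟪w, q⟫_ℂ = ⟪sobolevEmbedding w, sobolevEmbedding q⟫_ℂ +
      ∑ i, ⟪(w : FieldPair).snd i, (q : FieldPair).snd i⟫_ℂ := by
  rw [Submodule.coe_inner, WithLp.prod_inner_apply, PiLp.inner_apply]
  rfl

theorem norm_sq_sobolev (q : sobolevGraph) :
    ‖q‖ ^ 2 = ‖sobolevEmbedding q‖ ^ 2 + ∑ i, ‖(q : FieldPair).snd i‖ ^ 2 := by
  rw [Submodule.coe_norm, WithLp.prod_norm_sq_eq_of_L2, PiLp.norm_sq_eq_of_L2]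
  rfl

/-- The element of the Sobolev space given by a function with weak gradient. -/
noncomputable def toSobolev {u : L2} {g : Fin 3 → L2} (h : HasWeakGradient u g) : sobolevGraph :=
  ⟨WithLp.toLp 2 (u, WithLp.toLp 2 g), mem_sobolevGraph.2 h⟩

theorem toTemperedDistribution_injective {f f' : L2} (h : (f : 𝓢'(R3, ℂ)) = f') : f = f' := by
  have := LinearMap.ker_eq_bot.1 (Lp.ker_toTemperedDistributionCLM_eq_bot (E := R3) (F := ℂ)
    (μ := volume) (p := 2))
  exact this h

theorem HasWeakGradient.unique {u : L2} {g g' : Fin 3 → L2} (h : HasWeakGradient u g)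
    (h' : HasWeakGradient u g') : g = g' :=
  funext fun i => toTemperedDistribution_injective ((h i).symm.trans (h' i))

theorem hasWeakGradient_zero : HasWeakGradient 0 fun _ => 0 := by
  simpa using hasWeakGradient_coe 0

theorem hasWeakGradient_schwartz (φ : 𝓢(R3, ℂ)) :
    HasWeakGradient (φ.toLp 2 volume)
      fun i => (∂_{(EuclideanSpace.single i (1 : ℝ) : R3)} φ).toLp 2 volume := by
  intro i
  rw [Lp.toTemperedDistribution_toLp_eq, Lp.toTemperedDistribution_toLp_eq]
  exact TemperedDistribution.lineDerivOp_toTemperedDistributionCLM_eq φ _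

/-- Schwartz functions have weak gradients and are dense in `L²`. -/
theorem eq_zero_of_inner_sobolev {f : L2}
    (h : ∀ (w : L2) (k : Fin 3 → L2), HasWeakGradient w k → ⟪w, f⟫_ℂ = 0) : f = 0 := by
  have hd : DenseRange (SchwartzMap.toLpCLM ℝ (E := R3) ℂ 2 volume) :=
    SchwartzMap.denseRange_toLpCLM ENNReal.ofNat_ne_top
  have : (fun w : L2 => ⟪w, f⟫_ℂ) = fun _ => 0 :=
    hd.equalizer (by fun_prop) continuous_const
      (funext fun φ => h _ _ (hasWeakGradient_schwartz φ))
  exact inner_self_eq_zero.1 (congrFun this f)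

/-! ### The operator associated with the form -/

/-- Turning a submodule into a partial map keeps its graph only if it is single-valued. A pair `(0,
f)` in it has zero gradient by uniqueness, so `f` is orthogonal to the dense space `H¹`. -/
theorem graph_schroedingerOp (v : R3 → ℝ) : (schroedingerOp v).graph = formGraph v := by
  refine Submodule.toLinearPMap_graph_eq _ ?_
  rintro ⟨u, f⟩ ⟨g, hg, h⟩ (rfl : u = 0)
  have hg0 : g = fun _ => 0 := hg.unique hasWeakGradient_zero
  refine eq_zero_of_inner_sobolev fun w k hw => ?_
  rw [← (h w k hw).2, hg0]
  have h0 : (fun x => conj (w x) * ((v x : ℂ) * (0 : L2) x)) =ᵐ[volume] fun _ => (0 : ℂ) := by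
    filter_upwards [Lp.coeFn_zero ℂ 2 (volume : Measure R3)] with x hx
    simp
  simp only [inner_zero_right, Finset.sum_const_zero, zero_add]
  rw [integral_congr_ae h0, integral_zero]

section Potential

variable {W : R3 → ℝ}

theorem lintegral_enorm_sqrt_mul (W : R3 → ℝ) (u : L2) :
    ∫⁻ x, ‖(√|W x| : ℂ) * u x‖ₑ ^ 2 = ∫⁻ x, ENNReal.ofReal |W x| * ‖u x‖ₑ ^ 2 := by
  refine lintegral_congr fun x => ?_
  rw [enorm_mul, mul_pow, enorm_ofReal_complex, Real.enorm_of_nonneg (Real.sqrt_nonneg _),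
    ← ENNReal.ofReal_pow (Real.sqrt_nonneg _), Real.sq_sqrt (abs_nonneg _)]

theorem MemRollnik.aemeasurable_real (hW : MemRollnik fun x => (W x : ℂ)) :
    AEMeasurable W volume := by
  have := Complex.measurable_re.comp_aemeasurable hW.1
  exact this

theorem MemRollnik.memLp_sqrt_mul (hW : MemRollnik fun x => (W x : ℂ)) {u : L2}
    {g : Fin 3 → L2} (hg : HasWeakGradient u g) :
    MemLp (fun x => (√|W x| : ℂ) * u x) 2 volume := by
  have hm : AEMeasurable W volume := hW.aemeasurable_real
  refine ⟨?_, ?_⟩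
  · have h1 : AEMeasurable (fun x => (√|W x| : ℂ)) volume :=
      (Complex.measurable_ofReal.comp (Real.continuous_sqrt.measurable.comp
        measurable_norm)).comp_aemeasurable hm
    exact h1.aestronglyMeasurable.mul (Lp.aestronglyMeasurable u)
  · obtain ⟨b, -, hb⟩ := hW.formBound one_pos
    rw [eLpNorm_lt_top_iff_lintegral_rpow_enorm_lt_top two_ne_zero ENNReal.ofNat_ne_top]
    simp only [ENNReal.toReal_ofNat, ENNReal.rpow_two]
    rw [lintegral_enorm_sqrt_mul]
    exact (hb u g hg).trans_lt ENNReal.ofReal_lt_top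

theorem norm_sq_toLp_sqrt_mul {u : L2} (h : MemLp (fun x => (√|W x| : ℂ) * u x) 2 volume) :
    ENNReal.ofReal (‖h.toLp _‖ ^ 2) = ∫⁻ x, ENNReal.ofReal |W x| * ‖u x‖ₑ ^ 2 := by
  rw [ENNReal.ofReal_pow (norm_nonneg _), ofReal_norm, ← lintegral_enorm_sq,
    ← lintegral_enorm_sqrt_mul]
  refine lintegral_congr_ae ?_
  filter_upwards [h.coeFn_toLp] with x hx
  rw [hx]

/-- Multiplication by the square root of a Rollnik function, from the Sobolev space to `L²`. -/
theorem MemRollnik.exists_sqrtMul (hW : MemRollnik fun x => (W x : ℂ)) :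
    ∃ (S : sobolevGraph →L[ℂ] L2) (b : ℝ), 0 ≤ b ∧
      (∀ q, S q =ᵐ[volume] fun x => (√|W x| : ℂ) * sobolevEmbedding q x) ∧
      ∀ q, ‖S q‖ ^ 2 ≤ 1 / 2 * ‖q‖ ^ 2 + b * ‖sobolevEmbedding q‖ ^ 2 := by
  obtain ⟨b, hb0, hb⟩ := hW.formBound (ε := 1 / 2) (by norm_num)
  have hL := fun q : sobolevGraph => hW.memLp_sqrt_mul (hasWeakGradient_coe q)
  have hn : ∀ q : sobolevGraph, ‖(hL q).toLp _‖ ^ 2 ≤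
      1 / 2 * ‖q‖ ^ 2 + b * ‖sobolevEmbedding q‖ ^ 2 := fun q => by
    have h1 := hb _ _ (hasWeakGradient_coe q)
    rw [← norm_sq_toLp_sqrt_mul (hL q), ENNReal.ofReal_le_ofReal_iff (by positivity)] at h1
    have h2 := norm_sq_sobolev q
    have h3 : 0 ≤ ‖sobolevEmbedding q‖ ^ 2 := by positivity
    linarith
  let S₀ : sobolevGraph →ₗ[ℂ] L2 :=
    { toFun := fun q => (hL q).toLp _
      map_add' := fun p q => by
        refine Lp.ext ?_
        filter_upwards [(hL (p + q)).coeFn_toLp, (hL p).coeFn_toLp, (hL q).coeFn_toLp,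
          Lp.coeFn_add ((hL p).toLp _) ((hL q).toLp _),
          Lp.coeFn_add (sobolevEmbedding p) (sobolevEmbedding q)] with x h1 h2 h3 h4 h5
        rw [h1, h4, Pi.add_apply, h2, h3, map_add, h5, Pi.add_apply, mul_add]
      map_smul' := fun c q => by
        refine Lp.ext ?_
        filter_upwards [(hL (c • q)).coeFn_toLp, (hL q).coeFn_toLp,
          Lp.coeFn_smul c ((hL q).toLp _),
          Lp.coeFn_smul c (sobolevEmbedding q)] with x h1 h2 h3 h4
        rw [h1, RingHom.id_apply, h3, Pi.smul_apply, h2, map_smul, h4, Pi.smul_apply, smul_eq_mul,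
          smul_eq_mul, mul_left_comm] }
  refine ⟨S₀.mkContinuous √(1 / 2 + b) fun q => ?_, b, hb0, fun q => (hL q).coeFn_toLp, hn⟩
  have h1 := hn q
  have h2 : ‖sobolevEmbedding q‖ ^ 2 ≤ ‖q‖ ^ 2 := by
    rw [norm_sq_sobolev q]
    exact le_add_of_nonneg_right (by positivity)
  refine le_of_sq_le_sq ?_ (by positivity)
  rw [mul_pow, Real.sq_sqrt (by positivity)]
  calc _ ≤ 1 / 2 * ‖q‖ ^ 2 + b * ‖sobolevEmbedding q‖ ^ 2 := h1
    _ ≤ 1 / 2 * ‖q‖ ^ 2 + b * ‖q‖ ^ 2 := by gcongr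
    _ = _ := by ring

/-- The form of the potential `v`, `|v| ≤ W`, factorized by means of `√W`. -/
theorem integral_form_eq {S : sobolevGraph →L[ℂ] L2}
    (hS : ∀ q, S q =ᵐ[volume] fun x => (√|W x| : ℂ) * sobolevEmbedding q x) {v : R3 → ℝ}
    (hv : AEStronglyMeasurable (fun x => v x / |W x|) volume) (hvW : ∀ᵐ x, |v x| ≤ W x)
    (w q : sobolevGraph) :
    Integrable (fun x => conj (sobolevEmbedding w x) * ((v x : ℂ) * sobolevEmbedding q x)) volume ∧
      ∫ x, conj (sobolevEmbedding w x) * ((v x : ℂ) * sobolevEmbedding q x) =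
        ⟪S w, mulOp (fun x => v x / |W x|) (S q)⟫_ℂ := by
  have hb : ∀ᵐ x, |(v x / |W x|)| ≤ 1 := by
    filter_upwards [hvW] with x hx
    rw [abs_div, abs_abs]
    exact div_le_one_of_le₀ (hx.trans (le_abs_self _)) (abs_nonneg _)
  have h : (fun x => conj (sobolevEmbedding w x) * ((v x : ℂ) * sobolevEmbedding q x)) =ᵐ[volume]
      fun x => ⟪S w x, mulOp (fun x => v x / |W x|) (S q) x⟫_ℂ := by
    filter_upwards [hS w, hS q, coeFn_mulOp hv hb (S q), hvW] with x h1 h2 h3 h4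
    rw [h3, h1, h2, RCLike.inner_apply]
    simp only [map_mul, Complex.conj_ofReal]
    have h5 : ((v x / |W x| : ℝ) : ℂ) * ((√|W x| : ℂ) * (√|W x| : ℂ)) = (v x : ℂ) := by
      rw [← Complex.ofReal_mul, ← Complex.ofReal_mul, Real.mul_self_sqrt (abs_nonneg _)]
      congr 1
      -- Where `W = 0` the bound forces `v = 0`, so the factorization survives the convention `v / 0
      -- = 0`.
      rcases eq_or_ne (W x) 0 with h0 | h0
      · rw [h0] at h4 ⊢
        rw [abs_nonpos_iff.1 h4]
        simp
      · exact div_mul_cancel₀ _ (abs_ne_zero.2 h0)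
    rw [← h5]
    ring
  refine ⟨(L2.integrable_inner _ _).congr h.symm, ?_⟩
  rw [integral_congr_ae h, L2.inner_def]

theorem mem_graph_schroedingerOp_iff {S : sobolevGraph →L[ℂ] L2}
    (hS : ∀ q, S q =ᵐ[volume] fun x => (√|W x| : ℂ) * sobolevEmbedding q x) {v : R3 → ℝ}
    (hv : AEStronglyMeasurable (fun x => v x / |W x|) volume) (hvW : ∀ᵐ x, |v x| ≤ W x)
    (u f : L2) :
    (u, f) ∈ (schroedingerOp v).graph ↔ ∃ q : sobolevGraph, sobolevEmbedding q = u ∧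
      ∀ w : sobolevGraph, ⟪w, q⟫_ℂ - ⟪sobolevEmbedding w, sobolevEmbedding q⟫_ℂ +
        ⟪S w, mulOp (fun x => v x / |W x|) (S q)⟫_ℂ = ⟪sobolevEmbedding w, f⟫_ℂ := by
  rw [graph_schroedingerOp]
  constructor
  · rintro ⟨g, hg, h⟩
    refine ⟨toSobolev hg, rfl, fun w => ?_⟩
    rw [← (integral_form_eq hS hv hvW w (toSobolev hg)).2, inner_sobolev, add_sub_cancel_left]
    exact (h _ _ (hasWeakGradient_coe w)).2
  · rintro ⟨q, rfl, h⟩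
    refine ⟨_, hasWeakGradient_coe q, fun w k hw => ?_⟩
    obtain ⟨h1, h2⟩ := integral_form_eq hS hv hvW (toSobolev hw) q
    refine ⟨h1, ?_⟩
    have h3 := h (toSobolev hw)
    rw [← h2, inner_sobolev, add_sub_cancel_left] at h3
    exact h3

theorem MemRollnik.formBounded (hW : MemRollnik fun x => (W x : ℂ)) {v : R3 → ℝ}
    (hv : AEMeasurable v volume) (hvW : ∀ᵐ x, |v x| ≤ W x) :
    ∃ a b : ℝ, a < 1 ∧ ∀ (u : L2) (g : Fin 3 → L2), HasWeakGradient u g →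
      Integrable (fun x => |v x| * ‖u x‖ ^ 2) volume ∧
      ∫ x, |v x| * ‖u x‖ ^ 2 ≤ a * ∑ i, ‖g i‖ ^ 2 + b * ‖u‖ ^ 2 := by
  obtain ⟨b, hb0, hb⟩ := hW.formBound (ε := 1 / 2) (by norm_num)
  refine ⟨1 / 2, b, by norm_num, fun u g hg => ?_⟩
  have hm : AEStronglyMeasurable (fun x => |v x| * ‖u x‖ ^ 2) volume := by
    have h1 : AEMeasurable (fun x => |v x|) volume := measurable_norm.comp_aemeasurable hv
    exact h1.aestronglyMeasurable.mul ((Lp.aestronglyMeasurable u).norm.pow 2)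
  have hle : ∫⁻ x, ENNReal.ofReal (|v x| * ‖u x‖ ^ 2) ≤
      ENNReal.ofReal (1 / 2 * ∑ i, ‖g i‖ ^ 2 + b * ‖u‖ ^ 2) := by
    refine le_trans (lintegral_mono_ae ?_) (hb u g hg)
    filter_upwards [hvW] with x hx
    rw [ENNReal.ofReal_mul (abs_nonneg _), ENNReal.ofReal_pow (norm_nonneg _), ofReal_norm]
    exact mul_le_mul_left (ENNReal.ofReal_le_ofReal (hx.trans (le_abs_self _))) _
  have h0 : 0 ≤ᵐ[volume] fun x => |v x| * ‖u x‖ ^ 2 :=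
    Eventually.of_forall fun x => by positivity
  refine ⟨⟨hm, ?_⟩, ?_⟩
  · rw [hasFiniteIntegral_iff_ofReal h0]
    exact hle.trans_lt ENNReal.ofReal_lt_top
  · rw [integral_eq_lintegral_of_nonneg_ae h0 hm]
    exact ENNReal.toReal_le_of_le_ofReal (by positivity) hle

end Potential

/-- Dividing by `|W|` turns the two bounds of the hypothesis into bounds by 1 for the multiplier
`V/|W|` and its time derivative; the singularity of the potential sits entirely in the
time-independent map `S`, multiplication by `√|W|`. -/
theorem smoothFamily_schroedingerOp {V : ℝ → R3 → ℝ} (hV : ∀ t, AEMeasurable (V t) volume)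
    (hV_C1 : ∀ᵐ x : R3, ContDiff ℝ 1 (fun t => V t x))
    (hV_bound : ∀ a b : ℝ, a < b → ∃ W : R3 → ℝ, MemRollnik (fun x => (W x : ℂ)) ∧
      ∀ᵐ x : R3, ∀ t ∈ Ioo a b, |V t x| ≤ W x ∧ |deriv (fun τ => V τ x) t| ≤ W x) :
    SmoothFamily fun t => schroedingerOp (V t) := by
  intro r hr
  obtain ⟨W, hW, hb⟩ := hV_bound (-r) r (by linarith)
  obtain ⟨S, b, hb0, hS, hSn⟩ := hW.exists_sqrtMul
  have hWm : AEMeasurable (fun x => |W x|) volume :=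
    measurable_norm.comp_aemeasurable hW.aemeasurable_real
  have hV' := aemeasurable_deriv_slice hV
    (hV_C1.mono fun x hx => hx.differentiable one_ne_zero)
  have hderiv : ∀ x t, deriv (fun τ => V τ x / |W x|) t = deriv (fun τ => V τ x) t / |W x| :=
    fun x t => deriv_div_const _
  have hm : ∀ t, AEStronglyMeasurable (fun x => V t x / |W x|) volume := fun t =>
    ((hV t).div hWm).aestronglyMeasurable
  have hm' : ∀ t, AEStronglyMeasurable (fun x => deriv (fun τ => V τ x / |W x|) t) volume :=
    fun t => by
      simp_rw [hderiv]
      exact ((hV' t).div hWm).aestronglyMeasurable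
  have hC1 : ∀ᵐ x, ContDiff ℝ 1 fun t => V t x / |W x| := hV_C1.mono fun x hx => hx.div_const _
  have hb1 : ∀ᵐ x, ∀ t ∈ Ioo (-r) r,
      |(V t x / |W x|)| ≤ 1 ∧ |deriv (fun τ => V τ x / |W x|) t| ≤ 1 := by
    filter_upwards [hb] with x hx t ht
    rw [hderiv, abs_div, abs_div, abs_abs]
    exact ⟨div_le_one_of_le₀ ((hx t ht).1.trans (le_abs_self _)) (abs_nonneg _),
      div_le_one_of_le₀ ((hx t ht).2.trans (le_abs_self _)) (abs_nonneg _)⟩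
  refine isSmoothResolvent_of_form (Q := sobolevGraph) isOpen_Ioo (J := sobolevEmbedding) (S := S)
    (M := fun t => mulOp fun x => V t x / |W x|)
    (M' := fun t => mulOp fun x => deriv (fun τ => V τ x / |W x|) t) hb0
    (fun t _ => norm_mulOp_le _) (fun t _ => norm_mulOp_le _) ?_ ?_ ?_ hSn ?_
  · exact fun t ht => inner_mulOp_left (hm t) (hb1.mono fun x hx => (hx t ht).1)
  · exact fun t ht y => hasDerivAt_mulOp hm hm' hC1 hb1 ht y
  · exact fun y => continuousOn_mulOp hm' (hC1.mono fun x hx => hx.continuous_deriv le_rfl)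
      (hb1.mono fun x hx t ht => (hx t ht).2) y
  · exact fun t ht => mem_graph_schroedingerOp_iff hS (hm t) (hb.mono fun x hx => (hx t ht).1)

end RollnikSchroedinger

/-! ### Assembly. -/

theorem mainTheorem10
    (V : ℝ → R3 → ℝ)
    (hV : AEMeasurable (fun p : ℝ × R3 => V p.1 p.2) volume)
    (hV_C1 : ∀ᵐ x : R3, ContDiff ℝ 1 (fun t => V t x))
    (hV_bound : ∀ a b : ℝ, a < b → ∃ W : R3 → ℝ, MemRollnik (fun x => (W x : ℂ)) ∧
      ∀ᵐ x : R3, ∀ t ∈ Ioo a b, |V t x| ≤ W x ∧ |deriv (fun τ => V τ x) t| ≤ W x) :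
    let H : ℝ → L2 →ₗ.[ℂ] L2 := fun t => schroedingerOp (V t)
    let A : ℝ → L2 →ₗ.[ℂ] L2 := fun t => (-Complex.I) • H t
    (∀ t, IsKLMNFormSum (V t) (H t)) ∧
    SohrHypotheses H ∧
    EvolutionConditions A ∧
    EvolutionConditions (fun t => (A t).adjoint) ∧
    BackwardEvolutionConditions (fun t => (A t).adjoint) ∧
    ∃ U : ℝ → ℝ → L2 →L[ℂ] L2, IsUnitaryPropagator U ∧
      ∀ (s : ℝ) (x : L2),
        (IsMildSolution A s x (fun t => U t s x) ∧
          ∀ u : ℝ → L2, IsMildSolution A s x u → u = fun t => U t s x) ∧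
        (IsWeakSolution A s x (fun t => U t s x) ∧
          ∀ u : ℝ → L2, IsWeakSolution A s x u → u = fun t => U t s x) := by
  intro H A
  have hVm : ∀ t, AEMeasurable (V t) volume :=
    aemeasurable_slice hV (hV_C1.mono fun x hx => hx.continuous)
  have hfam : SmoothFamily H := smoothFamily_schroedingerOp hVm hV_C1 hV_bound
  refine ⟨fun t => ?_, hfam.sohrHypotheses, hfam.main⟩
  obtain ⟨W, hW, hb⟩ := hV_bound (t - 1) (t + 1) (by linarith)
  obtain ⟨β, R, hR⟩ := hfam.exists_isPosResolvent t
  exact ⟨hW.formBounded (hVm t)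
    (hb.mono fun x hx => (hx t ⟨by linarith, by linarith⟩).1), hR.isSelfAdjoint,
    graph_schroedingerOp _⟩
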